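/- Let $\alpha\le -2$, and let $\gamma=(x,z)\colon I\to\mathbb R^2\setminus\{(0,0)\}$, with $0\in I\subset\mathbb R$ an open interval, be a maximal solution of the system describing the arc-length parametrized generating curves, in the $(x,z)$-plane, of surfaces of revolution about the $z$-axis that satisfy $H=\alpha\langle\nu,p\rangle/|p|^2$, $$x'=\cos\psi,\qquad z'=\sin\psi,\qquad \psi'=\alpha\,\frac{z\cos\psi-x\sin\psi}{x^2+z^2}-\frac{\sin\psi}{x},$$ with initial conditions $x(0)=0$, $z(0)=1$, $\psi(0)=0$. Here $\psi$ is of class $C^1$ on all of $I$, the third equation is required at the points where $x\neq0$ (so at points of the axis $x=0$ it holds in the limit), and maximal means that the solution does not extend to a larger open interval. If $\alpha<-2$, then $\gamma$ is injective, $\gamma(I)\cup\{(0,0)\}$ is an embedded closed curve (the image of a topological embedding of the circle), and this set is a smooth ($C^\infty$) embedded curve near $(0,0)$ if and only if $\alpha=-4$. Moreover: 1. If $\alpha=-2$, then $\gamma(I)$ is the circle of radius $1$ centred at $(0,0)$. 2. If $-4<\alpha<-2$, then $\gamma$ has points in both half-planes $z>0$ and $z<0$. 3. If $\alpha=-4$,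 then $\gamma(I)\cup\{(0,0)\}$ is the circle of radius $\frac12$ centred at $(0,\frac12)$. 4. If $\alpha<-4$, then $\gamma(I)$ is contained in the half-plane $z>0$ and is a bigraph on the $z$-axis: there are an interval $J\subset\mathbb R$ with non-empty interior and a continuous function $f\colon J\to\mathbb R$, smooth and positive in the interior of $J$, such that $\gamma(I)=\{(x,z): z\in J,\ x=\pm f(z)\}$. -/

import Mathlib

open Set
open scoped ContDiff Topology

namespace StationaryCurve

/-- `(x, z, ψ)` on the interval `I` is a solution of the generating-curve system of rotational
`α`-stationary surfaces about the `z`-axis,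
`x' = cos ψ`, `z' = sin ψ`, `ψ' = α (z cos ψ - x sin ψ) / (x² + z²) - sin ψ / x`,
with `(x(0), z(0)) = (0, 1)` and `ψ(0) = 0`.
The curve stays in the plane minus the origin.  The third equation is singular on the axis `x = 0`
(in particular at `s = 0`); there the requirement is that `ψ` is still of class `C¹`, so that the
third equation holds there in the limit. -/
structure IsSolution (α : ℝ) (I : Set ℝ) (x z ψ : ℝ → ℝ) : Prop where
  isOpen : IsOpen I
  ordConnected : I.OrdConnected
  zero_mem : 0 ∈ I
  x_zero : x 0 = 0
  z_zero : z 0 = 1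
  ψ_zero : ψ 0 = 0
  ne_origin : ∀ s ∈ I, (x s, z s) ≠ (0, 0)
  x_deriv : ∀ s ∈ I, HasDerivAt x (Real.cos (ψ s)) s
  z_deriv : ∀ s ∈ I, HasDerivAt z (Real.sin (ψ s)) s
  ψ_contDiffOn : ContDiffOn ℝ 1 ψ I
  ψ_deriv : ∀ s ∈ I, x s ≠ 0 →
    HasDerivAt ψ (α * ((z s * Real.cos (ψ s) - x s * Real.sin (ψ s)) / (x s ^ 2 + z s ^ 2))
      - Real.sin (ψ s) / x s) s

/-- A solution that has no extension to a strictly larger interval. -/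
def IsMaximalSolution (α : ℝ) (I : Set ℝ) (x z ψ : ℝ → ℝ) : Prop :=
  IsSolution α I x z ψ ∧
    ∀ (I' : Set ℝ) (x' z' ψ' : ℝ → ℝ), IsSolution α I' x' z' ψ' → I ⊆ I' →
      EqOn x' x I → EqOn z' z I → EqOn ψ' ψ I → I' = I

/-- An embedded (simple) closed curve in the plane: the image of a topological embedding of the
circle. -/
def IsEmbeddedClosedCurve (S : Set (ℝ × ℝ)) : Prop :=
  ∃ c : Circle → ℝ × ℝ, Topology.IsEmbedding c ∧ range c = S

/-- `S` is a smooth (`C^∞`) embedded curve near its point `p`: on a neighbourhood of `p` it is the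
zero set of a smooth function whose differential at `p` is nonzero. -/
def IsSmoothCurveAt (S : Set (ℝ × ℝ)) (p : ℝ × ℝ) : Prop :=
  p ∈ S ∧ ∃ (U : Set (ℝ × ℝ)) (F : ℝ × ℝ → ℝ), IsOpen U ∧ p ∈ U ∧ ContDiffOn ℝ ∞ F U ∧
    fderiv ℝ F p ≠ 0 ∧ ∀ q ∈ U, q ∈ S ↔ F q = 0

/-- `S` is a bigraph on the `z`-axis (the second coordinate axis): it is the union of the two
graphs `x = f(z)` and `x = -f(z)` over an interval `J` of the `z`-axis, where `f` is continuous on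
`J`, and smooth and positive in the interior of `J`. -/
def IsBigraph (S : Set (ℝ × ℝ)) : Prop :=
  ∃ (J : Set ℝ) (f : ℝ → ℝ), J.OrdConnected ∧ (interior J).Nonempty ∧ ContinuousOn f J ∧
    ContDiffOn ℝ ∞ f (interior J) ∧ (∀ t ∈ interior J, 0 < f t) ∧
    S = {p | p.2 ∈ J ∧ (p.1 = f p.2 ∨ p.1 = -f p.2)}

end StationaryCurve

/-!
In polar form the system is autonomous up to scale.  Let `r` be the distance to the origin, `(a, b)`
the unit position vector, and `(S, C)` the components of the unit tangent vector along the radial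
direction `(a, b)` and along `(b, -a)`.  With `m = α + 2`, a prime for the derivative in arc length
and `x > 0`, one has `r' = S`, and the direction `(a, b, S, C)` moves by a planar flow run at speed
`1 / r`.  The product `p = a * S` vanishes on the axis and satisfies `r * p' = m * a * C²`.  Hence,
for `α < -2`, it decreases from `0` on `s > 0`: the curve cannot return to the axis, `r` decreases
strictly (so the curve is injective), and the solution lives for a finite time only.  As long as `r`
is bounded below the solution stays in a compact part of `x > 0` and can be continued, so a maximal
solution tends to the origin (`IsMaximalSolution.tendsto_rad`).  Uniqueness, including at the
singular initial point (`IsSolution.eq_of_mem`), makes the solution symmetric about the `z`-axis,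
and adding the origin closes it up (`IsMaximalSolution.isEmbeddedClosedCurve`).

A Lyapunov function shows `p → -1` (`PolarFlow.tendsto_p`): the curve becomes radial and horizontal
at the origin, which is the equilibrium `a = 1`, `S = -1` of the planar flow.  Its nature depends
on `n = m + 2 = α + 4`.  The height `k = z / r² = b / r` of the inverted curve and
`y = r * k' = -(S * b + C * a) / r` satisfy asymptotically, in the time `-log r`, the linear system
`k˙ = y`, `y˙ = -n * k + n * y`.

* For `-4 < α < -2`, that is `0 < n < 2`, this is a growing spiral, so `z` changes sign
  (`PolarFlow.exists_b_neg`) and `(k, y)` is unbounded (`PolarFlow.not_bounded_of_gt`).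
* For `α < -4` the quadrant `k > 0`, `y > 0` is invariant (`PolarFlow.y_pos`), so `z > 0`, and `z`
  is monotone on each half of the curve (`PolarFlow.slope_neg`), which gives the bigraph; and again
  `(k, y)` is unbounded (`PolarFlow.not_bounded_of_lt`).
* A curve that is smooth at the origin has `(k, y)` bounded there
  (`IsMaximalSolution.eq_neg_four`), so smoothness forces `α = -4`.

For `α = -4` and `α = -2` the solutions are explicit circles; the first is identified by
uniqueness, the second by the conservation law `p = 0`.
-/

namespace StationaryCurve

open Filter

/-! ### Sign and growth lemmas for differentiable functions of one variable -/

theorem eventually_lt_left_of_hasDerivAt_pos {f : ℝ → ℝ} {f' t : ℝ} (h : HasDerivAt f f' t)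
    (hf' : 0 < f') : ∀ᶠ s in 𝓝[<] t, f s < f t := by
  have h1 := (hasDerivAt_iff_tendsto_slope.1 h).eventually (lt_mem_nhds hf')
  have h2 : 𝓝[<] t ≤ 𝓝[≠] t := nhdsWithin_mono _ fun s hs => ne_of_lt hs
  filter_upwards [h2 h1, self_mem_nhdsWithin] with s hs hst
  rw [slope_def_field] at hs
  have h3 : s - t < 0 := sub_neg.2 hst
  rcases div_pos_iff.1 hs with h | h
  · linarith [h.2]
  · linarith [h.1]

/-- The first zero of a continuous function that is positive at `u` and nonpositive at `v`. -/
theorem exists_first_zero {f : ℝ → ℝ} {u v : ℝ} (huv : u ≤ v) (hf : ContinuousOn f (Icc u v))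
    (hu : 0 < f u) (hv : f v ≤ 0) :
    ∃ t ∈ Ioc u v, f t = 0 ∧ ∀ s ∈ Ico u t, 0 < f s := by
  have hclosed : IsClosed (Icc u v ∩ f ⁻¹' Iic 0) :=
    hf.preimage_isClosed_of_isClosed isClosed_Icc isClosed_Iic
  have hne : (Icc u v ∩ f ⁻¹' Iic 0).Nonempty := ⟨v, ⟨huv, le_rfl⟩, hv⟩
  have hbdd : BddBelow (Icc u v ∩ f ⁻¹' Iic 0) := ⟨u, fun s hs => hs.1.1⟩
  set t := sInf (Icc u v ∩ f ⁻¹' Iic 0) with ht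
  have htm : t ∈ Icc u v ∩ f ⁻¹' Iic 0 := hclosed.csInf_mem hne hbdd
  have hft : f t ≤ 0 := htm.2
  have hut : u < t := by
    rcases eq_or_lt_of_le htm.1.1 with h | h
    · rw [← h] at hft; linarith
    · exact h
  have hbefore : ∀ s ∈ Ico u t, 0 < f s := by
    intro s hs
    by_contra hcon
    exact absurd (csInf_le hbdd ⟨⟨hs.1, hs.2.le.trans htm.1.2⟩, not_lt.1 hcon⟩) (not_le.2 hs.2)
  refine ⟨t, ⟨hut, htm.1.2⟩, le_antisymm hft ?_, hbefore⟩
  have hcw : Tendsto f (𝓝[Ico u t] t) (𝓝 (f t)) :=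
    (hf t htm.1).mono_left (nhdsWithin_mono _ fun s hs => ⟨hs.1, hs.2.le.trans htm.1.2⟩)
  have : (𝓝[Ico u t] t).NeBot := by
    rw [← mem_closure_iff_nhdsWithin_neBot, closure_Ico hut.ne]
    exact ⟨hut.le, le_rfl⟩
  exact ge_of_tendsto hcw (eventually_mem_nhdsWithin.mono fun s hs => (hbefore s hs).le)

/-- A function that increases wherever it is nonpositive, and starts at `0`, is positive. -/
theorem pos_of_hasDerivAt_pos_of_nonpos {f : ℝ → ℝ} {T : ℝ} (hf : ContinuousOn f (Ico 0 T))
    (h0 : f 0 = 0) (hd : ∀ s ∈ Ioo 0 T, f s ≤ 0 → ∃ f' > 0, HasDerivAt f f' s) :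
    ∀ s ∈ Ioo 0 T, 0 < f s := by
  intro s hs
  by_contra hcon
  have hcon : f s ≤ 0 := not_lt.1 hcon
  have key : ∀ t ∈ Ioo 0 T, f t ≤ 0 → ¬ ∀ u ∈ Icc 0 t, f t ≤ f u := by
    intro t ht hft hmin
    obtain ⟨f', hf', hder⟩ := hd t ht hft
    have h1 := eventually_lt_left_of_hasDerivAt_pos hder hf'
    have h2 : ∀ᶠ u in 𝓝[<] t, u ∈ Ioo 0 t := Ioo_mem_nhdsLT ht.1
    obtain ⟨u, hu1, hu2⟩ := (h1.and h2).exists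
    linarith [hmin u ⟨hu2.1.le, hu2.2.le⟩]
  obtain ⟨t, ht, hmin⟩ := isCompact_Icc.exists_isMinOn (nonempty_Icc.2 hs.1.le)
    (hf.mono fun u hu => ⟨hu.1, hu.2.trans_lt hs.2⟩)
  have hmin' : ∀ u ∈ Icc 0 s, f t ≤ f u := fun u hu => hmin hu
  rcases eq_or_lt_of_le ht.1 with h | h
  · refine key s hs hcon fun u hu => ?_
    have := hmin' u hu
    rw [← h, h0] at this
    linarith
  · exact key t ⟨h, ht.2.trans_lt hs.2⟩ ((hmin' s ⟨hs.1.le, le_rfl⟩).trans hcon)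
      fun u hu => hmin' u ⟨hu.1, hu.2.trans ht.2⟩

/-- If `r` decreases to `0` at speed at most one, then `-log r` is a clock that runs to infinity,
and a function that grows at least at a fixed rate with respect to it is unbounded. -/
theorem tendsto_atTop_of_clock {r S f f' : ℝ → ℝ} {c t T : ℝ} (htT : t < T) (hc : 0 < c)
    (hr : ∀ s ∈ Ioo t T, 0 < r s) (hrd : ∀ s ∈ Ioo t T, HasDerivAt r (S s) s)
    (hS : ∀ s ∈ Ioo t T, -1 ≤ S s) (hlim : Tendsto r (𝓝[<] T) (𝓝 0))
    (hf : ∀ s ∈ Ioo t T, HasDerivAt f (f' s) s) (hf' : ∀ s ∈ Ioo t T, c / r s ≤ f' s) :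
    Tendsto f (𝓝[<] T) atTop := by
  have hd : ∀ s ∈ Ioo t T, HasDerivAt (fun s => f s + c * Real.log (r s))
      (f' s + c * (S s / r s)) s := fun s hs =>
    (hf s hs).add (((hrd s hs).log (hr s hs).ne').const_mul c)
  have hmono : MonotoneOn (fun s => f s + c * Real.log (r s)) (Ioo t T) := by
    refine monotoneOn_of_deriv_nonneg (convex_Ioo t T)
      (fun s hs => (hd s hs).continuousAt.continuousWithinAt)
      (fun s hs => ?_) (fun s hs => ?_)
    · rw [interior_Ioo] at hs
      exact (hd s hs).differentiableAt.differentiableWithinAt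
    · rw [interior_Ioo] at hs
      rw [(hd s hs).deriv]
      have h1 := hf' s hs
      have h2 : c * (-1 / r s) ≤ c * (S s / r s) :=
        mul_le_mul_of_nonneg_left (div_le_div_of_nonneg_right (hS s hs) (hr s hs).le) hc.le
      have h3 : c * (-1 / r s) = -(c / r s) := by ring
      linarith
  obtain ⟨u, hu⟩ : (Ioo t T).Nonempty := nonempty_Ioo.2 htT
  have hev : ∀ᶠ s in 𝓝[<] T, s ∈ Ioo u T := Ioo_mem_nhdsLT hu.2
  have hlim' : Tendsto r (𝓝[<] T) (𝓝[>] 0) :=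
    tendsto_nhdsWithin_iff.2 ⟨hlim, hev.mono fun s hs => hr s ⟨hu.1.trans hs.1, hs.2⟩⟩
  have hlog : Tendsto (fun s => -Real.log (r s)) (𝓝[<] T) atTop :=
    tendsto_neg_atBot_atTop.comp (Real.tendsto_log_nhdsGT_zero.comp hlim')
  have h1 : Tendsto (fun s => (f u + c * Real.log (r u)) + c * -Real.log (r s)) (𝓝[<] T) atTop :=
    tendsto_atTop_add_const_left _ _ (hlog.const_mul_atTop hc)
  refine tendsto_atTop_mono' _ (hev.mono fun s hs => ?_) h1
  have := hmono hu ⟨hu.1.trans hs.1, hs.2⟩ hs.1.le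
  simp only at this
  linarith

theorem tendsto_zero_of_sq {f g : ℝ → ℝ} {l : Filter ℝ} {c : ℝ} (hc : c ^ 2 = 1)
    (hg : Tendsto g l (𝓝 c)) (h : ∀ᶠ s in l, f s ^ 2 = 1 - g s ^ 2) : Tendsto f l (𝓝 0) := by
  have h1 : Tendsto (fun s => 1 - g s ^ 2) l (𝓝 0) := by
    have := (hg.pow 2).const_sub 1
    rwa [hc, sub_self] at this
  have h2 : Tendsto (fun s => f s ^ 2) l (𝓝 0) := h1.congr' (h.mono fun s hs => hs.symm)
  have h3 : Tendsto (fun s => √(f s ^ 2)) l (𝓝 0) := by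
    have := h2.sqrt
    rwa [Real.sqrt_zero] at this
  simp only [Real.sqrt_sq_eq_abs] at h3
  exact (tendsto_zero_iff_abs_tendsto_zero f).2 h3

/-! ### The generating-curve system in polar form -/

/-- The generating-curve system on a half-open interval `[0, T)` in polar form, for a curve that
stays in `x > 0`.  Here `r` is the distance to the origin, `(a, b)` is the unit position vector,
and `(S, C)` are the sine and the cosine of the angle from the unit tangential direction `(b, -a)`
to the unit tangent vector; `m` stands for `α + 2`. -/
structure PolarFlow (m T : ℝ) (r a b S C : ℝ → ℝ) : Prop where
  T_pos : 0 < T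
  r_cont : ContinuousOn r (Ico 0 T)
  a_cont : ContinuousOn a (Ico 0 T)
  b_cont : ContinuousOn b (Ico 0 T)
  S_cont : ContinuousOn S (Ico 0 T)
  C_cont : ContinuousOn C (Ico 0 T)
  r_zero : r 0 = 1
  a_zero : a 0 = 0
  b_zero : b 0 = 1
  S_zero : S 0 = 0
  C_zero : C 0 = 1
  r_pos : ∀ s ∈ Ico 0 T, 0 < r s
  a_pos : ∀ s ∈ Ioo 0 T, 0 < a s
  pos_sq : ∀ s ∈ Ico 0 T, a s ^ 2 + b s ^ 2 = 1
  tan_sq : ∀ s ∈ Ico 0 T, S s ^ 2 + C s ^ 2 = 1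
  r_deriv : ∀ s ∈ Ioo 0 T, HasDerivAt r (S s) s
  a_deriv : ∀ s ∈ Ioo 0 T, HasDerivAt a (b s * C s / r s) s
  b_deriv : ∀ s ∈ Ioo 0 T, HasDerivAt b (-(a s * C s / r s)) s
  S_deriv : ∀ s ∈ Ioo 0 T, HasDerivAt S (C s * (m * C s - b s * S s / a s) / r s) s
  C_deriv : ∀ s ∈ Ioo 0 T, HasDerivAt C (-(S s * (m * C s - b s * S s / a s) / r s)) s

namespace PolarFlow

variable {m T : ℝ} {r a b S C : ℝ → ℝ}

/-- The monotone quantity `p = a * S`, which controls the return to the axis. -/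
theorem p_deriv (h : PolarFlow m T r a b S C) {s : ℝ} (hs : s ∈ Ioo 0 T) :
    HasDerivAt (fun s => a s * S s) (m * a s * C s ^ 2 / r s) s := by
  have hr := (h.r_pos s ⟨hs.1.le, hs.2⟩).ne'
  have ha := (h.a_pos s hs).ne'
  refine ((h.a_deriv s hs).mul (h.S_deriv s hs)).congr_deriv ?_
  field_simp
  ring

theorem p_cont (h : PolarFlow m T r a b S C) : ContinuousOn (fun s => a s * S s) (Ico 0 T) :=
  h.a_cont.mul h.S_cont

theorem p_antitone (h : PolarFlow m T r a b S C) (hm : m ≤ 0) :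
    AntitoneOn (fun s => a s * S s) (Ico 0 T) := by
  refine antitoneOn_of_deriv_nonpos (convex_Ico 0 T) h.p_cont (fun s hs => ?_) (fun s hs => ?_)
  · rw [interior_Ico] at hs
    exact (h.p_deriv hs).differentiableAt.differentiableWithinAt
  · rw [interior_Ico] at hs
    rw [(h.p_deriv hs).deriv]
    have h1 := h.r_pos s ⟨hs.1.le, hs.2⟩
    have h2 := h.a_pos s hs
    refine div_nonpos_of_nonpos_of_nonneg ?_ h1.le
    nlinarith [mul_nonneg (mul_nonneg (neg_nonneg.2 hm) h2.le) (sq_nonneg (C s))]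

/-- If `a * S` vanished at some positive time it would vanish before, so `C` would vanish there,
against `C 0 = 1`. -/
theorem p_neg (h : PolarFlow m T r a b S C) (hm : m < 0) : ∀ s ∈ Ioo 0 T, a s * S s < 0 := by
  intro s hs
  have hanti := h.p_antitone hm.le
  have h0 : a 0 * S 0 = 0 := by rw [h.a_zero, zero_mul]
  by_contra hcon
  have hcon : 0 ≤ a s * S s := not_lt.1 hcon
  have hz : ∀ u ∈ Ioo 0 s, a u * S u = 0 := by
    intro u hu
    have h1 := hanti ⟨le_rfl, h.T_pos⟩ ⟨hu.1.le, hu.2.trans hs.2⟩ hu.1.le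
    have h2 := hanti ⟨hu.1.le, hu.2.trans hs.2⟩ ⟨hs.1.le, hs.2⟩ hu.2.le
    simp only at h1 h2
    linarith
  have hC : ∀ u ∈ Ioo 0 s, C u = 0 := by
    intro u hu
    have huT : u ∈ Ioo 0 T := ⟨hu.1, hu.2.trans hs.2⟩
    have h1 : HasDerivAt (fun s => a s * S s) 0 u := by
      refine (hasDerivAt_const u (0 : ℝ)).congr_of_eventuallyEq ?_
      filter_upwards [Ioo_mem_nhds hu.1 hu.2] with v hv using hz v hv
    have h2 := (h.p_deriv huT).unique h1
    have hr := (h.r_pos u ⟨hu.1.le, huT.2⟩).ne'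
    have ha := (h.a_pos u huT).ne'
    simpa [hm.ne, hr, ha] using h2
  have hlim : Tendsto C (𝓝[Ioo 0 s] 0) (𝓝 (C 0)) :=
    (h.C_cont 0 ⟨le_rfl, h.T_pos⟩).mono_left
      (nhdsWithin_mono _ fun u hu => ⟨hu.1.le, hu.2.trans hs.2⟩)
  have hne : (𝓝[Ioo 0 s] (0 : ℝ)).NeBot := by
    rw [← mem_closure_iff_nhdsWithin_neBot, closure_Ioo hs.1.ne]
    exact ⟨le_rfl, hs.1.le⟩
  have hlim0 : Tendsto C (𝓝[Ioo 0 s] 0) (𝓝 0) :=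
    tendsto_const_nhds.congr' (eventually_mem_nhdsWithin.mono fun u hu => (hC u hu).symm)
  have := tendsto_nhds_unique hlim hlim0
  rw [h.C_zero] at this
  exact one_ne_zero this

theorem S_neg (h : PolarFlow m T r a b S C) (hm : m < 0) : ∀ s ∈ Ioo 0 T, S s < 0 := by
  intro s hs
  by_contra hcon
  have := mul_nonneg (h.a_pos s hs).le (not_lt.1 hcon)
  linarith [h.p_neg hm s hs]

theorem r_strictAnti (h : PolarFlow m T r a b S C) (hm : m < 0) : StrictAntiOn r (Ico 0 T) := by
  refine strictAntiOn_of_deriv_neg (convex_Ico 0 T) h.r_cont fun s hs => ?_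
  rw [interior_Ico] at hs
  rw [(h.r_deriv s hs).deriv]
  exact h.S_neg hm s hs

theorem a_le_one (h : PolarFlow m T r a b S C) {s : ℝ} (hs : s ∈ Ico 0 T) : a s ≤ 1 := by
  nlinarith [h.pos_sq s hs, sq_nonneg (b s), sq_nonneg (a s - 1)]

theorem neg_one_le_S (h : PolarFlow m T r a b S C) {s : ℝ} (hs : s ∈ Ico 0 T) : -1 ≤ S s := by
  nlinarith [h.tan_sq s hs, sq_nonneg (C s), sq_nonneg (S s + 1)]

/-- The equilibrium `a = 1`, `S = -1` is not reached in finite time. -/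
theorem neg_one_lt_p (h : PolarFlow m T r a b S C) (hm : m < 0) :
    ∀ s ∈ Ioo 0 T, -1 < a s * S s := by
  intro s hs
  by_contra hcon
  have hcon : a s * S s ≤ -1 := not_lt.1 hcon
  set K := -2 * m / r s with hK
  have hsI : s ∈ Ico 0 T := ⟨hs.1.le, hs.2⟩
  have hd : ∀ u ∈ Ioo 0 s, HasDerivAt (fun u => (1 + a u * S u) * Real.exp (K * u))
      ((m * a u * C u ^ 2 / r u + K * (1 + a u * S u)) * Real.exp (K * u)) u := by
    intro u hu
    have h1 := ((h.p_deriv ⟨hu.1, hu.2.trans hs.2⟩).const_add 1).mul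
      (((hasDerivAt_id u).const_mul K).exp)
    refine h1.congr_deriv ?_
    simp only [id]
    ring
  have hmono : MonotoneOn (fun u => (1 + a u * S u) * Real.exp (K * u)) (Icc 0 s) := by
    refine monotoneOn_of_deriv_nonneg (convex_Icc 0 s) ?_ (fun u hu => ?_) (fun u hu => ?_)
    · have : ContinuousOn (fun s => a s * S s) (Icc 0 s) :=
        h.p_cont.mono fun u hu => ⟨hu.1, hu.2.trans_lt hs.2⟩
      fun_prop
    · rw [interior_Icc] at hu
      exact (hd u hu).differentiableAt.differentiableWithinAt
    · rw [interior_Icc] at hu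
      have huI : u ∈ Ico 0 T := ⟨hu.1.le, hu.2.trans hs.2⟩
      rw [(hd u hu).deriv]
      refine mul_nonneg ?_ (Real.exp_pos _).le
      have hr := h.r_pos u huI
      have hrs := h.r_pos s hsI
      have hle : r s ≤ r u := (h.r_strictAnti hm).antitoneOn huI hsI hu.2.le
      have ha1 := h.a_le_one huI
      have ha0 := h.a_pos u ⟨hu.1, huI.2⟩
      have hS := h.neg_one_le_S huI
      have hpneg := h.p_neg hm u ⟨hu.1, huI.2⟩
      have hSneg := h.S_neg hm u ⟨hu.1, huI.2⟩
      have hp1 : 0 ≤ 1 + a u * S u := by nlinarith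
      have hC : C u ^ 2 ≤ 2 * (1 + a u * S u) := by
        have h1 := h.tan_sq u huI
        have : (a u * S u) ^ 2 ≤ S u ^ 2 := by
          rw [mul_pow]; nlinarith [sq_nonneg (S u), mul_le_one₀ ha1 ha0.le ha1]
        nlinarith
      have h1 : a u * C u ^ 2 ≤ 2 * (1 + a u * S u) := by nlinarith [sq_nonneg (C u)]
      have h2 : a u * C u ^ 2 / r u ≤ 2 * (1 + a u * S u) / r s :=
        div_le_div₀ (by linarith) h1 hrs hle
      have h3 : m * a u * C u ^ 2 / r u + K * (1 + a u * S u)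
          = -m * (2 * (1 + a u * S u) / r s - a u * C u ^ 2 / r u) := by
        rw [hK]; ring
      rw [h3]
      exact mul_nonneg (by linarith) (by linarith)
  have h1 := hmono ⟨le_rfl, hs.1.le⟩ ⟨hs.1.le, le_rfl⟩ hs.1.le
  simp only [h.a_zero, zero_mul, mul_zero, add_zero, Real.exp_zero, one_mul] at h1
  have h2 : (1 + a s * S s) * Real.exp (K * s) ≤ 0 :=
    mul_nonpos_of_nonpos_of_nonneg (by linarith) (Real.exp_pos _).le
  linarith

theorem bC_deriv (h : PolarFlow m T r a b S C) {s : ℝ} (hs : s ∈ Ioo 0 T) :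
    HasDerivAt (fun s => b s * C s)
      ((-(a s * C s ^ 2) - m * b s * C s * S s + b s ^ 2 / a s * S s ^ 2) / r s) s := by
  have hr := (h.r_pos s ⟨hs.1.le, hs.2⟩).ne'
  have ha := (h.a_pos s hs).ne'
  refine ((h.b_deriv s hs).mul (h.C_deriv s hs)).congr_deriv ?_
  field_simp
  ring

/-- The dissipation of `a * S - ε * (b * C)` dominates a multiple of `b² + C²`, which is
at least `1 - (a * S)²`. -/
theorem dissipation_bound {m κ ε c η a b S C : ℝ} (hm : m < 0) (hκ : 0 < κ) (hε : 0 < ε)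
    (ha : κ ≤ a) (ha1 : a ≤ 1) (hS : S ≤ -κ)
    (hpos : a ^ 2 + b ^ 2 = 1) (htan : S ^ 2 + C ^ 2 = 1) (hp : η ≤ 1 - (a * S) ^ 2)
    (hεeq : ε * (1 + m ^ 2 / (2 * κ ^ 2)) = -m * κ / 2) (hc : 0 ≤ c) (hc1 : c ≤ -m * κ / 2)
    (hc2 : c ≤ ε * κ ^ 2 / 2) :
    c * η ≤ ε * (-(a * C ^ 2) - m * b * C * S + b ^ 2 / a * S ^ 2) - m * a * C ^ 2 := by
  have ha0 : 0 < a := hκ.trans_le ha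
  have e1 : b ^ 2 * κ ^ 2 ≤ b ^ 2 / a * S ^ 2 := by
    have h1 : κ ^ 2 ≤ S ^ 2 := by nlinarith
    have h3 : b ^ 2 ≤ b ^ 2 / a := by
      rw [le_div_iff₀ ha0]; nlinarith [sq_nonneg b]
    exact mul_le_mul h3 h1 (by positivity) (by positivity)
  have e2 : m * b * C * S ≤ κ ^ 2 / 2 * b ^ 2 + m ^ 2 / (2 * κ ^ 2) * C ^ 2 := by
    have h4 : 0 ≤ (κ * b - (m * S) * C / κ) ^ 2 := sq_nonneg _
    have h5 : (κ * b - (m * S) * C / κ) ^ 2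
        = κ ^ 2 * b ^ 2 - 2 * (m * b * C * S) + 2 * (m ^ 2 / (2 * κ ^ 2) * C ^ 2) * S ^ 2 := by
      field_simp; ring
    have h6 : 0 ≤ m ^ 2 / (2 * κ ^ 2) * C ^ 2 := by positivity
    have h7 : S ^ 2 ≤ 1 := by linarith [sq_nonneg C]
    have h8 := mul_le_mul_of_nonneg_left h7 h6
    linarith
  have e3 : η ≤ b ^ 2 + C ^ 2 := by
    have h4 : (a * S) ^ 2 = (1 - b ^ 2) * (1 - C ^ 2) := by
      rw [mul_pow, show 1 - b ^ 2 = a ^ 2 by linarith, show 1 - C ^ 2 = S ^ 2 by linarith]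
    rw [h4] at hp
    linarith [mul_nonneg (sq_nonneg b) (sq_nonneg C)]
  have h8 : ε * (a * C ^ 2) ≤ ε * C ^ 2 :=
    mul_le_mul_of_nonneg_left (mul_le_of_le_one_left (sq_nonneg C) ha1) hε.le
  have h9 : -m * κ * C ^ 2 ≤ -m * a * C ^ 2 :=
    mul_le_mul_of_nonneg_right (mul_le_mul_of_nonneg_left ha (by linarith)) (sq_nonneg _)
  have h10 := mul_le_mul_of_nonneg_left e1 hε.le
  have h11 := mul_le_mul_of_nonneg_left e2 hε.le
  have h12 : c * η ≤ c * (b ^ 2 + C ^ 2) := mul_le_mul_of_nonneg_left e3 hc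
  have h13 : c * C ^ 2 ≤ -m * κ / 2 * C ^ 2 := mul_le_mul_of_nonneg_right hc1 (sq_nonneg _)
  have h14 : c * b ^ 2 ≤ ε * κ ^ 2 / 2 * b ^ 2 := mul_le_mul_of_nonneg_right hc2 (sq_nonneg _)
  have h15 : ε * (1 + m ^ 2 / (2 * κ ^ 2)) * C ^ 2 = -m * κ / 2 * C ^ 2 := by rw [hεeq]
  linarith

/-- The curve approaches the origin tangentially to the plane `z = 0`: `a * S` tends to `-1`.
The function `a * S - ε * (b * C)` decreases along the flow at a rate, in the time `-log r`, that
is bounded below by a multiple of `b² + C² ≥ 1 - (a * S)²`, while it stays bounded. -/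
theorem tendsto_p (h : PolarFlow m T r a b S C) (hm : m < 0)
    (hlim : Tendsto r (𝓝[<] T) (𝓝 0)) : Tendsto (fun s => a s * S s) (𝓝[<] T) (𝓝 (-1)) := by
  have hT := h.T_pos
  have h2T : T / 2 ∈ Ioo 0 T := ⟨by linarith, by linarith⟩
  have hanti := h.p_antitone hm.le
  obtain ⟨κ, hκ⟩ : ∃ κ, κ = -(a (T / 2) * S (T / 2)) := ⟨_, rfl⟩
  have hκ0 : 0 < κ := by rw [hκ]; linarith [h.p_neg hm _ h2T]
  have hpκ : ∀ s ∈ Ioo (T / 2) T, a s * S s ≤ -κ := by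
    intro s hs
    have := hanti ⟨h2T.1.le, h2T.2⟩ ⟨h2T.1.le.trans hs.1.le, hs.2⟩ hs.1.le
    simp only at this
    linarith
  have key : ∀ η > 0, ∃ s ∈ Ioo (T / 2) T, a s * S s < -1 + η := by
    intro η hη
    by_contra hcon
    push Not at hcon
    obtain ⟨ε, hε⟩ : ∃ ε, ε = (-m * κ / 2) / (1 + m ^ 2 / (2 * κ ^ 2)) := ⟨_, rfl⟩
    have hden : 0 < 1 + m ^ 2 / (2 * κ ^ 2) := by positivity
    have hε0 : 0 < ε := by
      rw [hε]; exact div_pos (by nlinarith) hden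
    have hεeq : ε * (1 + m ^ 2 / (2 * κ ^ 2)) = -m * κ / 2 := by
      rw [hε]; exact div_mul_cancel₀ _ hden.ne'
    obtain ⟨c, hc⟩ : ∃ c, c = min (-m * κ / 2) (ε * κ ^ 2 / 2) := ⟨_, rfl⟩
    have hc0 : 0 < c := by
      rw [hc]; exact lt_min (by nlinarith) (by positivity)
    have hc1 : c ≤ -m * κ / 2 := hc ▸ min_le_left _ _
    have hc2 : c ≤ ε * κ ^ 2 / 2 := hc ▸ min_le_right _ _
    have hcl := tendsto_atTop_of_clock (r := r) (S := S)
      (f := fun s => ε * (b s * C s) - a s * S s)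
      (f' := fun s => ε * ((-(a s * C s ^ 2) - m * b s * C s * S s
        + b s ^ 2 / a s * S s ^ 2) / r s) - m * a s * C s ^ 2 / r s)
      (c := c * η) (t := T / 2) (T := T) h2T.2 (by positivity)
      (fun s hs => h.r_pos s ⟨h2T.1.le.trans hs.1.le, hs.2⟩)
      (fun s hs => h.r_deriv s ⟨h2T.1.trans hs.1, hs.2⟩)
      (fun s hs => h.neg_one_le_S ⟨h2T.1.le.trans hs.1.le, hs.2⟩) hlim
      (fun s hs => ((h.bC_deriv ⟨h2T.1.trans hs.1, hs.2⟩).const_mul ε).sub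
        (h.p_deriv ⟨h2T.1.trans hs.1, hs.2⟩)) ?_
    · have hev : ∀ᶠ s in 𝓝[<] T, s ∈ Ioo (T / 2) T := Ioo_mem_nhdsLT h2T.2
      obtain ⟨s, hs1, hs2⟩ := ((hcl.eventually_gt_atTop (ε + 1)).and hev).exists
      have hsI : s ∈ Ico 0 T := ⟨h2T.1.le.trans hs2.1.le, hs2.2⟩
      have hbC : b s * C s ≤ 1 := by
        nlinarith [h.pos_sq s hsI, h.tan_sq s hsI, sq_nonneg (b s - C s), sq_nonneg (a s),
          sq_nonneg (S s)]
      have hp := h.neg_one_lt_p hm s ⟨h2T.1.trans hs2.1, hs2.2⟩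
      nlinarith
    · intro s hs
      have hs0 : s ∈ Ioo 0 T := ⟨h2T.1.trans hs.1, hs.2⟩
      have hsI : s ∈ Ico 0 T := ⟨hs0.1.le, hs0.2⟩
      have hr := h.r_pos s hsI
      have ha0 := h.a_pos s hs0
      have ha1 := h.a_le_one hsI
      have hS1 := h.neg_one_le_S hsI
      have hS0 := h.S_neg hm s hs0
      have hp := hpκ s hs
      have hp2 := hcon s hs
      have haκ : κ ≤ a s := by nlinarith
      have hSκ : S s ≤ -κ := by nlinarith
      have hpos := h.pos_sq s hsI
      have htan := h.tan_sq s hsI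
      have e4 := dissipation_bound (η := η) hm hκ0 hε0 haκ ha1 hSκ hpos htan
        (by nlinarith) hεeq hc0.le hc1 hc2
      have e5 := div_le_div_of_nonneg_right e4 hr.le
      calc c * η / r s ≤ _ := e5
        _ = _ := by ring
  rw [Metric.tendsto_nhdsWithin_nhds]
  intro η hη
  obtain ⟨s, hs, hps⟩ := key η hη
  refine ⟨T - s, by linarith [hs.2], fun {u} hu hd => ?_⟩
  have hu : u < T := hu
  rw [Real.dist_eq, abs_sub_comm, abs_of_pos (by linarith)] at hd
  have hsu : s ≤ u := by linarith
  have hs0 : 0 < s := h2T.1.trans hs.1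
  have h1 := hanti ⟨hs0.le, hs.2⟩ ⟨hs0.le.trans hsu, hu⟩ hsu
  simp only at h1
  have h2 := h.neg_one_lt_p hm u ⟨hs0.trans_le hsu, hu⟩
  rw [Real.dist_eq, abs_lt]
  constructor <;> linarith

theorem eventually_mem (h : PolarFlow m T r a b S C) : ∀ᶠ s in 𝓝[<] T, s ∈ Ioo 0 T :=
  Ioo_mem_nhdsLT h.T_pos

theorem tendsto_a (h : PolarFlow m T r a b S C) (hm : m < 0)
    (hlim : Tendsto r (𝓝[<] T) (𝓝 0)) : Tendsto a (𝓝[<] T) (𝓝 1) := by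
  have h1 : Tendsto (fun s => -(a s * S s)) (𝓝[<] T) (𝓝 1) := by
    simpa using (h.tendsto_p hm hlim).neg
  refine tendsto_of_tendsto_of_tendsto_of_le_of_le' h1 tendsto_const_nhds ?_ ?_
  · filter_upwards [h.eventually_mem] with s hs
    have hsI : s ∈ Ico 0 T := ⟨hs.1.le, hs.2⟩
    nlinarith [h.a_pos s hs, h.neg_one_le_S hsI]
  · filter_upwards [h.eventually_mem] with s hs using h.a_le_one ⟨hs.1.le, hs.2⟩

theorem tendsto_S (h : PolarFlow m T r a b S C) (hm : m < 0)
    (hlim : Tendsto r (𝓝[<] T) (𝓝 0)) : Tendsto S (𝓝[<] T) (𝓝 (-1)) := by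
  refine tendsto_of_tendsto_of_tendsto_of_le_of_le' tendsto_const_nhds (h.tendsto_p hm hlim) ?_ ?_
  · filter_upwards [h.eventually_mem] with s hs using h.neg_one_le_S ⟨hs.1.le, hs.2⟩
  · filter_upwards [h.eventually_mem] with s hs
    have hsI : s ∈ Ico 0 T := ⟨hs.1.le, hs.2⟩
    nlinarith [h.a_le_one hsI, h.S_neg hm s hs]

theorem tendsto_b (h : PolarFlow m T r a b S C) (hm : m < 0)
    (hlim : Tendsto r (𝓝[<] T) (𝓝 0)) : Tendsto b (𝓝[<] T) (𝓝 0) :=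
  tendsto_zero_of_sq (by norm_num) (h.tendsto_a hm hlim) <| h.eventually_mem.mono fun s hs => by
    linarith [h.pos_sq s ⟨hs.1.le, hs.2⟩]

theorem tendsto_C (h : PolarFlow m T r a b S C) (hm : m < 0)
    (hlim : Tendsto r (𝓝[<] T) (𝓝 0)) : Tendsto C (𝓝[<] T) (𝓝 0) :=
  tendsto_zero_of_sq (by norm_num) (h.tendsto_S hm hlim) <| h.eventually_mem.mono fun s hs => by
    linarith [h.tan_sq s ⟨hs.1.le, hs.2⟩]

/-! ### The height of the inverted curve -/

/-- The height `k = b / r = z / r²` of the curve inverted in the unit circle. -/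
theorem k_deriv (h : PolarFlow m T r a b S C) {s : ℝ} (hs : s ∈ Ioo 0 T) :
    HasDerivAt (fun s => b s / r s) (-(S s * b s + C s * a s) / r s / r s) s := by
  have hr := (h.r_pos s ⟨hs.1.le, hs.2⟩).ne'
  refine ((h.b_deriv s hs).div (h.r_deriv s hs) hr).congr_deriv ?_
  field_simp
  ring

/-- With `k = b / r` and `y = -(S * b + C * a) / r`, the system reads `r * k' = y` and
`r * y' = -(m + 2) * E² * k + c * y`.  Here `E = C * b - S * a` tends to `1` and the coefficient
`c` tends to `m + 2` at the origin, so that the limiting system is linear. -/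
theorem y_deriv (h : PolarFlow m T r a b S C) {s : ℝ} (hs : s ∈ Ioo 0 T) :
    HasDerivAt (fun s => -(S s * b s + C s * a s) / r s)
      ((-(m + 2) * (C s * b s - S s * a s) ^ 2 * (b s / r s)
        + ((C s * b s - S s * a s) * ((m + 2) * a s - b s ^ 2 / a s)
            - (S s * b s + C s * a s) * b s) * (-(S s * b s + C s * a s) / r s)) / r s) s := by
  have hsI : s ∈ Ico 0 T := ⟨hs.1.le, hs.2⟩
  have hr := (h.r_pos s hsI).ne'
  have ha := (h.a_pos s hs).ne'
  have h1 := (((h.S_deriv s hs).mul (h.b_deriv s hs)).add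
    ((h.C_deriv s hs).mul (h.a_deriv s hs))).neg.div (h.r_deriv s hs) hr
  refine h1.congr_deriv ?_
  have hpos := h.pos_sq s hsI
  -- in terms of `D = S b + C a` and `E = C b - S a`, rotating back gives `C` and `S`
  obtain ⟨D, hD⟩ : ∃ D, D = S s * b s + C s * a s := ⟨_, rfl⟩
  obtain ⟨E, hE⟩ : ∃ E, E = C s * b s - S s * a s := ⟨_, rfl⟩
  have hC : C s = E * b s + D * a s := by rw [hD, hE]; linear_combination (-C s) * hpos
  have hS : S s = D * b s - E * a s := by rw [hD, hE]; linear_combination (-S s) * hpos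
  have e1 : C s * b s - S s * a s = E := hE.symm
  have e2 : S s * b s + C s * a s = D := hD.symm
  simp only [Pi.add_apply, Pi.mul_apply, Pi.neg_apply, e1, e2]
  field_simp
  rw [hC, hS]
  linear_combination (E * D * (b s ^ 2 - (1 + m) * a s ^ 2) - E ^ 2 * b s * a s * (2 + m)) * hpos

theorem tendsto_D (h : PolarFlow m T r a b S C) (hm : m < 0)
    (hlim : Tendsto r (𝓝[<] T) (𝓝 0)) :
    Tendsto (fun s => S s * b s + C s * a s) (𝓝[<] T) (𝓝 0) := by
  have := ((h.tendsto_S hm hlim).mul (h.tendsto_b hm hlim)).add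
    ((h.tendsto_C hm hlim).mul (h.tendsto_a hm hlim))
  simpa using this

theorem tendsto_E (h : PolarFlow m T r a b S C) (hm : m < 0)
    (hlim : Tendsto r (𝓝[<] T) (𝓝 0)) :
    Tendsto (fun s => C s * b s - S s * a s) (𝓝[<] T) (𝓝 1) := by
  have := ((h.tendsto_C hm hlim).mul (h.tendsto_b hm hlim)).sub
    ((h.tendsto_S hm hlim).mul (h.tendsto_a hm hlim))
  simpa using this

theorem tendsto_coeff (h : PolarFlow m T r a b S C) (hm : m < 0)
    (hlim : Tendsto r (𝓝[<] T) (𝓝 0)) :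
    Tendsto (fun s => (C s * b s - S s * a s) * ((m + 2) * a s - b s ^ 2 / a s)
      - (S s * b s + C s * a s) * b s) (𝓝[<] T) (𝓝 (m + 2)) := by
  have ha := h.tendsto_a hm hlim
  have hb := h.tendsto_b hm hlim
  have := ((h.tendsto_E hm hlim).mul ((ha.const_mul (m + 2)).sub
    ((hb.pow 2).div ha one_ne_zero))).sub ((h.tendsto_D hm hlim).mul hb)
  simpa using this

/-- The pair `(k, y)` does not vanish, because `a * S > -1`. -/
theorem k_or_y_ne_zero (h : PolarFlow m T r a b S C) (hm : m < 0) {s : ℝ} (hs : s ∈ Ioo 0 T) :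
    b s ≠ 0 ∨ S s * b s + C s * a s ≠ 0 := by
  by_contra hcon
  push Not at hcon
  obtain ⟨hb, hD⟩ := hcon
  have hsI : s ∈ Ico 0 T := ⟨hs.1.le, hs.2⟩
  have ha := h.a_pos s hs
  have hC : C s = 0 := by
    rw [hb, mul_zero, zero_add] at hD
    exact (mul_eq_zero.1 hD).resolve_right ha.ne'
  have h1 := h.pos_sq s hsI
  have h2 := h.tan_sq s hsI
  rw [hb] at h1
  rw [hC] at h2
  have h3 := h.neg_one_lt_p hm s hs
  have h4 := h.p_neg hm s hs
  have h5 : (a s * S s) ^ 2 = 1 := by rw [mul_pow]; nlinarith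
  nlinarith

/-- If `-4 < α < -2` the curve meets `z < 0`: otherwise `w = y / k` would satisfy
`r * w' = -(m + 2) * E² + c * w - w²`, whose right-hand side is eventually at most a negative
multiple of `1 + w²`, so `arctan w` would tend to `-∞`. -/
theorem exists_b_neg (h : PolarFlow m T r a b S C) (hm : m < 0) (hm2 : -2 < m)
    (hlim : Tendsto r (𝓝[<] T) (𝓝 0)) : ∃ s ∈ Ioo 0 T, b s < 0 := by
  by_contra hcon
  push Not at hcon
  have hb : ∀ s ∈ Ioo 0 T, 0 < b s := by
    intro s hs
    rcases (hcon s hs).lt_or_eq with hlt | heq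
    · exact hlt
    -- at a zero of `b ≥ 0` the derivative of `b` vanishes too
    have hmin : IsLocalMin b s := by
      filter_upwards [Ioo_mem_nhds hs.1 hs.2] with u hu
      rw [← heq]
      exact hcon u hu
    have h1 := hmin.hasDerivAt_eq_zero (h.b_deriv s hs)
    have hr := (h.r_pos s ⟨hs.1.le, hs.2⟩).ne'
    have h2 : C s * a s = 0 := by
      rw [neg_eq_zero, div_eq_zero_iff] at h1
      rw [mul_comm]; exact h1.resolve_right hr
    rcases h.k_or_y_ne_zero hm hs with h3 | h3
    · exact absurd heq.symm h3
    · rw [← heq, h2] at h3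
      simp at h3
  set n := m + 2 with hn
  have hn0 : 0 < n := by linarith
  obtain ⟨δ, hδ⟩ : ∃ δ, δ = min (1 / 4 : ℝ) (n * (2 - n) / 4) := ⟨_, rfl⟩
  have hn2 : n < 2 := by linarith
  have hδ0 : 0 < δ := by
    rw [hδ]; exact lt_min (by norm_num) (div_pos (mul_pos hn0 (by linarith)) (by norm_num))
  have hE := h.tendsto_E hm hlim
  have hc := h.tendsto_coeff hm hlim
  have hdisc : Tendsto (fun s => ((C s * b s - S s * a s) * ((m + 2) * a s - b s ^ 2 / a s)
      - (S s * b s + C s * a s) * b s) ^ 2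
      - 4 * (1 - δ) * (n * (C s * b s - S s * a s) ^ 2 - δ)) (𝓝[<] T)
      (𝓝 (n ^ 2 - 4 * (1 - δ) * (n * 1 ^ 2 - δ))) :=
    (hc.pow 2).sub ((((hE.pow 2).const_mul n).sub_const δ).const_mul _)
  have hneg : n ^ 2 - 4 * (1 - δ) * (n * 1 ^ 2 - δ) < 0 := by
    have h1 : δ ≤ n * (2 - n) / 4 := hδ ▸ min_le_right _ _
    nlinarith
  obtain ⟨t, ht, hsub⟩ := mem_nhdsLT_iff_exists_Ioo_subset.1
    ((hdisc.eventually (gt_mem_nhds hneg)).and h.eventually_mem)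
  have htT : t < T := ht
  have hI : ∀ s ∈ Ioo t T, s ∈ Ioo 0 T := fun s hs => (hsub hs).2
  have hcl := tendsto_atTop_of_clock (r := r) (S := S)
    (f := fun s => -Real.arctan ((-(S s * b s + C s * a s) / r s) / (b s / r s)))
    (c := δ) (t := t) (T := T) htT hδ0
    (fun s hs => h.r_pos s ⟨(hI s hs).1.le, hs.2⟩) (fun s hs => h.r_deriv s (hI s hs))
    (fun s hs => h.neg_one_le_S ⟨(hI s hs).1.le, hs.2⟩) hlim
    (fun s hs => (((h.y_deriv (hI s hs)).div (h.k_deriv (hI s hs))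
      (div_pos (hb s (hI s hs)) (h.r_pos s ⟨(hI s hs).1.le, hs.2⟩)).ne').arctan).neg) ?_
  · obtain ⟨s, hs⟩ := (hcl.eventually_gt_atTop (Real.pi / 2)).exists
    have := Real.neg_pi_div_two_lt_arctan ((-(S s * b s + C s * a s) / r s) / (b s / r s))
    linarith
  · intro s hs
    have hr := h.r_pos s ⟨(hI s hs).1.le, hs.2⟩
    have hbs := hb s (hI s hs)
    have hd : ((C s * b s - S s * a s) * ((m + 2) * a s - b s ^ 2 / a s)
      - (S s * b s + C s * a s) * b s) ^ 2
      - 4 * (1 - δ) * (n * (C s * b s - S s * a s) ^ 2 - δ) < 0 := (hsub hs).1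
    rw [← hn] at hd ⊢
    generalize (C s * b s - S s * a s) * (n * a s - b s ^ 2 / a s)
      - (S s * b s + C s * a s) * b s = c at hd ⊢
    generalize C s * b s - S s * a s = E at hd ⊢
    have hk : 0 < b s / r s := div_pos hbs hr
    simp only [Pi.div_apply]
    generalize hy : -(S s * b s + C s * a s) / r s = y
    generalize hkk : b s / r s = k at hk ⊢
    have hδ1 : δ ≤ 1 / 4 := hδ ▸ min_le_left _ _
    -- the quadratic `n E² - c w + w² - δ (1 + w²)` in `w = y / k` has negative discriminant
    have key : δ * (1 + (y / k) ^ 2) ≤ n * E ^ 2 - c * (y / k) + (y / k) ^ 2 := by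
      nlinarith [sq_nonneg (2 * (1 - δ) * (y / k) - c)]
    have h1 : -(1 / (1 + (y / k) ^ 2)
        * (((-n * E ^ 2 * k + c * y) / r s * k - y * (y / r s)) / k ^ 2))
        = (n * E ^ 2 - c * (y / k) + (y / k) ^ 2) / (1 + (y / k) ^ 2) / r s := by
      field_simp
      ring
    rw [h1]
    refine div_le_div_of_nonneg_right ?_ hr.le
    rw [le_div_iff₀ (by positivity)]
    exact key

/-- If `α < -4` then `y > 0`.  Where `y ≤ 0` near `s = 0`, the function `y` would be increasing;
and at a later first zero of `y` its derivative `-(m + 2) * k / r` would be positive. -/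
theorem y_pos (h : PolarFlow m T r a b S C) (hm2 : m < -2) :
    (∀ s ∈ Ioo 0 T, 0 < -(S s * b s + C s * a s) / r s) ∧ ∀ s ∈ Ioo 0 T, 0 < b s := by
  have hT := h.T_pos
  have h0 : (0 : ℝ) ∈ Ico 0 T := ⟨le_rfl, hT⟩
  have hnhds : 𝓝[Ico 0 T] (0 : ℝ) = 𝓝[≥] 0 := nhdsWithin_Ico_eq_nhdsGE hT
  have hycont : ContinuousOn (fun s => -(S s * b s + C s * a s) / r s) (Ico 0 T) :=
    (((h.S_cont.mul h.b_cont).add (h.C_cont.mul h.a_cont)).neg).div h.r_cont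
      fun s hs => (h.r_pos s hs).ne'
  have hy0 : -(S 0 * b 0 + C 0 * a 0) / r 0 = 0 := by simp [h.S_zero, h.a_zero]
  have hkcont : ContinuousOn (fun s => b s / r s) (Ico 0 T) :=
    h.b_cont.div h.r_cont fun s hs => (h.r_pos s hs).ne'
  have hEcont : ContinuousOn (fun s => (C s * b s - S s * a s)) (Ico 0 T) :=
    (h.C_cont.mul h.b_cont).sub (h.S_cont.mul h.a_cont)
  have hGcont : ContinuousOn (fun s => (C s * b s - S s * a s) * b s ^ 2
      + (S s * b s + C s * a s) * b s) (Ico 0 T) :=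
    (hEcont.mul (h.b_cont.pow 2)).add
      (((h.S_cont.mul h.b_cont).add (h.C_cont.mul h.a_cont)).mul h.b_cont)
  have ev1 : ∀ᶠ s in 𝓝[≥] (0 : ℝ), 0 < b s := by
    rw [← hnhds]
    refine (h.b_cont 0 h0).eventually (lt_mem_nhds ?_)
    simp [h.b_zero]
  have ev2 : ∀ᶠ s in 𝓝[≥] (0 : ℝ), 0 < C s * b s - S s * a s := by
    rw [← hnhds]
    refine (hEcont 0 h0).eventually (lt_mem_nhds ?_)
    simp [h.b_zero, h.C_zero, h.S_zero]
  have ev3 : ∀ᶠ s in 𝓝[≥] (0 : ℝ), 0 < (C s * b s - S s * a s) * b s ^ 2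
      + (S s * b s + C s * a s) * b s := by
    rw [← hnhds]
    refine (hGcont 0 h0).eventually (lt_mem_nhds ?_)
    simp [h.b_zero, h.C_zero, h.S_zero, h.a_zero]
  obtain ⟨t, ht, hsub⟩ := mem_nhdsGE_iff_exists_Ico_subset.1 (ev1.and (ev2.and ev3))
  have ht0 : 0 < t := ht
  obtain ⟨u, hu⟩ : ∃ u, u = min t T := ⟨_, rfl⟩
  have hu0 : 0 < u := by rw [hu]; exact lt_min ht0 hT
  have hut : u ≤ t := hu ▸ min_le_left _ _
  have huT : u ≤ T := hu ▸ min_le_right _ _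
  have near : ∀ s ∈ Ioo 0 u, 0 < -(S s * b s + C s * a s) / r s := by
    refine pos_of_hasDerivAt_pos_of_nonpos
      (hycont.mono fun s hs => ⟨hs.1, hs.2.trans_le huT⟩) hy0 fun s hs hys => ?_
    have hs0 : s ∈ Ioo 0 T := ⟨hs.1, hs.2.trans_le huT⟩
    have hsI : s ∈ Ico 0 T := ⟨hs0.1.le, hs0.2⟩
    refine ⟨_, ?_, h.y_deriv hs0⟩
    obtain ⟨hb, hE, hG⟩ := hsub ⟨hs.1.le, hs.2.trans_le hut⟩
    have hr := h.r_pos s hsI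
    have ha := h.a_pos s hs0
    have ha1 := h.a_le_one hsI
    -- the coefficient of `y` is negative here
    have hc : (C s * b s - S s * a s) * ((m + 2) * a s - b s ^ 2 / a s)
        - (S s * b s + C s * a s) * b s ≤ 0 := by
      have h1 : b s ^ 2 ≤ b s ^ 2 / a s := by
        rw [le_div_iff₀ ha]; exact mul_le_of_le_one_right (sq_nonneg _) ha1
      have h2 : (m + 2) * a s ≤ 0 := mul_nonpos_of_nonpos_of_nonneg (by linarith) ha.le
      have h3 : (C s * b s - S s * a s) * ((m + 2) * a s - b s ^ 2 / a s)
          ≤ (C s * b s - S s * a s) * (-b s ^ 2) :=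
        mul_le_mul_of_nonneg_left (by linarith) hE.le
      linarith
    have h4 : 0 < -(m + 2) * (C s * b s - S s * a s) ^ 2 * (b s / r s) :=
      mul_pos (mul_pos (by linarith) (pow_pos hE 2)) (div_pos hb hr)
    exact div_pos (add_pos_of_pos_of_nonneg h4 (mul_nonneg_of_nonpos_of_nonpos hc hys)) hr
  -- as long as `y > 0`, the function `k` stays at least `1`
  have hk : ∀ t ∈ Ioo 0 T, (∀ s ∈ Ioo 0 t, 0 < -(S s * b s + C s * a s) / r s) → 0 < b t := by
    intro t ht hy
    have hmono : MonotoneOn (fun s => b s / r s) (Icc 0 t) := by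
      refine monotoneOn_of_deriv_nonneg (convex_Icc 0 t)
        (hkcont.mono fun s hs => ⟨hs.1, hs.2.trans_lt ht.2⟩) (fun s hs => ?_) (fun s hs => ?_)
      · rw [interior_Icc] at hs
        exact (h.k_deriv ⟨hs.1, hs.2.trans ht.2⟩).differentiableAt.differentiableWithinAt
      · rw [interior_Icc] at hs
        rw [(h.k_deriv ⟨hs.1, hs.2.trans ht.2⟩).deriv]
        exact (div_pos (hy s hs) (h.r_pos s ⟨hs.1.le, hs.2.trans ht.2⟩)).le
    have h1 := hmono ⟨le_rfl, ht.1.le⟩ ⟨ht.1.le, le_rfl⟩ ht.1.le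
    simp only [h.b_zero, h.r_zero, div_one] at h1
    rw [le_div_iff₀ (h.r_pos t ⟨ht.1.le, ht.2⟩)] at h1
    linarith [h.r_pos t ⟨ht.1.le, ht.2⟩]
  have all : ∀ s ∈ Ioo 0 T, 0 < -(S s * b s + C s * a s) / r s := by
    intro s hs
    by_contra hcon
    have hus : u ≤ s := by
      by_contra hlt
      exact hcon (near s ⟨hs.1, not_le.1 hlt⟩)
    obtain ⟨v, hv, hv0, hvpos⟩ := exists_first_zero (u := u / 2) (v := s) (by linarith)
      (hycont.mono fun w hw => ⟨by linarith [hw.1], hw.2.trans_lt hs.2⟩)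
      (near (u / 2) ⟨by linarith, by linarith⟩) (not_lt.1 hcon)
    have hvI : v ∈ Ioo 0 T := ⟨by linarith [hv.1], hv.2.trans_lt hs.2⟩
    have hbefore : ∀ w ∈ Ioo 0 v, 0 < -(S w * b w + C w * a w) / r w := by
      intro w hw
      rcases lt_or_ge w (u / 2) with h1 | h1
      · exact near w ⟨hw.1, by linarith⟩
      · exact hvpos w ⟨h1, hw.2⟩
    have hbv := hk v hvI hbefore
    have hr := h.r_pos v ⟨hvI.1.le, hvI.2⟩
    have hD : S v * b v + C v * a v = 0 := by
      rw [div_eq_zero_iff, neg_eq_zero] at hv0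
      exact hv0.resolve_right hr.ne'
    have hE : (C v * b v - S v * a v) ^ 2 = 1 := by
      have h1 := h.pos_sq v ⟨hvI.1.le, hvI.2⟩
      have h2 := h.tan_sq v ⟨hvI.1.le, hvI.2⟩
      have h3 : (C v * b v - S v * a v) ^ 2 + (S v * b v + C v * a v) ^ 2 = 1 := by
        calc _ = (a v ^ 2 + b v ^ 2) * (S v ^ 2 + C v ^ 2) := by ring
          _ = 1 := by rw [h1, h2, one_mul]
      rw [hD] at h3
      linarith
    have hd := h.y_deriv hvI
    have hpos : 0 < (-(m + 2) * (C v * b v - S v * a v) ^ 2 * (b v / r v)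
        + ((C v * b v - S v * a v) * ((m + 2) * a v - b v ^ 2 / a v)
            - (S v * b v + C v * a v) * b v) * (-(S v * b v + C v * a v) / r v)) / r v := by
      rw [hv0, mul_zero, add_zero, hE]
      exact div_pos (mul_pos (by linarith) (div_pos hbv hr)) hr
    have h1 := eventually_lt_left_of_hasDerivAt_pos hd hpos
    have h2 : ∀ᶠ w in 𝓝[<] v, w ∈ Ioo 0 v := Ioo_mem_nhdsLT hvI.1
    obtain ⟨w, hw1, hw2⟩ := (h1.and h2).exists
    simp only [hv0] at hw1
    linarith [hbefore w hw2]
  exact ⟨all, fun s hs => hk s hs fun w hw => all w ⟨hw.1, hw.2.trans hs.2⟩⟩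

theorem one_le_k (h : PolarFlow m T r a b S C) (hm2 : m < -2) {t : ℝ} (ht : t ∈ Ioo 0 T) :
    1 ≤ b t / r t := by
  have hmono : MonotoneOn (fun s => b s / r s) (Ico 0 T) := by
    refine monotoneOn_of_deriv_nonneg (convex_Ico 0 T)
      (h.b_cont.div h.r_cont fun s hs => (h.r_pos s hs).ne') (fun s hs => ?_) (fun s hs => ?_)
    · rw [interior_Ico] at hs
      exact (h.k_deriv hs).differentiableAt.differentiableWithinAt
    · rw [interior_Ico] at hs
      rw [(h.k_deriv hs).deriv]
      exact (div_pos ((h.y_pos hm2).1 s hs) (h.r_pos s ⟨hs.1.le, hs.2⟩)).le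
  have h1 := hmono ⟨le_rfl, h.T_pos⟩ ⟨ht.1.le, ht.2⟩ ht.1.le
  simpa only [h.b_zero, h.r_zero, div_one] using h1

/-- If `α < -4` the curve descends: `S * b - C * a` is the derivative of the height. -/
theorem slope_neg (h : PolarFlow m T r a b S C) (hm2 : m < -2) :
    ∀ s ∈ Ioo 0 T, S s * b s - C s * a s < 0 := by
  have hb := (h.y_pos hm2).2
  have hC : ∀ s ∈ Ioo 0 T, 0 < C s := by
    intro s hs
    by_contra hcon
    obtain ⟨v, hv, hv0, hvpos⟩ := exists_first_zero (u := 0) (v := s) hs.1.le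
      (h.C_cont.mono fun w hw => ⟨hw.1, hw.2.trans_lt hs.2⟩)
      (by rw [h.C_zero]; exact one_pos) (not_lt.1 hcon)
    have hvI : v ∈ Ioo 0 T := ⟨hv.1, hv.2.trans_lt hs.2⟩
    have hd := h.C_deriv v hvI
    have hr := h.r_pos v ⟨hvI.1.le, hvI.2⟩
    have ha := h.a_pos v hvI
    have hS := h.S_neg (by linarith) v hvI
    have hpos : 0 < -(S v * (m * C v - b v * S v / a v) / r v) := by
      rw [hv0, mul_zero, zero_sub]
      have : -(S v * -(b v * S v / a v) / r v) = b v * S v ^ 2 / a v / r v := by ring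
      rw [this]
      exact div_pos (div_pos (mul_pos (hb v hvI) (sq_pos_of_neg hS)) ha) hr
    have h1 := eventually_lt_left_of_hasDerivAt_pos hd hpos
    have h2 : ∀ᶠ w in 𝓝[<] v, w ∈ Ioo 0 v := Ioo_mem_nhdsLT hvI.1
    obtain ⟨w, hw1, hw2⟩ := (h1.and h2).exists
    rw [hv0] at hw1
    linarith [hvpos w ⟨hw2.1.le, hw2.2⟩]
  intro s hs
  have h1 := mul_pos (neg_pos.2 (h.S_neg (by linarith) s hs)) (hb s hs)
  have h2 := mul_pos (hC s hs) (h.a_pos s hs)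
  linarith

/-- If `α < -4` then `(k, y)` is unbounded near the origin: `y - (m + 2) * k` grows at a positive
rate in the time `-log r`, because `k ≥ 1`. -/
theorem not_bounded_of_lt (h : PolarFlow m T r a b S C) (hm2 : m < -2)
    (hlim : Tendsto r (𝓝[<] T) (𝓝 0)) {M : ℝ}
    (hM : ∀ᶠ s in 𝓝[<] T, |b s / r s| ≤ M ∧ |-(S s * b s + C s * a s) / r s| ≤ M) : False := by
  have hm : m < 0 := by linarith
  obtain ⟨n, hn⟩ : ∃ n, n = m + 2 := ⟨_, rfl⟩
  have hn0 : n < 0 := by linarith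
  have hM0 : 0 ≤ M := by
    obtain ⟨s, hs⟩ := hM.exists
    exact (abs_nonneg _).trans hs.1
  have ev1 : ∀ᶠ s in 𝓝[<] T, 3 / 4 < (C s * b s - S s * a s) ^ 2 :=
    ((h.tendsto_E hm hlim).pow 2).eventually (lt_mem_nhds (by norm_num))
  have ev2 : ∀ᶠ s in 𝓝[<] T, |(C s * b s - S s * a s) * ((m + 2) * a s - b s ^ 2 / a s)
      - (S s * b s + C s * a s) * b s - (m + 2)| < -n / (4 * (M + 1)) := by
    have := ((h.tendsto_coeff hm hlim).sub_const (m + 2)).abs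
    rw [sub_self, abs_zero] at this
    exact this.eventually (gt_mem_nhds (div_pos (by linarith) (by linarith)))
  obtain ⟨t, ht, hsub⟩ := mem_nhdsLT_iff_exists_Ioo_subset.1
    (ev1.and (ev2.and (hM.and h.eventually_mem)))
  have htT : t < T := ht
  have hI : ∀ s ∈ Ioo t T, s ∈ Ioo 0 T := fun s hs => (hsub hs).2.2.2
  have hcl := tendsto_atTop_of_clock (r := r) (S := S)
    (f := fun s => -(S s * b s + C s * a s) / r s - n * (b s / r s))
    (c := -n / 4) (t := t) (T := T) htT (by linarith)
    (fun s hs => h.r_pos s ⟨(hI s hs).1.le, hs.2⟩) (fun s hs => h.r_deriv s (hI s hs))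
    (fun s hs => h.neg_one_le_S ⟨(hI s hs).1.le, hs.2⟩) hlim
    (fun s hs => (h.y_deriv (hI s hs)).sub ((h.k_deriv (hI s hs)).const_mul n)) ?_
  · obtain ⟨s, hs, hs2⟩ := ((hcl.eventually_gt_atTop (M - n * M)).and hM).exists
    have h1 := (le_abs_self _).trans hs2.1
    have h2 := (le_abs_self _).trans hs2.2
    nlinarith
  · intro s hs
    have hr := h.r_pos s ⟨(hI s hs).1.le, hs.2⟩
    have hk := h.one_le_k hm2 (hI s hs)
    obtain ⟨h1, h2, ⟨-, h3⟩, -⟩ := hsub hs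
    simp only [← hn] at h1 h2 h3 ⊢
    generalize (C s * b s - S s * a s) * (n * a s - b s ^ 2 / a s)
      - (S s * b s + C s * a s) * b s = c at h2 ⊢
    generalize C s * b s - S s * a s = E at h1 ⊢
    generalize -(S s * b s + C s * a s) / r s = y at h3 ⊢
    generalize b s / r s = k at hk ⊢
    have h4 : |(c - n) * y| ≤ -n / 4 := by
      rw [abs_mul]
      calc |c - n| * |y| ≤ (-n / (4 * (M + 1))) * (M + 1) :=
            mul_le_mul h2.le (by linarith) (abs_nonneg _)
              (div_nonneg (by linarith) (by linarith))
        _ = -n / 4 := by field_simp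
    have h5 := (abs_le.1 h4).1
    have h6 : 3 / 4 ≤ E ^ 2 * k := by nlinarith
    have h7 : -n / 4 ≤ -n * (E ^ 2 * k) + (c - n) * y := by nlinarith
    calc -n / 4 / r s ≤ (-n * (E ^ 2 * k) + (c - n) * y) / r s :=
          div_le_div_of_nonneg_right h7 hr.le
      _ = _ := by ring

/-- If `-4 < α < -2` then `(k, y)` is unbounded near the origin: the positive definite form
`V = n * k² + y² - n * k * y`, with `n = m + 2`, satisfies `r * V' ≥ (n / 2) * V` eventually, so
that `log V` tends to infinity. -/
theorem not_bounded_of_gt (h : PolarFlow m T r a b S C) (hm : m < 0) (hm2 : -2 < m)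
    (hlim : Tendsto r (𝓝[<] T) (𝓝 0)) {M : ℝ}
    (hM : ∀ᶠ s in 𝓝[<] T, |b s / r s| ≤ M ∧ |-(S s * b s + C s * a s) / r s| ≤ M) : False := by
  obtain ⟨n, hn⟩ : ∃ n, n = m + 2 := ⟨_, rfl⟩
  have hn0 : 0 < n := by linarith
  have hn2 : n < 2 := by linarith
  -- a lower bound of `V` in terms of `k² + y²`
  obtain ⟨q, hq⟩ : ∃ q, q = n * (4 - n) / 16 := ⟨_, rfl⟩
  have hq0 : 0 < q := by rw [hq]; exact div_pos (mul_pos hn0 (by linarith)) (by norm_num)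
  have hV : ∀ k y : ℝ, q * (k ^ 2 + y ^ 2) ≤ n * k ^ 2 + y ^ 2 - n * k * y := by
    intro k y
    have h1 : 0 < 1 - q := by rw [hq]; nlinarith
    have h2 : n ^ 2 ≤ 4 * (n - q) * (1 - q) := by rw [hq]; nlinarith [mul_pos hn0 hn0]
    nlinarith [sq_nonneg (2 * (1 - q) * y - n * k), mul_nonneg (sub_nonneg.2 h2) (sq_nonneg k)]
  obtain ⟨e, he⟩ : ∃ e, e = min 1 (n * q / 40) := ⟨_, rfl⟩
  have he0 : 0 < e := by rw [he]; exact lt_min one_pos (by positivity)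
  have ev1 : ∀ᶠ s in 𝓝[<] T, |(C s * b s - S s * a s) ^ 2 - 1| < e := by
    have := (((h.tendsto_E hm hlim).pow 2).sub_const 1).abs
    norm_num at this
    exact this.eventually (gt_mem_nhds he0)
  have ev2 : ∀ᶠ s in 𝓝[<] T, |(C s * b s - S s * a s) * ((m + 2) * a s - b s ^ 2 / a s)
      - (S s * b s + C s * a s) * b s - (m + 2)| < e := by
    have := ((h.tendsto_coeff hm hlim).sub_const (m + 2)).abs
    rw [sub_self, abs_zero] at this
    exact this.eventually (gt_mem_nhds he0)
  obtain ⟨t, ht, hsub⟩ := mem_nhdsLT_iff_exists_Ioo_subset.1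
    (ev1.and (ev2.and (hM.and h.eventually_mem)))
  have htT : t < T := ht
  have hI : ∀ s ∈ Ioo t T, s ∈ Ioo 0 T := fun s hs => (hsub hs).2.2.2
  have hVpos : ∀ s ∈ Ioo t T, 0 < n * (b s / r s) ^ 2 + (-(S s * b s + C s * a s) / r s) ^ 2
      - n * (b s / r s) * (-(S s * b s + C s * a s) / r s) := by
    intro s hs
    have hr := h.r_pos s ⟨(hI s hs).1.le, hs.2⟩
    refine lt_of_lt_of_le (mul_pos hq0 ?_) (hV _ _)
    rcases h.k_or_y_ne_zero hm (hI s hs) with h1 | h1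
    · have : 0 < (b s / r s) ^ 2 := by positivity
      positivity
    · have h2 : -(S s * b s + C s * a s) / r s ≠ 0 := div_ne_zero (neg_ne_zero.2 h1) hr.ne'
      have : 0 < (-(S s * b s + C s * a s) / r s) ^ 2 := by positivity
      positivity
  have hcl := tendsto_atTop_of_clock (r := r) (S := S)
    (f := fun s => Real.log (n * (b s / r s) ^ 2 + (-(S s * b s + C s * a s) / r s) ^ 2
      - n * (b s / r s) * (-(S s * b s + C s * a s) / r s)))
    (c := n / 2) (t := t) (T := T) htT (by linarith)
    (fun s hs => h.r_pos s ⟨(hI s hs).1.le, hs.2⟩) (fun s hs => h.r_deriv s (hI s hs))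
    (fun s hs => h.neg_one_le_S ⟨(hI s hs).1.le, hs.2⟩) hlim
    (fun s hs => (((((h.k_deriv (hI s hs)).pow 2).const_mul n).add
      ((h.y_deriv (hI s hs)).pow 2)).sub (((h.k_deriv (hI s hs)).const_mul n).mul
      (h.y_deriv (hI s hs)))).log (hVpos s hs).ne') ?_
  · have hev : ∀ᶠ s in 𝓝[<] T, s ∈ Ioo t T := Ioo_mem_nhdsLT htT
    obtain ⟨s, hs, hs2, hs3⟩ :=
      ((hcl.eventually_gt_atTop (Real.log (n * M ^ 2 + M ^ 2 + n * M * M))).and (hM.and hev)).exists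
    have hle : n * (b s / r s) ^ 2 + (-(S s * b s + C s * a s) / r s) ^ 2
      - n * (b s / r s) * (-(S s * b s + C s * a s) / r s) ≤ n * M ^ 2 + M ^ 2 + n * M * M := by
      obtain ⟨h1, h2⟩ := hs2
      generalize -(S s * b s + C s * a s) / r s = y at h2 ⊢
      generalize b s / r s = k at h1 ⊢
      have h3 : k ^ 2 ≤ M ^ 2 := sq_le_sq' (abs_le.1 h1).1 (abs_le.1 h1).2
      have h4 : y ^ 2 ≤ M ^ 2 := sq_le_sq' (abs_le.1 h2).1 (abs_le.1 h2).2
      have h5 : |k * y| ≤ M * M := by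
        rw [abs_mul]; exact mul_le_mul h1 h2 (abs_nonneg _) ((abs_nonneg _).trans h1)
      have h6 := (abs_le.1 h5).1
      nlinarith
    exact absurd (Real.log_le_log (hVpos s hs3) hle) (not_le.2 hs)
  · intro s hs
    have hr := h.r_pos s ⟨(hI s hs).1.le, hs.2⟩
    have hVs := hVpos s hs
    obtain ⟨h1, h2, -, -⟩ := hsub hs
    simp only [← hn] at h1 h2 hVs ⊢
    generalize (C s * b s - S s * a s) * (n * a s - b s ^ 2 / a s)
      - (S s * b s + C s * a s) * b s = c at h2 ⊢
    generalize C s * b s - S s * a s = E at h1 ⊢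
    simp only [Pi.add_apply, Pi.mul_apply, Pi.sub_apply, Pi.pow_apply]
    generalize -(S s * b s + C s * a s) / r s = y at hVs ⊢
    generalize b s / r s = k at hVs ⊢
    rw [le_div_iff₀ hVs]
    have he1 : e ≤ 1 := he ▸ min_le_left _ _
    have he2 : e ≤ n * q / 40 := he ▸ min_le_right _ _
    have h1' := abs_lt.1 h1
    have h2' := abs_lt.1 h2
    have hVq := hV k y
    -- the error terms are small compared with `k² + y²`
    have a1 : |(c - n) * y ^ 2| ≤ e * (k ^ 2 + y ^ 2) := by
      rw [abs_mul, abs_of_nonneg (sq_nonneg y)]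
      exact mul_le_mul h2.le (by nlinarith [sq_nonneg k]) (sq_nonneg y) he0.le
    have a2 : |(c - n) * (k * y)| ≤ e * (k ^ 2 + y ^ 2) := by
      rw [abs_mul]
      refine mul_le_mul h2.le (abs_le.2 ⟨?_, ?_⟩) (abs_nonneg _) he0.le
      · nlinarith [sq_nonneg (k + y), sq_nonneg k, sq_nonneg y]
      · nlinarith [sq_nonneg (k - y), sq_nonneg k, sq_nonneg y]
    have a3 : |(E ^ 2 - 1) * k ^ 2| ≤ e * (k ^ 2 + y ^ 2) := by
      rw [abs_mul, abs_of_nonneg (sq_nonneg k)]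
      exact mul_le_mul h1.le (by nlinarith [sq_nonneg y]) (sq_nonneg k) he0.le
    have a4 : |(E ^ 2 - 1) * (k * y)| ≤ e * (k ^ 2 + y ^ 2) := by
      rw [abs_mul]
      refine mul_le_mul h1.le (abs_le.2 ⟨?_, ?_⟩) (abs_nonneg _) he0.le
      · nlinarith [sq_nonneg (k + y), sq_nonneg k, sq_nonneg y]
      · nlinarith [sq_nonneg (k - y), sq_nonneg k, sq_nonneg y]
    have b1 := (abs_le.1 a1).1
    have b2 := (abs_le.1 a2).2
    have b3 := (abs_le.1 a3).1
    have b4 := (abs_le.1 a4).2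
    have hw : 0 ≤ k ^ 2 + y ^ 2 := by positivity
    have hW : 0 ≤ e * (k ^ 2 + y ^ 2) := mul_nonneg he0.le hw
    have b5 : e * (k ^ 2 + y ^ 2) ≤ n / 40 * (n * k ^ 2 + y ^ 2 - n * k * y) := by
      calc e * (k ^ 2 + y ^ 2) ≤ n * q / 40 * (k ^ 2 + y ^ 2) :=
            mul_le_mul_of_nonneg_right he2 hw
        _ = n / 40 * (q * (k ^ 2 + y ^ 2)) := by ring
        _ ≤ _ := mul_le_mul_of_nonneg_left hVq (by linarith)
    have main : n / 2 * (n * k ^ 2 + y ^ 2 - n * k * y)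
        ≤ n * (n * k ^ 2 + y ^ 2 - n * k * y) + 2 * ((c - n) * y ^ 2)
          - n * ((c - n) * (k * y)) + n ^ 2 * ((E ^ 2 - 1) * k ^ 2)
          - 2 * n * ((E ^ 2 - 1) * (k * y)) := by
      generalize e * (k ^ 2 + y ^ 2) = W at b1 b2 b3 b4 b5 hW
      have d1 : n * ((c - n) * (k * y)) ≤ 2 * W :=
        (mul_le_mul_of_nonneg_left b2 hn0.le).trans (mul_le_mul_of_nonneg_right hn2.le hW)
      have d2 : 2 * n * ((E ^ 2 - 1) * (k * y)) ≤ 4 * W :=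
        (mul_le_mul_of_nonneg_left b4 (by linarith)).trans
          (mul_le_mul_of_nonneg_right (by linarith) hW)
      have d3 : n ^ 2 * (-W) ≤ n ^ 2 * ((E ^ 2 - 1) * k ^ 2) :=
        mul_le_mul_of_nonneg_left b3 (sq_nonneg n)
      have d4 : n ^ 2 * W ≤ 4 * W := mul_le_mul_of_nonneg_right (by nlinarith) hW
      linarith
    calc n / 2 / r s * (n * k ^ 2 + y ^ 2 - n * k * y)
        = n / 2 * (n * k ^ 2 + y ^ 2 - n * k * y) / r s := by ring
      _ ≤ _ := div_le_div_of_nonneg_right main hr.le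
      _ = _ := by field_simp; ring

end PolarFlow

/-! ### From solutions to the polar form -/

/-- The distance to the origin along the curve `(x, z)`. -/
noncomputable def rad (x z : ℝ → ℝ) (s : ℝ) : ℝ := √(x s ^ 2 + z s ^ 2)

/-- The radial component of the unit tangent vector. -/
noncomputable def radComp (x z ψ : ℝ → ℝ) (s : ℝ) : ℝ :=
  (x s * Real.cos (ψ s) + z s * Real.sin (ψ s)) / rad x z s

/-- The component of the unit tangent vector along the unit tangential direction. -/
noncomputable def angComp (x z ψ : ℝ → ℝ) (s : ℝ) : ℝ :=
  (z s * Real.cos (ψ s) - x s * Real.sin (ψ s)) / rad x z s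

theorem sq_add_sq_pos_of_ne {u v : ℝ} (h : (u, v) ≠ (0, 0)) : 0 < u ^ 2 + v ^ 2 := by
  by_contra hcon
  have h1 := sq_nonneg u
  have h2 := sq_nonneg v
  have hu : u = 0 := pow_eq_zero_iff two_ne_zero |>.1 (by linarith)
  have hv : v = 0 := pow_eq_zero_iff two_ne_zero |>.1 (by linarith)
  exact h (by rw [hu, hv])

namespace IsSolution

variable {α : ℝ} {I : Set ℝ} {x z ψ : ℝ → ℝ}

theorem x_cont (h : IsSolution α I x z ψ) : ContinuousOn x I :=
  fun s hs => (h.x_deriv s hs).continuousAt.continuousWithinAt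

theorem z_cont (h : IsSolution α I x z ψ) : ContinuousOn z I :=
  fun s hs => (h.z_deriv s hs).continuousAt.continuousWithinAt

theorem ψ_cont (h : IsSolution α I x z ψ) : ContinuousOn ψ I := h.ψ_contDiffOn.continuousOn

theorem sq_pos (h : IsSolution α I x z ψ) {s : ℝ} (hs : s ∈ I) : 0 < x s ^ 2 + z s ^ 2 :=
  sq_add_sq_pos_of_ne (h.ne_origin s hs)

theorem rad_pos (h : IsSolution α I x z ψ) {s : ℝ} (hs : s ∈ I) : 0 < rad x z s :=
  Real.sqrt_pos.2 (h.sq_pos hs)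

theorem rad_cont (h : IsSolution α I x z ψ) : ContinuousOn (rad x z) I :=
  ((h.x_cont.pow 2).add (h.z_cont.pow 2)).sqrt

theorem rad_sq (h : IsSolution α I x z ψ) {s : ℝ} (hs : s ∈ I) :
    rad x z s ^ 2 = x s ^ 2 + z s ^ 2 := Real.sq_sqrt (h.sq_pos hs).le

theorem rad_deriv (h : IsSolution α I x z ψ) {s : ℝ} (hs : s ∈ I) :
    HasDerivAt (rad x z) (radComp x z ψ s) s := by
  refine ((((h.x_deriv s hs).pow 2).add ((h.z_deriv s hs).pow 2)).sqrt
    (h.sq_pos hs).ne').congr_deriv ?_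
  have hr := (h.rad_pos hs).ne'
  simp only [Pi.add_apply, Pi.pow_apply]
  rw [radComp, show √(x s ^ 2 + z s ^ 2) = rad x z s from rfl]
  field_simp
  ring

theorem Icc_subset (h : IsSolution α I x z ψ) {t : ℝ} (ht : t ∈ I) : Icc 0 t ⊆ I :=
  h.ordConnected.out h.zero_mem ht

/-- A solution that stays in `x > 0` on `(0, T)` gives a solution of the polar system. -/
theorem polarFlow (h : IsSolution α I x z ψ) {T : ℝ} (hT : 0 < T) (hTI : Ico 0 T ⊆ I)
    (hx : ∀ s ∈ Ioo 0 T, 0 < x s) :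
    PolarFlow (α + 2) T (rad x z) (fun s => x s / rad x z s) (fun s => z s / rad x z s)
      (radComp x z ψ) (angComp x z ψ) := by
  have hI : ∀ s ∈ Ioo 0 T, s ∈ I := fun s hs => hTI ⟨hs.1.le, hs.2⟩
  have hr0 : rad x z 0 = 1 := by rw [rad, h.x_zero, h.z_zero]; norm_num
  have hcos : ContinuousOn (fun s => Real.cos (ψ s)) I :=
    Real.continuous_cos.comp_continuousOn h.ψ_cont
  have hsin : ContinuousOn (fun s => Real.sin (ψ s)) I :=
    Real.continuous_sin.comp_continuousOn h.ψ_cont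
  have hne : ∀ s ∈ I, rad x z s ≠ 0 := fun s hs => (h.rad_pos hs).ne'
  refine
    { T_pos := hT
      r_cont := h.rad_cont.mono hTI
      a_cont := (h.x_cont.div h.rad_cont hne).mono hTI
      b_cont := (h.z_cont.div h.rad_cont hne).mono hTI
      S_cont := (((h.x_cont.mul hcos).add (h.z_cont.mul hsin)).div h.rad_cont hne).mono hTI
      C_cont := (((h.z_cont.mul hcos).sub (h.x_cont.mul hsin)).div h.rad_cont hne).mono hTI
      r_zero := hr0
      a_zero := by rw [h.x_zero, zero_div]
      b_zero := by rw [h.z_zero, hr0, div_one]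
      S_zero := by simp [radComp, h.x_zero, h.ψ_zero]
      C_zero := by simp [angComp, h.x_zero, h.ψ_zero, h.z_zero, hr0]
      r_pos := fun s hs => h.rad_pos (hTI hs)
      a_pos := fun s hs => div_pos (hx s hs) (h.rad_pos (hI s hs))
      pos_sq := fun s hs => ?_
      tan_sq := fun s hs => ?_
      r_deriv := fun s hs => h.rad_deriv (hI s hs)
      a_deriv := fun s hs => ?_
      b_deriv := fun s hs => ?_
      S_deriv := fun s hs => ?_
      C_deriv := fun s hs => ?_ }
  · have h1 := h.rad_sq (hTI hs)
    have h2 := hne s (hTI hs)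
    field_simp
    exact h1.symm
  · have h1 := h.rad_sq (hTI hs)
    have h2 := hne s (hTI hs)
    rw [radComp, angComp]
    field_simp
    rw [h1]
    linear_combination (x s ^ 2 + z s ^ 2) * Real.sin_sq_add_cos_sq (ψ s)
  all_goals
    have h1 := h.rad_sq (hI s hs)
    have h2 := hne s (hI s hs)
    have h3 := (hx s hs).ne'
    have h4 := Real.sin_sq_add_cos_sq (ψ s)
    have h5 := (h.sq_pos (hI s hs)).ne'
  · refine ((h.x_deriv s (hI s hs)).div (h.rad_deriv (hI s hs)) h2).congr_deriv ?_
    rw [radComp, angComp]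
    field_simp
    rw [h1]; ring
  · refine ((h.z_deriv s (hI s hs)).div (h.rad_deriv (hI s hs)) h2).congr_deriv ?_
    rw [radComp, angComp]
    field_simp
    rw [h1]; ring
  · refine ((((h.x_deriv s (hI s hs)).mul (h.ψ_deriv s (hI s hs) h3).cos).add
      ((h.z_deriv s (hI s hs)).mul (h.ψ_deriv s (hI s hs) h3).sin)).div
      (h.rad_deriv (hI s hs)) h2).congr_deriv ?_
    simp only [Pi.add_apply, Pi.mul_apply]
    rw [radComp, angComp, ← h1]
    generalize rad x z s = R at *
    generalize Real.cos (ψ s) = c at *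
    generalize Real.sin (ψ s) = t at *
    field_simp
    rw [h1]
    ring
  · refine ((((h.z_deriv s (hI s hs)).mul (h.ψ_deriv s (hI s hs) h3).cos).sub
      ((h.x_deriv s (hI s hs)).mul (h.ψ_deriv s (hI s hs) h3).sin)).div
      (h.rad_deriv (hI s hs)) h2).congr_deriv ?_
    simp only [Pi.sub_apply, Pi.mul_apply]
    rw [radComp, angComp, ← h1]
    generalize rad x z s = R at *
    generalize Real.cos (ψ s) = c at *
    generalize Real.sin (ψ s) = t at *
    field_simp
    rw [h1]
    ring

theorem exists_gt (h : IsSolution α I x z ψ) {s : ℝ} (hs : s ∈ I) :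
    ∃ t > s, t ∈ I ∧ Icc s t ⊆ I := by
  obtain ⟨ε, hε, hball⟩ := Metric.isOpen_iff.1 h.isOpen s hs
  have ht : s + ε / 2 ∈ I := hball (by
    rw [Metric.mem_ball, Real.dist_eq, add_sub_cancel_left, abs_of_pos (by linarith)]; linarith)
  exact ⟨s + ε / 2, by linarith, ht, h.ordConnected.out hs ht⟩

/-- For `α < -2` the curve does not return to the axis: at a first return the product
`x / rad * radComp` would vanish, while it is negative and decreasing before. -/
theorem x_pos (h : IsSolution α I x z ψ) (hα : α < -2) {s : ℝ} (hs : s ∈ I) (hs0 : 0 < s) :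
    0 < x s := by
  by_contra hcon
  have hcon : x s ≤ 0 := not_lt.1 hcon
  have hd : HasDerivAt x 1 0 := by
    have := h.x_deriv 0 h.zero_mem
    rwa [h.ψ_zero, Real.cos_zero] at this
  have hev : ∀ᶠ t in 𝓝[>] (0 : ℝ), 0 < x t := by
    have h1 := (hasDerivAt_iff_tendsto_slope.1 hd).eventually (lt_mem_nhds one_pos)
    have h2 : 𝓝[>] (0 : ℝ) ≤ 𝓝[≠] 0 := nhdsWithin_mono _ fun s hs => ne_of_gt hs
    filter_upwards [h2 h1, self_mem_nhdsWithin] with t ht ht0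
    have ht0 : 0 < t := ht0
    rw [slope_def_field, h.x_zero, sub_zero, sub_zero] at ht
    exact (div_pos_iff_of_pos_right ht0).1 ht
  obtain ⟨u, hu, hsub⟩ := mem_nhdsGT_iff_exists_Ioo_subset.1 hev
  have hu0 : 0 < u := hu
  obtain ⟨w, hw⟩ : ∃ w, w = min (u / 2) s := ⟨_, rfl⟩
  have hw0 : 0 < w := hw ▸ lt_min (by linarith) hs0
  have hws : w ≤ s := hw ▸ min_le_right _ _
  have hwu : w < u := (hw ▸ min_le_left _ _ : w ≤ u / 2).trans_lt (by linarith)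
  have hI := h.Icc_subset hs
  obtain ⟨t, ht, ht0, hpos⟩ := exists_first_zero hws
    (h.x_cont.mono fun v hv => hI ⟨hw0.le.trans hv.1, hv.2⟩) (hsub ⟨hw0, hwu⟩) hcon
  have ht_pos : 0 < t := hw0.trans ht.1
  have htI : t ∈ I := hI ⟨ht_pos.le, ht.2⟩
  have hflow := h.polarFlow ht_pos (fun v hv => hI ⟨hv.1, hv.2.le.trans ht.2⟩) (fun v hv => by
    rcases lt_or_ge v w with h1 | h1
    · exact hsub ⟨hv.1, h1.trans hwu⟩
    · exact hpos v ⟨h1, hv.2⟩)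
  have hm : α + 2 < 0 := by linarith
  have hψ := h.ψ_cont.continuousAt (h.isOpen.mem_nhds htI)
  have hcont : Tendsto (fun v => x v / rad x z v * radComp x z ψ v) (𝓝[<] t) (𝓝 0) := by
    have h1 := ((h.x_deriv t htI).continuousAt.div (h.rad_deriv htI).continuousAt
      (h.rad_pos htI).ne').mul ((((h.x_deriv t htI).continuousAt.mul
        (Real.continuous_cos.continuousAt.comp hψ)).add
        ((h.z_deriv t htI).continuousAt.mul (Real.continuous_sin.continuousAt.comp hψ))).div
        (h.rad_deriv htI).continuousAt (h.rad_pos htI).ne')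
    have h2 := h1.tendsto.mono_left (nhdsWithin_le_nhds (s := Iio t))
    simp only [Pi.mul_apply, Pi.div_apply, ht0, zero_div, zero_mul] at h2
    exact h2
  have hhalf : t / 2 ∈ Ioo 0 t := ⟨by linarith, by linarith⟩
  have hle : (0 : ℝ) ≤ x (t / 2) / rad x z (t / 2) * radComp x z ψ (t / 2) := by
    refine le_of_tendsto hcont ?_
    filter_upwards [Ioo_mem_nhdsLT hhalf.2] with v hv
    exact hflow.p_antitone hm.le ⟨hhalf.1.le, hhalf.2⟩ ⟨hhalf.1.le.trans hv.1.le, hv.2⟩ hv.1.le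
  exact absurd (hflow.p_neg hm _ hhalf) (not_lt.2 hle)

/-- For `α < -2` every solution gives a solution of the polar system for positive parameters. -/
theorem polarFlow_of_lt (h : IsSolution α I x z ψ) (hα : α < -2) {T : ℝ} (hT : 0 < T)
    (hTI : Ico 0 T ⊆ I) :
    PolarFlow (α + 2) T (rad x z) (fun s => x s / rad x z s) (fun s => z s / rad x z s)
      (radComp x z ψ) (angComp x z ψ) :=
  h.polarFlow hT hTI fun _ hs => h.x_pos hα (hTI ⟨hs.1.le, hs.2⟩) hs.1

/-- The reflection in the `z`-axis. -/
theorem reflect (h : IsSolution α I x z ψ) :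
    IsSolution α (Neg.neg ⁻¹' I) (fun s => -x (-s)) (fun s => z (-s)) (fun s => -ψ (-s)) where
  isOpen := h.isOpen.preimage continuous_neg
  ordConnected := ⟨fun u hu v hv w hw => h.ordConnected.out hv hu
    ⟨neg_le_neg hw.2, neg_le_neg hw.1⟩⟩
  zero_mem := by simpa using h.zero_mem
  x_zero := by simp [h.x_zero]
  z_zero := by simp [h.z_zero]
  ψ_zero := by simp [h.ψ_zero]
  ne_origin s hs hcon := by
    rw [Prod.mk.injEq, neg_eq_zero] at hcon
    exact h.ne_origin (-s) hs (by rw [hcon.1, hcon.2])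
  x_deriv s hs := by
    refine ((h.x_deriv (-s) hs).scomp s (hasDerivAt_neg s)).neg.congr_deriv ?_
    simp
  z_deriv s hs := by
    refine ((h.z_deriv (-s) hs).scomp s (hasDerivAt_neg s)).congr_deriv ?_
    simp
  ψ_contDiffOn := (h.ψ_contDiffOn.comp contDiff_neg.contDiffOn fun _ hs => hs).neg
  ψ_deriv s hs hx := by
    have := ((h.ψ_deriv (-s) hs (neg_ne_zero.1 hx)).scomp s (hasDerivAt_neg s)).neg
    refine this.congr_deriv ?_
    simp only [Real.cos_neg, Real.sin_neg, smul_eq_mul, neg_mul, one_mul, neg_neg, neg_sq,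
      mul_neg, neg_div_neg_eq]

end IsSolution

/-! ### Uniqueness -/

/-- The right-hand side of the generating-curve system, as a vector field on triples
`(x, z, ψ)`. -/
noncomputable def field (α : ℝ) (p : ℝ × ℝ × ℝ) : ℝ × ℝ × ℝ :=
  (Real.cos p.2.2, Real.sin p.2.2,
    α * ((p.2.1 * Real.cos p.2.2 - p.1 * Real.sin p.2.2) / (p.1 ^ 2 + p.2.1 ^ 2))
      - Real.sin p.2.2 / p.1)

theorem contDiffAt_quotient {n : ℕ∞} {p : ℝ × ℝ × ℝ} (hp : p.1 ^ 2 + p.2.1 ^ 2 ≠ 0) :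
    ContDiffAt ℝ n (fun p : ℝ × ℝ × ℝ =>
      (p.2.1 * Real.cos p.2.2 - p.1 * Real.sin p.2.2) / (p.1 ^ 2 + p.2.1 ^ 2)) p := by
  refine ContDiffAt.div ?_ ?_ hp
  · have : ContDiff ℝ n fun p : ℝ × ℝ × ℝ => p.2.1 * Real.cos p.2.2 - p.1 * Real.sin p.2.2 := by
      fun_prop
    exact this.contDiffAt
  · have : ContDiff ℝ n fun p : ℝ × ℝ × ℝ => p.1 ^ 2 + p.2.1 ^ 2 := by fun_prop
    exact this.contDiffAt

theorem contDiffAt_field (α : ℝ) {n : ℕ∞} {p : ℝ × ℝ × ℝ} (hp : 0 < p.1) :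
    ContDiffAt ℝ n (field α) p := by
  have hsin : ContDiff ℝ n fun p : ℝ × ℝ × ℝ => Real.sin p.2.2 := by fun_prop
  have hcos : ContDiff ℝ n fun p : ℝ × ℝ × ℝ => Real.cos p.2.2 := by fun_prop
  have hp2 : p.1 ^ 2 + p.2.1 ^ 2 ≠ 0 := by positivity
  exact hcos.contDiffAt.prodMk (hsin.contDiffAt.prodMk
    ((contDiffAt_const.mul (contDiffAt_quotient hp2)).sub
      (hsin.contDiffAt.div contDiff_fst.contDiffAt hp.ne')))

/-- Integral curves of the field in `x > 0` that meet coincide. -/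
theorem eqOn_Ioo_of_field {α c d t₀ : ℝ} {u v : ℝ → ℝ × ℝ × ℝ} (ht₀ : t₀ ∈ Ioo c d)
    (hu : ∀ t ∈ Ioo c d, HasDerivAt u (field α (u t)) t) (hu1 : ∀ t ∈ Ioo c d, 0 < (u t).1)
    (hv : ∀ t ∈ Ioo c d, HasDerivAt v (field α (v t)) t)
    (heq : u t₀ = v t₀) : EqOn u v (Ioo c d) := by
  have hopen : IsOpen {t | t ∈ Ioo c d ∧ u =ᶠ[𝓝 t] v} :=
    isOpen_Ioo.inter (isOpen_iff_mem_nhds.2 fun t ht => eventually_eventuallyEq_nhds.2 ht)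
  have hloc : ∀ t ∈ Ioo c d, u t = v t → u =ᶠ[𝓝 t] v := by
    intro t ht hte
    obtain ⟨K, s, hs, hl⟩ :=
      (contDiffAt_field α (n := 1) (hu1 t ht)).exists_lipschitzOnWith
    have hI : ∀ᶠ w in 𝓝 t, w ∈ Ioo c d := Ioo_mem_nhds ht.1 ht.2
    refine ODE_solution_unique_of_eventually (v := fun _ => field α) (s := fun _ => s) (K := K)
      (Eventually.of_forall fun _ => hl) ?_ ?_ hte
    · filter_upwards [hI, (hu t ht).continuousAt.eventually hs] with w hw hws
      exact ⟨hu w hw, hws⟩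
    · rw [hte] at hs
      filter_upwards [hI, (hv t ht).continuousAt.eventually hs] with w hw hws
      exact ⟨hv w hw, hws⟩
  have hsub := isPreconnected_Ioo.subset_of_closure_inter_subset hopen
    ⟨t₀, ht₀, ht₀, hloc t₀ ht₀ heq⟩ ?_
  · exact fun t ht => (hsub ht).2.eq_of_nhds
  · rintro t ⟨htc, ht⟩
    refine ⟨ht, hloc t ht ?_⟩
    have hne : (𝓝[{t | t ∈ Ioo c d ∧ u =ᶠ[𝓝 t] v}] t).NeBot :=
      mem_closure_iff_nhdsWithin_neBot.1 htc
    have h1 : Tendsto u (𝓝[{t | t ∈ Ioo c d ∧ u =ᶠ[𝓝 t] v}] t) (𝓝 (u t)) :=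
      (hu t ht).continuousAt.tendsto.mono_left nhdsWithin_le_nhds
    have h2 : Tendsto v (𝓝[{t | t ∈ Ioo c d ∧ u =ᶠ[𝓝 t] v}] t) (𝓝 (v t)) :=
      (hv t ht).continuousAt.tendsto.mono_left nhdsWithin_le_nhds
    exact tendsto_nhds_unique (h1.congr' (eventually_mem_nhdsWithin.mono fun w hw =>
      hw.2.eq_of_nhds)) h2

/-- The differential inequality behind uniqueness at the axis, with `e`, `Z`, `X * s` the
differences of `ψ`, `z`, `x` of two solutions.  The singular term `(sin ψ₁ - sin ψ₂) / x₁` has the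
favourable sign. -/
theorem energy_bound {A L K s e Z X x₁ x₂ p₁ p₂ g : ℝ} (hL : 0 ≤ L) (hK : 0 ≤ K)
    (hs : 0 < s) (hs1 : s ≤ 1) (hx₁ : s / 2 ≤ x₁) (hx₂ : s / 2 ≤ x₂)
    (hp₁ : |p₁| ≤ K * s) (hp₂ : |p₂| ≤ K * s) (hp₁' : |p₁| ≤ 1) (hp₂' : |p₂| ≤ 1)
    (he : e = p₁ - p₂) (hX : X * s = x₁ - x₂)
    (hg : |g| ≤ L * (|X| * s + |Z| + |e|)) :
    2 * e * (A * g - Real.sin p₁ / x₁ + Real.sin p₂ / x₂) + 2 * Z * (Real.sin p₁ - Real.sin p₂)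
      + 2 * X * ((Real.cos p₁ - Real.cos p₂) / s - X / s)
      ≤ (4 * |A| * L + 10 * K + 2) * (e ^ 2 + Z ^ 2 + X ^ 2) := by
  have hx₁0 : 0 < x₁ := by linarith
  have hx₂0 : 0 < x₂ := by linarith
  have hsq : ∀ u v : ℝ, |u| * |v| ≤ (u ^ 2 + v ^ 2) / 2 := by
    intro u v
    nlinarith [sq_nonneg (|u| - |v|), sq_abs u, sq_abs v]
  have t1 : e * (A * g) ≤ 2 * |A| * L * (e ^ 2 + Z ^ 2 + X ^ 2) := by
    have h1 : |X| * s + |Z| + |e| ≤ |X| + |Z| + |e| := by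
      have := mul_le_of_le_one_right (abs_nonneg X) hs1
      linarith
    have h2 : |e| * (|X| + |Z| + |e|) ≤ 2 * (e ^ 2 + Z ^ 2 + X ^ 2) := by
      have := hsq e X
      have := hsq e Z
      have : |e| * |e| = e ^ 2 := by rw [← sq, sq_abs]
      nlinarith [sq_nonneg Z, sq_nonneg X, sq_nonneg e]
    calc e * (A * g) ≤ |e * (A * g)| := le_abs_self _
      _ = |A| * (|e| * |g|) := by rw [abs_mul, abs_mul]; ring
      _ ≤ |A| * (|e| * (L * (|X| + |Z| + |e|))) := by gcongr; exact hg.trans (by gcongr)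
      _ = |A| * L * (|e| * (|X| + |Z| + |e|)) := by ring
      _ ≤ |A| * L * (2 * (e ^ 2 + Z ^ 2 + X ^ 2)) := by gcongr
      _ = _ := by ring
  have t2 : 0 ≤ e * ((Real.sin p₁ - Real.sin p₂) / x₁) := by
    have hpi := Real.pi_gt_three
    have m1 : p₁ ∈ Icc (-(Real.pi / 2)) (Real.pi / 2) :=
      ⟨by linarith [(abs_le.1 hp₁').1], by linarith [(abs_le.1 hp₁').2]⟩
    have m2 : p₂ ∈ Icc (-(Real.pi / 2)) (Real.pi / 2) :=
      ⟨by linarith [(abs_le.1 hp₂').1], by linarith [(abs_le.1 hp₂').2]⟩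
    rw [he]
    rcases le_total p₁ p₂ with h | h
    · have := Real.strictMonoOn_sin.monotoneOn m1 m2 h
      exact mul_nonneg_of_nonpos_of_nonpos (by linarith)
        (div_nonpos_of_nonpos_of_nonneg (by linarith) hx₁0.le)
    · have := Real.strictMonoOn_sin.monotoneOn m2 m1 h
      exact mul_nonneg (by linarith) (div_nonneg (by linarith) hx₁0.le)
  have t3 : e * (Real.sin p₂ / x₂ * (X * s / x₁)) ≤ 4 * K * ((e ^ 2 + X ^ 2) / 2) := by
    have h1 : |Real.sin p₂ / x₂| ≤ 2 * K := by
      rw [abs_div, abs_of_pos hx₂0, div_le_iff₀ hx₂0]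
      have := Real.abs_sin_sub_sin_le p₂ 0
      rw [Real.sin_zero, sub_zero, sub_zero] at this
      nlinarith
    have h2 : |X * s / x₁| ≤ 2 * |X| := by
      rw [abs_div, abs_mul, abs_of_pos hx₁0, abs_of_pos hs, div_le_iff₀ hx₁0]
      nlinarith [abs_nonneg X]
    calc e * (Real.sin p₂ / x₂ * (X * s / x₁)) ≤ |e * (Real.sin p₂ / x₂ * (X * s / x₁))| :=
          le_abs_self _
      _ = |e| * (|Real.sin p₂ / x₂| * |X * s / x₁|) := by rw [abs_mul, abs_mul]
      _ ≤ |e| * (2 * K * (2 * |X|)) := by gcongr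
      _ = 4 * K * (|e| * |X|) := by ring
      _ ≤ _ := by gcongr; exact hsq e X
  have t4 : Z * (Real.sin p₁ - Real.sin p₂) ≤ (e ^ 2 + Z ^ 2) / 2 := by
    calc Z * (Real.sin p₁ - Real.sin p₂) ≤ |Z * (Real.sin p₁ - Real.sin p₂)| := le_abs_self _
      _ = |Real.sin p₁ - Real.sin p₂| * |Z| := by rw [abs_mul, mul_comm]
      _ ≤ |e| * |Z| := by
        rw [he]
        exact mul_le_mul_of_nonneg_right (Real.abs_sin_sub_sin_le p₁ p₂) (abs_nonneg Z)
      _ ≤ _ := hsq e Z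
  have t5 : X * ((Real.cos p₁ - Real.cos p₂) / s) ≤ K * ((e ^ 2 + X ^ 2) / 2) := by
    have h1 : |(Real.cos p₁ - Real.cos p₂) / s| ≤ K * |e| := by
      rw [abs_div, abs_of_pos hs, div_le_iff₀ hs, Real.cos_sub_cos, abs_mul, abs_mul]
      have h2 := Real.abs_sin_sub_sin_le ((p₁ + p₂) / 2) 0
      have h3 := Real.abs_sin_sub_sin_le ((p₁ - p₂) / 2) 0
      rw [Real.sin_zero, sub_zero, sub_zero] at h2 h3
      rw [← he, abs_div, abs_two] at h3
      have h4 : |(p₁ + p₂) / 2| ≤ K * s := by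
        rw [abs_div, abs_two]
        linarith [abs_add_le p₁ p₂]
      rw [abs_neg, abs_two, ← he]
      calc 2 * |Real.sin ((p₁ + p₂) / 2)| * |Real.sin (e / 2)| ≤ 2 * (K * s) * (|e| / 2) := by
            gcongr
            exact h2.trans h4
        _ = _ := by ring
    calc X * ((Real.cos p₁ - Real.cos p₂) / s) ≤ |X * ((Real.cos p₁ - Real.cos p₂) / s)| :=
          le_abs_self _
      _ ≤ |X| * (K * |e|) := by rw [abs_mul]; gcongr
      _ = K * (|e| * |X|) := by ring
      _ ≤ _ := by gcongr; exact hsq e X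
  have t6 : 0 ≤ X * (X / s) := by
    rw [← mul_div_assoc]; exact div_nonneg (mul_self_nonneg X) hs.le
  have expand : Real.sin p₁ / x₁ - Real.sin p₂ / x₂
      = (Real.sin p₁ - Real.sin p₂) / x₁ - Real.sin p₂ / x₂ * (X * s / x₁) := by
    rw [hX]; field_simp; ring
  have hlhs : 2 * e * (A * g - Real.sin p₁ / x₁ + Real.sin p₂ / x₂)
      = 2 * (e * (A * g)) - 2 * (e * ((Real.sin p₁ - Real.sin p₂) / x₁))
        + 2 * (e * (Real.sin p₂ / x₂ * (X * s / x₁))) := by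
    linear_combination (-2 * e) * expand
  rw [hlhs]
  have hKX : 0 ≤ K * e ^ 2 := by positivity
  have hKX2 : 0 ≤ K * X ^ 2 := by positivity
  have hKX3 : 0 ≤ K * Z ^ 2 := by positivity
  nlinarith [sq_nonneg e, sq_nonneg Z, sq_nonneg X]

theorem IsSolution.eventually_near_zero {α : ℝ} {I : Set ℝ} {x z ψ : ℝ → ℝ}
    (h : IsSolution α I x z ψ) : ∃ K : ℝ, 0 ≤ K ∧ ∀ᶠ s in 𝓝[>] (0 : ℝ),
      s ∈ I ∧ s / 2 ≤ x s ∧ |ψ s| ≤ K * s ∧ |ψ s| ≤ 1 := by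
  have hI : ∀ᶠ s in 𝓝[>] (0 : ℝ), s ∈ I :=
    nhdsWithin_le_nhds (h.isOpen.mem_nhds h.zero_mem)
  have hψd : DifferentiableAt ℝ ψ 0 :=
    (h.ψ_contDiffOn.differentiableOn one_ne_zero).differentiableAt
      (h.isOpen.mem_nhds h.zero_mem)
  obtain ⟨K, hK⟩ := hψd.isBigO_sub.bound
  have hd : HasDerivAt x 1 0 := by
    have := h.x_deriv 0 h.zero_mem
    rwa [h.ψ_zero, Real.cos_zero] at this
  have hx : ∀ᶠ s in 𝓝[>] (0 : ℝ), s / 2 ≤ x s := by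
    have h1 := (hasDerivAt_iff_tendsto_slope.1 hd).eventually
      (lt_mem_nhds (show (1 : ℝ) / 2 < 1 by norm_num))
    have h2 : 𝓝[>] (0 : ℝ) ≤ 𝓝[≠] 0 := nhdsWithin_mono _ fun s hs => ne_of_gt hs
    filter_upwards [h2 h1, self_mem_nhdsWithin] with t ht ht0
    have ht0 : 0 < t := ht0
    rw [slope_def_field, h.x_zero, sub_zero, sub_zero, lt_div_iff₀ ht0] at ht
    linarith
  have hψ1 : ∀ᶠ s in 𝓝[>] (0 : ℝ), |ψ s| < 1 := by
    refine nhdsWithin_le_nhds (hψd.continuousAt.abs.eventually (gt_mem_nhds ?_))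
    simp only [h.ψ_zero, abs_zero]
    exact one_pos
  refine ⟨max K 0, le_max_right _ _, ?_⟩
  filter_upwards [hI, hx, hψ1, nhdsWithin_le_nhds hK, self_mem_nhdsWithin] with s h1 h2 h3 h4 h5
  have h5 : 0 < s := h5
  refine ⟨h1, h2, ?_, h3.le⟩
  simp only [h.ψ_zero, sub_zero, Real.norm_eq_abs, abs_of_pos h5] at h4
  exact h4.trans (mul_le_mul_of_nonneg_right (le_max_left _ _) h5.le)

/-- Two solutions coincide for small positive parameters: Grönwall for the sum of the squares of
the differences of `ψ`, of `z` and of `x / s`. -/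
theorem IsSolution.eventuallyEq_near_zero {α : ℝ} {I₁ I₂ : Set ℝ} {x₁ z₁ ψ₁ x₂ z₂ ψ₂ : ℝ → ℝ}
    (h₁ : IsSolution α I₁ x₁ z₁ ψ₁) (h₂ : IsSolution α I₂ x₂ z₂ ψ₂) :
    ∀ᶠ s in 𝓝[>] (0 : ℝ), x₁ s = x₂ s ∧ z₁ s = z₂ s ∧ ψ₁ s = ψ₂ s := by
  obtain ⟨K₁, hK₁, ev₁⟩ := h₁.eventually_near_zero
  obtain ⟨K₂, hK₂, ev₂⟩ := h₂.eventually_near_zero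
  obtain ⟨L, N, hN, hL⟩ := (contDiffAt_quotient (n := 1) (p := ((0 : ℝ), (1 : ℝ), (0 : ℝ)))
    (by norm_num)).exists_lipschitzOnWith
  have hmem : ∀ {I : Set ℝ} {x z ψ : ℝ → ℝ}, IsSolution α I x z ψ →
      ∀ᶠ s in 𝓝[>] (0 : ℝ), (x s, z s, ψ s) ∈ N := by
    intro I x z ψ h
    have hc : ContinuousAt (fun s => (x s, z s, ψ s)) 0 :=
      (h.x_deriv 0 h.zero_mem).continuousAt.prodMk ((h.z_deriv 0 h.zero_mem).continuousAt.prodMk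
        (h.ψ_cont.continuousAt (h.isOpen.mem_nhds h.zero_mem)))
    have hN' : N ∈ 𝓝 (x 0, z 0, ψ 0) := by rw [h.x_zero, h.z_zero, h.ψ_zero]; exact hN
    exact nhdsWithin_le_nhds (hc hN')
  have hlt1 : ∀ᶠ s in 𝓝[>] (0 : ℝ), s ∈ Ioo (0 : ℝ) 1 := Ioo_mem_nhdsGT one_pos
  obtain ⟨ε, hε, hsub⟩ := mem_nhdsGT_iff_exists_Ioo_subset.1
    (ev₁.and (ev₂.and ((hmem h₁).and ((hmem h₂).and hlt1))))
  have hε0 : 0 < ε := hε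
  obtain ⟨K, hK⟩ : ∃ K, K = max K₁ K₂ := ⟨_, rfl⟩
  have hKK₁ : K₁ ≤ K := hK ▸ le_max_left _ _
  have hKK₂ : K₂ ≤ K := hK ▸ le_max_right _ _
  obtain ⟨M, hM⟩ : ∃ M, M = 4 * |α| * (L : ℝ) + 10 * K + 2 := ⟨_, rfl⟩
  have hI₁ : ∀ s ∈ Ico 0 ε, s ∈ I₁ := fun s hs => by
    rcases hs.1.eq_or_lt with h | h
    · rw [← h]; exact h₁.zero_mem
    · exact (hsub ⟨h, hs.2⟩).1.1
  have hI₂ : ∀ s ∈ Ico 0 ε, s ∈ I₂ := fun s hs => by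
    rcases hs.1.eq_or_lt with h | h
    · rw [← h]; exact h₂.zero_mem
    · exact (hsub ⟨h, hs.2⟩).2.1.1
  have hE0 : ((ψ₁ 0 - ψ₂ 0) ^ 2 + (z₁ 0 - z₂ 0) ^ 2 + ((x₁ 0 - x₂ 0) / 0) ^ 2)
      * Real.exp (-M * 0) = 0 := by
    rw [h₁.ψ_zero, h₂.ψ_zero, h₁.z_zero, h₂.z_zero]; simp
  have hXcont : ContinuousOn (fun s => (x₁ s - x₂ s) / s) (Ico 0 ε) := by
    intro s hs
    rcases hs.1.eq_or_lt with h | h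
    · subst h
      have hd := (h₁.x_deriv 0 h₁.zero_mem).sub (h₂.x_deriv 0 h₂.zero_mem)
      rw [h₁.ψ_zero, h₂.ψ_zero, sub_self] at hd
      have h3 := hasDerivAt_iff_tendsto_slope.1 hd
      have h4 : ContinuousAt (fun s => (x₁ s - x₂ s) / s) 0 := by
        rw [continuousAt_iff_punctured_nhds]
        refine (h3.congr fun t => ?_).trans_eq ?_
        · rw [slope_def_field]; simp [h₁.x_zero, h₂.x_zero]
        · simp
      exact h4.continuousWithinAt
    · exact (((h₁.x_deriv s (hI₁ s hs)).continuousAt.sub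
        (h₂.x_deriv s (hI₂ s hs)).continuousAt).div continuousAt_id h.ne').continuousWithinAt
  have hcont : ContinuousOn (fun s => ((ψ₁ s - ψ₂ s) ^ 2 + (z₁ s - z₂ s) ^ 2
      + ((x₁ s - x₂ s) / s) ^ 2) * Real.exp (-M * s)) (Ico 0 ε) := by
    have a1 := (h₁.ψ_cont.mono hI₁).sub (h₂.ψ_cont.mono hI₂)
    have a2 := (h₁.z_cont.mono hI₁).sub (h₂.z_cont.mono hI₂)
    exact ((((a1.pow 2).add (a2.pow 2)).add (hXcont.pow 2))).mul (by fun_prop)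
  have hanti : AntitoneOn (fun s => ((ψ₁ s - ψ₂ s) ^ 2 + (z₁ s - z₂ s) ^ 2
      + ((x₁ s - x₂ s) / s) ^ 2) * Real.exp (-M * s)) (Ico 0 ε) := by
    have hd : ∀ s ∈ Ioo 0 ε, ∃ E' ≤ 0, HasDerivAt (fun s => ((ψ₁ s - ψ₂ s) ^ 2
        + (z₁ s - z₂ s) ^ 2 + ((x₁ s - x₂ s) / s) ^ 2) * Real.exp (-M * s)) E' s := by
      intro s hs
      obtain ⟨⟨hsI₁, hx₁, hψ₁, hψ₁'⟩, ⟨hsI₂, hx₂, hψ₂, hψ₂'⟩, hn₁, hn₂, -, hs1⟩ := hsub hs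
      have hs0 : 0 < s := hs.1
      have hx₁0 : x₁ s ≠ 0 := by linarith
      have hx₂0 : x₂ s ≠ 0 := by linarith
      have hg := hL.dist_le_mul _ hn₁ _ hn₂
      have hb := energy_bound (A := α) (L := L) (K := K) (s := s) (e := ψ₁ s - ψ₂ s)
        (Z := z₁ s - z₂ s) (X := (x₁ s - x₂ s) / s) (x₁ := x₁ s) (x₂ := x₂ s) (p₁ := ψ₁ s)
        (p₂ := ψ₂ s)
        (g := (z₁ s * Real.cos (ψ₁ s) - x₁ s * Real.sin (ψ₁ s)) / (x₁ s ^ 2 + z₁ s ^ 2)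
          - (z₂ s * Real.cos (ψ₂ s) - x₂ s * Real.sin (ψ₂ s)) / (x₂ s ^ 2 + z₂ s ^ 2))
        L.2 (hK₁.trans hKK₁) hs0 hs1.le hx₁ hx₂
        (hψ₁.trans (mul_le_mul_of_nonneg_right hKK₁ hs0.le))
        (hψ₂.trans (mul_le_mul_of_nonneg_right hKK₂ hs0.le)) hψ₁' hψ₂' rfl
        (div_mul_cancel₀ _ hs0.ne') ?_
      · refine ⟨_, ?_, (((((h₁.ψ_deriv s hsI₁ hx₁0).sub (h₂.ψ_deriv s hsI₂ hx₂0)).pow 2).add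
          (((h₁.z_deriv s hsI₁).sub (h₂.z_deriv s hsI₂)).pow 2)).add
          ((((h₁.x_deriv s hsI₁).sub (h₂.x_deriv s hsI₂)).div (hasDerivAt_id s) hs0.ne').pow
            2)).mul ((((hasDerivAt_id s).const_mul (-M)).exp))⟩
        rw [← hM] at hb
        simp only [Pi.add_apply, Pi.sub_apply, Pi.pow_apply, Pi.div_apply, id, mul_one]
        have hexp := Real.exp_pos (-M * s)
        have h5 : ((Real.cos (ψ₁ s) - Real.cos (ψ₂ s)) * s - (x₁ s - x₂ s)) / s ^ 2
            = (Real.cos (ψ₁ s) - Real.cos (ψ₂ s)) / s - (x₁ s - x₂ s) / s / s := by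
          field_simp
        rw [h5]
        have h6 := mul_le_mul_of_nonneg_right hb hexp.le
        simp only [Nat.add_one_sub_one, Nat.cast_ofNat, pow_one]
        linarith
      · refine hg.trans (mul_le_mul_of_nonneg_left ?_ L.2)
        simp only [Prod.dist_eq, Real.dist_eq]
        rw [abs_div, abs_of_pos hs0, div_mul_cancel₀ _ hs0.ne']
        have n1 := abs_nonneg (x₁ s - x₂ s)
        have n2 := abs_nonneg (z₁ s - z₂ s)
        have n3 := abs_nonneg (ψ₁ s - ψ₂ s)
        exact max_le (by linarith) (max_le (by linarith) (by linarith))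
    refine antitoneOn_of_deriv_nonpos (convex_Ico 0 ε) hcont (fun s hs => ?_) (fun s hs => ?_)
    · rw [interior_Ico] at hs
      obtain ⟨E', -, h⟩ := hd s hs
      exact h.differentiableAt.differentiableWithinAt
    · rw [interior_Ico] at hs
      obtain ⟨E', hE', h⟩ := hd s hs
      rw [h.deriv]; exact hE'
  filter_upwards [Ioo_mem_nhdsGT hε0] with s hs
  have h1 := hanti ⟨le_rfl, hε0⟩ ⟨hs.1.le, hs.2⟩ hs.1.le
  simp only [hE0] at h1
  have h2 := nonpos_of_mul_nonpos_left h1 (Real.exp_pos _)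
  have q1 := sq_nonneg (ψ₁ s - ψ₂ s)
  have q2 := sq_nonneg (z₁ s - z₂ s)
  have q3 := sq_nonneg ((x₁ s - x₂ s) / s)
  have r1 : ψ₁ s - ψ₂ s = 0 := pow_eq_zero_iff two_ne_zero |>.1 (by linarith)
  have r2 : z₁ s - z₂ s = 0 := pow_eq_zero_iff two_ne_zero |>.1 (by linarith)
  have r3 : (x₁ s - x₂ s) / s = 0 := pow_eq_zero_iff two_ne_zero |>.1 (by linarith)
  rw [div_eq_zero_iff] at r3
  exact ⟨sub_eq_zero.1 (r3.resolve_right hs.1.ne'), sub_eq_zero.1 r2, sub_eq_zero.1 r1⟩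

variable {α : ℝ} {I : Set ℝ} {x z ψ : ℝ → ℝ}

theorem IsSolution.hasDerivAt_field (h : IsSolution α I x z ψ) {s : ℝ} (hs : s ∈ I)
    (hx : x s ≠ 0) : HasDerivAt (fun s => (x s, z s, ψ s)) (field α (x s, z s, ψ s)) s :=
  (h.x_deriv s hs).prodMk ((h.z_deriv s hs).prodMk (h.ψ_deriv s hs hx))

theorem IsSolution.eq_of_nonneg {I' : Set ℝ} {x' z' ψ' : ℝ → ℝ} (hα : α < -2)
    (h : IsSolution α I x z ψ) (h' : IsSolution α I' x' z' ψ') {s : ℝ} (hs : s ∈ I)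
    (hs' : s ∈ I') (hs0 : 0 ≤ s) : x s = x' s ∧ z s = z' s ∧ ψ s = ψ' s := by
  rcases hs0.eq_or_lt with h0 | h0
  · subst h0
    exact ⟨h.x_zero.trans h'.x_zero.symm, h.z_zero.trans h'.z_zero.symm,
      h.ψ_zero.trans h'.ψ_zero.symm⟩
  obtain ⟨t, ht, htI, -⟩ := h.exists_gt hs
  obtain ⟨t', ht', htI', -⟩ := h'.exists_gt hs'
  obtain ⟨d, hd⟩ : ∃ d, d = min t t' := ⟨_, rfl⟩
  have hsd : s < d := hd ▸ lt_min ht ht'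
  have hdI : ∀ v ∈ Ioo 0 d, v ∈ I := fun v hv =>
    h.Icc_subset htI ⟨hv.1.le, hv.2.le.trans (hd ▸ min_le_left _ _)⟩
  have hdI' : ∀ v ∈ Ioo 0 d, v ∈ I' := fun v hv =>
    h'.Icc_subset htI' ⟨hv.1.le, hv.2.le.trans (hd ▸ min_le_right _ _)⟩
  obtain ⟨t₀, ⟨e1, e2, e3⟩, ht₀⟩ := ((h.eventuallyEq_near_zero h').and
    (Ioo_mem_nhdsGT (h0.trans hsd))).exists
  have hx : ∀ v ∈ Ioo 0 d, 0 < x v := fun v hv => h.x_pos hα (hdI v hv) hv.1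
  have hx' : ∀ v ∈ Ioo 0 d, 0 < x' v := fun v hv => h'.x_pos hα (hdI' v hv) hv.1
  have heq := eqOn_Ioo_of_field (α := α) (u := fun s => (x s, z s, ψ s))
    (v := fun s => (x' s, z' s, ψ' s)) ht₀
    (fun v hv => h.hasDerivAt_field (hdI v hv) (hx v hv).ne') hx
    (fun v hv => h'.hasDerivAt_field (hdI' v hv) (hx' v hv).ne') (by simp only [e1, e2, e3])
  have := heq ⟨h0, hsd⟩
  simpa only [Prod.mk.injEq] using this

/-- Two solutions coincide on the intersection of their intervals. -/
theorem IsSolution.eq_of_mem {I' : Set ℝ} {x' z' ψ' : ℝ → ℝ} (hα : α < -2)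
    (h : IsSolution α I x z ψ) (h' : IsSolution α I' x' z' ψ') {s : ℝ} (hs : s ∈ I)
    (hs' : s ∈ I') : x s = x' s ∧ z s = z' s ∧ ψ s = ψ' s := by
  rcases le_total 0 s with h0 | h0
  · exact h.eq_of_nonneg hα h' hs hs' h0
  · have := h.reflect.eq_of_nonneg hα h'.reflect (s := -s) (by simpa using hs)
      (by simpa using hs') (by linarith)
    simpa only [neg_neg, neg_inj] using this

/-! ### Gluing and extension -/

/-- The differential conditions of `IsSolution` on an open set, without initial conditions. -/
structure IsFlow (α : ℝ) (J : Set ℝ) (x z ψ : ℝ → ℝ) : Prop where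
  isOpen : IsOpen J
  ne_origin : ∀ s ∈ J, (x s, z s) ≠ (0, 0)
  x_deriv : ∀ s ∈ J, HasDerivAt x (Real.cos (ψ s)) s
  z_deriv : ∀ s ∈ J, HasDerivAt z (Real.sin (ψ s)) s
  ψ_contDiffOn : ContDiffOn ℝ 1 ψ J
  ψ_deriv : ∀ s ∈ J, x s ≠ 0 →
    HasDerivAt ψ (α * ((z s * Real.cos (ψ s) - x s * Real.sin (ψ s)) / (x s ^ 2 + z s ^ 2))
      - Real.sin (ψ s) / x s) s

theorem IsSolution.isFlow (h : IsSolution α I x z ψ) : IsFlow α I x z ψ :=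
  ⟨h.isOpen, h.ne_origin, h.x_deriv, h.z_deriv, h.ψ_contDiffOn, h.ψ_deriv⟩

theorem IsFlow.congr {J : Set ℝ} {x' z' ψ' : ℝ → ℝ} (h : IsFlow α J x z ψ) (hx : EqOn x' x J)
    (hz : EqOn z' z J) (hψ : EqOn ψ' ψ J) : IsFlow α J x' z' ψ' where
  isOpen := h.isOpen
  ne_origin s hs := by rw [hx hs, hz hs]; exact h.ne_origin s hs
  x_deriv s hs := by
    rw [hψ hs]
    exact (h.x_deriv s hs).congr_of_eventuallyEq (hx.eventuallyEq_of_mem (h.isOpen.mem_nhds hs))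
  z_deriv s hs := by
    rw [hψ hs]
    exact (h.z_deriv s hs).congr_of_eventuallyEq (hz.eventuallyEq_of_mem (h.isOpen.mem_nhds hs))
  ψ_contDiffOn := h.ψ_contDiffOn.congr hψ
  ψ_deriv s hs hxs := by
    rw [hψ hs, hx hs, hz hs]
    rw [hx hs] at hxs
    exact (h.ψ_deriv s hs hxs).congr_of_eventuallyEq
      (hψ.eventuallyEq_of_mem (h.isOpen.mem_nhds hs))

theorem IsFlow.union {J J' : Set ℝ} (h : IsFlow α J x z ψ) (h' : IsFlow α J' x z ψ) :
    IsFlow α (J ∪ J') x z ψ where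
  isOpen := h.isOpen.union h'.isOpen
  ne_origin s hs := hs.elim (h.ne_origin s) (h'.ne_origin s)
  x_deriv s hs := hs.elim (h.x_deriv s) (h'.x_deriv s)
  z_deriv s hs := hs.elim (h.z_deriv s) (h'.z_deriv s)
  ψ_contDiffOn := h.ψ_contDiffOn.union_of_isOpen h'.ψ_contDiffOn h.isOpen h'.isOpen
  ψ_deriv s hs := hs.elim (h.ψ_deriv s) (h'.ψ_deriv s)

/-- A maximal solution is not extended by any overlapping piece of solution. -/
theorem IsMaximalSolution.subset_of_isFlow (h : IsMaximalSolution α I x z ψ) {J : Set ℝ}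
    {x' z' ψ' : ℝ → ℝ} (h' : IsFlow α J x' z' ψ') (hJ : J.OrdConnected) (hne : (I ∩ J).Nonempty)
    (hagree : ∀ s ∈ I ∩ J, x s = x' s ∧ z s = z' s ∧ ψ s = ψ' s) : J ⊆ I := by
  classical
  have hI : ∀ f f' : ℝ → ℝ, EqOn (I.piecewise f f') f I := fun f f' => piecewise_eqOn I f f'
  have hJe : ∀ f f' : ℝ → ℝ, (∀ s ∈ I ∩ J, f s = f' s) → EqOn (I.piecewise f f') f' J := by
    intro f f' hff s hs
    by_cases hsI : s ∈ I
    · rw [piecewise_eq_of_mem _ _ _ hsI]; exact hff s ⟨hsI, hs⟩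
    · exact piecewise_eq_of_notMem _ _ _ hsI
  have hflow : IsFlow α (I ∪ J) (I.piecewise x x') (I.piecewise z z') (I.piecewise ψ ψ') :=
    (h.1.isFlow.congr (hI _ _) (hI _ _) (hI _ _)).union
      (h'.congr (hJe _ _ fun s hs => (hagree s hs).1) (hJe _ _ fun s hs => (hagree s hs).2.1)
        (hJe _ _ fun s hs => (hagree s hs).2.2))
  have hconn : (I ∪ J).OrdConnected := by
    have h1 := h.1.ordConnected.isPreconnected.union' hne hJ.isPreconnected
    exact h1.ordConnected
  have hsol : IsSolution α (I ∪ J) (I.piecewise x x') (I.piecewise z z') (I.piecewise ψ ψ') :=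
    { isOpen := hflow.isOpen
      ordConnected := hconn
      zero_mem := Or.inl h.1.zero_mem
      x_zero := (hI _ _ h.1.zero_mem).trans h.1.x_zero
      z_zero := (hI _ _ h.1.zero_mem).trans h.1.z_zero
      ψ_zero := (hI _ _ h.1.zero_mem).trans h.1.ψ_zero
      ne_origin := hflow.ne_origin
      x_deriv := hflow.x_deriv
      z_deriv := hflow.z_deriv
      ψ_contDiffOn := hflow.ψ_contDiffOn
      ψ_deriv := hflow.ψ_deriv }
  rw [← h.2 _ _ _ _ hsol subset_union_left (hI _ _) (hI _ _) (hI _ _)]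
  exact subset_union_right

theorem IsMaximalSolution.subset_of_isSolution (h : IsMaximalSolution α I x z ψ) (hα : α < -2)
    {J : Set ℝ} {x' z' ψ' : ℝ → ℝ} (h' : IsSolution α J x' z' ψ') : J ⊆ I :=
  h.subset_of_isFlow h'.isFlow h'.ordConnected ⟨0, h.1.zero_mem, h'.zero_mem⟩
    fun _ hs => h.1.eq_of_mem hα h' hs.1 hs.2

theorem IsMaximalSolution.neg_mem (h : IsMaximalSolution α I x z ψ) (hα : α < -2) {s : ℝ}
    (hs : s ∈ I) : -s ∈ I :=
  h.subset_of_isSolution hα h.1.reflect (by simpa using hs)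

theorem IsMaximalSolution.symm (h : IsMaximalSolution α I x z ψ) (hα : α < -2) {s : ℝ}
    (hs : s ∈ I) : x (-s) = -x s ∧ z (-s) = z s := by
  have := h.1.eq_of_mem hα h.1.reflect (h.neg_mem hα hs) (by simpa using hs)
  rw [neg_neg] at this
  exact ⟨this.1, this.2.1⟩

theorem contDiffOn_of_field {w : ℝ → ℝ × ℝ × ℝ} {c d : ℝ} {n : ℕ∞}
    (hw : ∀ t ∈ Ioo c d, HasDerivAt w (field α (w t)) t) (hw1 : ∀ t ∈ Ioo c d, 0 < (w t).1) :
    ContDiffOn ℝ n w (Ioo c d) := by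
  intro t ht
  obtain ⟨t₁, h1, h1'⟩ := exists_between ht.1
  obtain ⟨t₂, h2, h2'⟩ := exists_between ht.2
  have hsub : Icc t₁ t₂ ⊆ Ioo c d := fun v hv => ⟨h1.trans_le hv.1, hv.2.trans_lt h2'⟩
  have hu : ContDiffOn ℝ n (Function.uncurry fun _ : ℝ => field α)
      (Icc t₁ t₂ ×ˢ {p : ℝ × ℝ × ℝ | 0 < p.1}) := by
    intro p hp
    exact ((contDiffAt_field α hp.2).comp p contDiffAt_snd).contDiffWithinAt
  have := ODE.contDiffOn_enat_Icc_of_hasDerivWithinAt hu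
    (fun v hv => (hw v (hsub hv)).hasDerivWithinAt) fun v hv => hw1 v (hsub hv)
  exact (this.contDiffAt (Icc_mem_nhds h1' h2)).contDiffWithinAt

theorem isFlow_of_field {w : ℝ → ℝ × ℝ × ℝ} {c d : ℝ}
    (hw : ∀ t ∈ Ioo c d, HasDerivAt w (field α (w t)) t) (hw1 : ∀ t ∈ Ioo c d, 0 < (w t).1) :
    IsFlow α (Ioo c d) (fun t => (w t).1) (fun t => (w t).2.1) (fun t => (w t).2.2) where
  isOpen := isOpen_Ioo
  ne_origin s hs hcon := (hw1 s hs).ne' (Prod.mk.inj hcon).1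
  x_deriv s hs := (hw s hs).fst
  z_deriv s hs := (hw s hs).snd.fst
  ψ_contDiffOn := ((contDiffOn_of_field (n := 1) hw hw1).snd).snd
  ψ_deriv s hs _ := (hw s hs).snd.snd

/-- Near a point with `x > 0`, integral curves exist for a uniform time and stay in `x > 0`. -/
theorem exists_uniform_flow (α : ℝ) {p : ℝ × ℝ × ℝ} (hp : 0 < p.1) :
    ∃ δ > 0, ∃ ε > 0, ∀ t₀ : ℝ, ∀ q ∈ Metric.ball p δ, ∃ w : ℝ → ℝ × ℝ × ℝ, w t₀ = q ∧
      (∀ t ∈ Ioo (t₀ - ε) (t₀ + ε), HasDerivAt w (field α (w t)) t) ∧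
      ∀ t ∈ Ioo (t₀ - ε) (t₀ + ε), 0 < (w t).1 := by
  obtain ⟨ε, hε, a, r, L, K, hr, hpl⟩ :=
    IsPicardLindelof.of_contDiffAt_one (contDiffAt_field α (n := 1) hp)
  obtain ⟨f, hf, hfc⟩ := (hpl 0).exists_forall_mem_closedBall_eq_hasDerivWithinAt_continuousOn
  have hr0 : (0 : ℝ) < r := hr
  have hnhds : Metric.closedBall p (r : ℝ) ×ˢ Icc (0 - ε) (0 + ε) ∈ 𝓝 (p, (0 : ℝ)) :=
    prod_mem_nhds (Metric.closedBall_mem_nhds p hr0) (Icc_mem_nhds (by linarith) (by linarith))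
  have hc : ContinuousAt f (p, 0) := hfc.continuousAt hnhds
  have hf0 : f (p, 0) = p := (hf p (Metric.mem_closedBall_self hr0.le)).1
  have hpos : ∀ᶠ q in 𝓝 (p, (0 : ℝ)), 0 < (f q).1 := by
    refine (continuous_fst.continuousAt.comp hc).eventually (lt_mem_nhds ?_)
    simpa [hf0] using hp
  obtain ⟨ρ, hρ, hball⟩ := Metric.mem_nhds_iff.1 (inter_mem hnhds hpos)
  refine ⟨ρ, hρ, min ε ρ, lt_min hε hρ, fun t₀ q hq => ⟨fun t => f (q, t - t₀), ?_, ?_, ?_⟩⟩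
  · have hq0 : (q, (0 : ℝ)) ∈ Metric.ball (p, (0 : ℝ)) ρ := by
      rw [Metric.mem_ball, Prod.dist_eq, dist_self]; exact max_lt hq hρ
    simp only [sub_self]
    exact (hf q (hball hq0).1.1).1
  all_goals
    intro t ht
    have hmin1 := min_le_left ε ρ
    have hmin2 := min_le_right ε ρ
    have ht1 := ht.1
    have ht2 := ht.2
    have hqt : (q, t - t₀) ∈ Metric.ball (p, (0 : ℝ)) ρ := by
      rw [Metric.mem_ball, Prod.dist_eq, Real.dist_eq (t - t₀)]
      exact max_lt hq (by rw [abs_lt]; constructor <;> linarith)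
    have hm := hball hqt
  · have h1 := ((hf q hm.1.1).2 (t - t₀) hm.1.2).hasDerivAt
      (Icc_mem_nhds (by linarith) (by linarith))
    have h2 := h1.scomp t ((hasDerivAt_id t).sub_const t₀)
    rw [one_smul] at h2
    exact h2
  · exact hm.2

/-- Solutions exist for a finite time only, because the distance to the origin decreases at a rate
bounded away from `0`. -/
theorem IsSolution.bddAbove (h : IsSolution α I x z ψ) (hα : α < -2) : BddAbove I := by
  obtain ⟨s₀, hs₀, hs₀I, -⟩ := h.exists_gt h.zero_mem
  have hm : α + 2 < 0 := by linarith
  obtain ⟨κ, hκ⟩ : ∃ κ, κ = -(x s₀ / rad x z s₀ * radComp x z ψ s₀) := ⟨_, rfl⟩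
  have hκ0 : 0 < κ := by
    obtain ⟨t, ht, htI, -⟩ := h.exists_gt hs₀I
    have hflow := h.polarFlow_of_lt hα (hs₀.trans ht)
      (fun v hv => h.Icc_subset htI ⟨hv.1, hv.2.le⟩)
    rw [hκ]
    linarith [hflow.p_neg hm s₀ ⟨hs₀, ht⟩]
  refine ⟨s₀ + rad x z s₀ / κ, fun s hs => ?_⟩
  rcases le_total s s₀ with hle | hle
  · linarith [div_nonneg (h.rad_pos hs₀I).le hκ0.le]
  obtain ⟨t, ht, htI, -⟩ := h.exists_gt hs
  have hT : 0 < t := hs₀.trans_le (hle.trans ht.le)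
  have hflow := h.polarFlow_of_lt hα hT (fun v hv => h.Icc_subset htI ⟨hv.1, hv.2.le⟩)
  have hd : ∀ v ∈ Icc s₀ s, HasDerivAt (fun v => rad x z v + κ * v)
      (radComp x z ψ v + κ * 1) v := fun v hv =>
    (h.rad_deriv (h.Icc_subset hs ⟨hs₀.le.trans hv.1, hv.2⟩)).add ((hasDerivAt_id v).const_mul κ)
  have hanti : AntitoneOn (fun v => rad x z v + κ * v) (Icc s₀ s) := by
    refine antitoneOn_of_deriv_nonpos (convex_Icc s₀ s)
      (fun v hv => (hd v hv).continuousAt.continuousWithinAt) (fun v hv => ?_) (fun v hv => ?_)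
    · exact (hd v (interior_subset hv)).differentiableAt.differentiableWithinAt
    · have hv := interior_subset hv
      rw [(hd v hv).deriv]
      have hvT : v ∈ Ioo 0 t := ⟨hs₀.trans_le hv.1, hv.2.trans_lt ht⟩
      have h1 := hflow.p_antitone hm.le ⟨hs₀.le, hv.1.trans_lt hvT.2⟩ ⟨hvT.1.le, hvT.2⟩ hv.1
      have h2 := hflow.S_neg hm v hvT
      have h3 := hflow.a_le_one ⟨hvT.1.le, hvT.2⟩
      simp only at h1 h3
      nlinarith
  have h1 := hanti ⟨le_rfl, hle⟩ ⟨hle, le_rfl⟩ hle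
  simp only at h1
  have h2 := h.rad_pos hs
  have : s - s₀ ≤ rad x z s₀ / κ := by
    rw [le_div_iff₀ hκ0]; nlinarith
  linarith

theorem IsMaximalSolution.exists_eq_Ioo (h : IsMaximalSolution α I x z ψ) (hα : α < -2) :
    ∃ T > 0, I = Ioo (-T) T := by
  have hb := h.1.bddAbove hα
  have hlt : ∀ s ∈ I, s < sSup I := fun s hs => by
    obtain ⟨t, ht, htI, -⟩ := h.1.exists_gt hs
    exact ht.trans_le (le_csSup hb htI)
  refine ⟨sSup I, hlt 0 h.1.zero_mem, ?_⟩
  ext s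
  constructor
  · intro hs
    exact ⟨by linarith [hlt _ (h.neg_mem hα hs)], hlt s hs⟩
  · intro hs
    obtain ⟨t, htI, ht⟩ := exists_lt_of_lt_csSup ⟨0, h.1.zero_mem⟩ hs.2
    obtain ⟨t', htI', ht'⟩ := exists_lt_of_lt_csSup ⟨0, h.1.zero_mem⟩
      (show -s < sSup I by linarith [hs.1])
    exact h.1.ordConnected.out (h.neg_mem hα htI') htI ⟨by linarith, ht.le⟩

/-- A maximal solution runs into the origin: otherwise it would stay in a compact part of `x > 0`
and could be continued. -/
theorem IsMaximalSolution.tendsto_rad (h : IsMaximalSolution α I x z ψ) (hα : α < -2) {T : ℝ}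
    (hT : 0 < T) (hI : I = Ioo (-T) T) : Tendsto (rad x z) (𝓝[<] T) (𝓝 0) := by
  have hm : α + 2 < 0 := by linarith
  have hsubI : Ico 0 T ⊆ I := fun s hs => by rw [hI]; exact ⟨by linarith [hs.1], hs.2⟩
  have hflow := h.1.polarFlow_of_lt hα hT hsubI
  have hanti := (hflow.r_strictAnti hm).antitoneOn
  by_cases hη : ∃ η > 0, ∀ s ∈ Ico 0 T, η ≤ rad x z s
  swap
  · push Not at hη
    rw [Metric.tendsto_nhdsWithin_nhds]
    intro η hη0
    obtain ⟨s, hs, hrs⟩ := hη η hη0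
    refine ⟨T - s, by linarith [hs.2], fun {u} hu hd => ?_⟩
    have hu : u < T := hu
    rw [Real.dist_eq, abs_sub_comm, abs_of_pos (by linarith)] at hd
    have hsu : s ≤ u := by linarith
    have huI : u ∈ Ico 0 T := ⟨hs.1.trans hsu, hu⟩
    rw [Real.dist_eq, sub_zero, abs_of_pos (hflow.r_pos u huI)]
    exact (hanti hs huI hsu).trans_lt hrs
  exfalso
  obtain ⟨η, hη0, hη⟩ := hη
  obtain ⟨s₀, hs₀⟩ : ∃ s₀, s₀ = T / 2 := ⟨_, rfl⟩
  have hs₀T : s₀ ∈ Ioo 0 T := ⟨by linarith, by linarith⟩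
  obtain ⟨κ, hκ⟩ : ∃ κ, κ = -(x s₀ / rad x z s₀ * radComp x z ψ s₀) := ⟨_, rfl⟩
  have hκ0 : 0 < κ := by rw [hκ]; linarith [hflow.p_neg hm s₀ hs₀T]
  have hIco : ∀ s ∈ Ico s₀ T, s ∈ Ioo 0 T := fun s hs => ⟨hs₀T.1.trans_le hs.1, hs.2⟩
  have hr1 : ∀ s ∈ Ico s₀ T, rad x z s ≤ 1 := fun s hs => by
    have := hanti ⟨le_rfl, hT⟩ ⟨(hIco s hs).1.le, hs.2⟩ (hIco s hs).1.le
    rwa [hflow.r_zero] at this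
  have hxlow : ∀ s ∈ Ico s₀ T, κ * η ≤ x s := by
    intro s hs
    have hsI : s ∈ Ico 0 T := ⟨(hIco s hs).1.le, hs.2⟩
    have h1 := hflow.p_antitone hm.le ⟨hs₀T.1.le, hs₀T.2⟩ hsI hs.1
    have h2 := hflow.neg_one_le_S hsI
    have h3 := hflow.a_pos s (hIco s hs)
    simp only at h1 h2 h3
    have h4 : κ ≤ x s / rad x z s := by nlinarith
    have hr := hflow.r_pos s hsI
    rw [le_div_iff₀ hr] at h4
    exact (mul_le_mul_of_nonneg_left (hη s hsI) hκ0.le).trans h4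
  have hκη : 0 < κ * η := mul_pos hκ0 hη0
  obtain ⟨B, hB⟩ : ∃ B, B = |α| * (1 / η) + 1 / (κ * η) := ⟨_, rfl⟩
  have hψ : ∀ s ∈ Ico s₀ T, |ψ s - ψ s₀| ≤ B * (T - s₀) := by
    intro s hs
    have hB0 : 0 ≤ B := by rw [hB]; positivity
    have h1 := (convex_Ico s₀ T).norm_image_sub_le_of_norm_hasDerivWithin_le (f := ψ) (C := B)
      (fun v hv => (h.1.ψ_deriv v (hsubI ⟨(hIco v hv).1.le, hv.2⟩)
        (hκη.trans_le (hxlow v hv)).ne').hasDerivWithinAt) (fun v hv => ?_)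
      ⟨le_rfl, hs₀T.2⟩ hs
    · rw [Real.norm_eq_abs, Real.norm_eq_abs, abs_of_nonneg (sub_nonneg.2 hs.1)] at h1
      exact h1.trans (mul_le_mul_of_nonneg_left (by linarith [hs.2]) hB0)
    · have hvI : v ∈ Ico 0 T := ⟨(hIco v hv).1.le, hv.2⟩
      have hr := hflow.r_pos v hvI
      have htan := hflow.tan_sq v hvI
      have hq : (z v * Real.cos (ψ v) - x v * Real.sin (ψ v)) / (x v ^ 2 + z v ^ 2)
          = angComp x z ψ v / rad x z v := by
        rw [← h.1.rad_sq (hsubI hvI), angComp, sq, div_div]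
      have hC : |angComp x z ψ v| ≤ 1 := by
        rw [← sq_le_one_iff_abs_le_one]; linarith [sq_nonneg (radComp x z ψ v)]
      rw [Real.norm_eq_abs, hq, hB]
      refine (abs_sub _ _).trans (add_le_add ?_ ?_)
      · rw [abs_mul, abs_div, abs_of_pos hr]
        exact mul_le_mul_of_nonneg_left (div_le_div₀ zero_le_one hC hη0 (hη v hvI)) (abs_nonneg _)
      · rw [abs_div, abs_of_pos (hκη.trans_le (hxlow v hv))]
        exact div_le_div₀ zero_le_one (Real.abs_sin_le_one _) hκη (hxlow v hv)
  have hev : ∀ᶠ s in 𝓝[<] T, s ∈ Ico s₀ T := Ico_mem_nhdsLT hs₀T.2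
  have hcomp : IsCompact (Icc (κ * η) 1 ×ˢ (Icc (-1 : ℝ) 1 ×ˢ
      Icc (ψ s₀ - B * (T - s₀)) (ψ s₀ + B * (T - s₀)))) :=
    isCompact_Icc.prod (isCompact_Icc.prod isCompact_Icc)
  have hmem : ∀ᶠ s in 𝓝[<] T, (x s, z s, ψ s) ∈ Icc (κ * η) 1 ×ˢ (Icc (-1 : ℝ) 1 ×ˢ
      Icc (ψ s₀ - B * (T - s₀)) (ψ s₀ + B * (T - s₀))) := by
    filter_upwards [hev] with s hs
    have hsI : s ∈ I := hsubI ⟨(hIco s hs).1.le, hs.2⟩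
    have h1 := h.1.rad_sq hsI
    have h2 := hr1 s hs
    have h3 := h.1.rad_pos hsI
    have h4 := abs_le.1 (hψ s hs)
    have h5 : rad x z s ^ 2 ≤ 1 := by nlinarith
    have h6 : |z s| ≤ 1 := by
      rw [← sq_le_one_iff_abs_le_one]; linarith [sq_nonneg (x s)]
    have h7 : |x s| ≤ 1 := by
      rw [← sq_le_one_iff_abs_le_one]; linarith [sq_nonneg (z s)]
    exact ⟨⟨hxlow s hs, (abs_le.1 h7).2⟩, abs_le.1 h6, by linarith, by linarith⟩
  obtain ⟨p, hpK, hp⟩ := hcomp.exists_clusterPt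
    (f := map (fun s => (x s, z s, ψ s)) (𝓝[<] T)) (le_principal_iff.2 hmem)
  have hp1 : 0 < p.1 := hκη.trans_le hpK.1.1
  obtain ⟨δ, hδ, ε, hε, hloc⟩ := exists_uniform_flow α hp1
  have hfreq := (mapClusterPt_iff_frequently.1 hp) _ (Metric.ball_mem_nhds p hδ)
  have hev2 : ∀ᶠ s in 𝓝[<] T, s ∈ Ioo (max 0 (T - ε)) T :=
    Ioo_mem_nhdsLT (max_lt hT (by linarith))
  obtain ⟨s₁, hs₁, hs₁T⟩ := (hfreq.and_eventually hev2).exists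
  obtain ⟨w, hw0, hw, hwpos⟩ := hloc s₁ _ hs₁
  have hs₁0 : 0 < s₁ := (le_max_left _ _).trans_lt hs₁T.1
  have hs₁ε : T - ε < s₁ := (le_max_right _ _).trans_lt hs₁T.1
  obtain ⟨c, hc⟩ : ∃ c, c = max 0 (s₁ - ε) := ⟨_, rfl⟩
  have hc0 : 0 ≤ c := hc ▸ le_max_left _ _
  have hcε : s₁ - ε ≤ c := hc ▸ le_max_right _ _
  have hcs : c < s₁ := hc ▸ max_lt hs₁0 (by linarith)
  have hJ : ∀ t ∈ Ioo c (s₁ + ε), t ∈ Ioo (s₁ - ε) (s₁ + ε) := fun t ht =>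
    ⟨hcε.trans_lt ht.1, ht.2⟩
  have hJI : ∀ t ∈ Ioo c T, t ∈ I := fun t ht => hsubI ⟨hc0.trans ht.1.le, ht.2⟩
  have hxp : ∀ t ∈ Ioo c T, 0 < x t := fun t ht =>
    h.1.x_pos hα (hJI t ht) (hc0.trans_lt ht.1)
  have hJw : ∀ t ∈ Ioo c T, t ∈ Ioo (s₁ - ε) (s₁ + ε) := fun t ht =>
    ⟨hcε.trans_lt ht.1, by linarith [ht.2]⟩
  have heq := eqOn_Ioo_of_field (α := α) (u := fun s => (x s, z s, ψ s)) (v := w)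
    (t₀ := s₁) (c := c) (d := T) ⟨hcs, hs₁T.2⟩
    (fun v hv => h.1.hasDerivAt_field (hJI v hv) (hxp v hv).ne') hxp
    (fun v hv => hw v (hJw v hv)) hw0.symm
  have hsub := h.subset_of_isFlow (isFlow_of_field (fun t ht => hw t (hJ t ht))
    fun t ht => hwpos t (hJ t ht)) ordConnected_Ioo
    ⟨s₁, hJI s₁ ⟨hcs, hs₁T.2⟩, hcs, by linarith⟩ (fun s hs => by
      have hsT : s < T := by have := hs.1; rw [hI] at this; exact this.2
      have := heq ⟨hs.2.1, hsT⟩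
      simp only at this
      rw [← this]
      exact ⟨rfl, rfl, rfl⟩)
  have hTI : T ∈ I := hsub ⟨hcs.trans hs₁T.2, by linarith⟩
  rw [hI] at hTI
  exact lt_irrefl T hTI.2

/-! ### The closed curve -/

theorem isEmbeddedClosedCurve_of_tendsto {γ : ℝ → ℝ × ℝ} {T : ℝ} {p : ℝ × ℝ} (hT : 0 < T)
    (hc : ContinuousOn γ (Ioo (-T) T)) (hinj : InjOn γ (Ioo (-T) T))
    (hne : ∀ s ∈ Ioo (-T) T, γ s ≠ p) (hl : Tendsto γ (𝓝[>] (-T)) (𝓝 p))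
    (hr : Tendsto γ (𝓝[<] T) (𝓝 p)) : IsEmbeddedClosedCurve (γ '' Ioo (-T) T ∪ {p}) := by
  have hlt : -T < T := by linarith
  have : Fact (0 < 2 * T) := ⟨by linarith⟩
  obtain ⟨g, hg⟩ : ∃ g, g = extendFrom (Ioo (-T) T) γ := ⟨_, rfl⟩
  have hgc : ContinuousOn g (Icc (-T) T) := by
    rw [hg]; exact continuousOn_Icc_extendFrom_Ioo hc hl hr
  have hgl : g (-T) = p := by rw [hg]; exact eq_lim_at_left_extendFrom_Ioo hlt hl
  have hgr : g T = p := by rw [hg]; exact eq_lim_at_right_extendFrom_Ioo hlt hr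
  have hgI : ∀ s ∈ Ioo (-T) T, g s = γ s := fun s hs => by
    rw [hg]; exact extendFrom_eq (subset_closure hs) (hc s hs)
  have hsum : -T + 2 * T = T := by ring
  have hcl : Continuous (AddCircle.liftIco (2 * T) (-T) g) :=
    AddCircle.liftIco_continuous (by rw [hsum, hgl, hgr]) (by rw [hsum]; exact hgc)
  have happ : ∀ s ∈ Ico (-T) T, AddCircle.liftIco (2 * T) (-T) g (s : AddCircle (2 * T)) = g s :=
    fun s hs => AddCircle.liftIco_coe_apply (by rw [hsum]; exact hs)
  have hsurj : ∀ q : AddCircle (2 * T), ∃ s ∈ Ico (-T) T, (s : AddCircle (2 * T)) = q := by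
    intro q
    have h1 := AddCircle.coe_image_Ico_eq (2 * T) (-T)
    rw [hsum] at h1
    have h2 : q ∈ ((↑) : ℝ → AddCircle (2 * T)) '' Ico (-T) T := by rw [h1]; exact mem_univ q
    exact h2
  have hIco : ∀ s ∈ Ico (-T) T, s = -T ∨ s ∈ Ioo (-T) T := fun s hs =>
    hs.1.eq_or_lt.imp Eq.symm fun h => ⟨h, hs.2⟩
  have hginj : InjOn g (Ico (-T) T) := by
    intro s hs t ht hst
    rcases hIco s hs with h1 | h1 <;> rcases hIco t ht with h2 | h2
    · rw [h1, h2]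
    · rw [h1, hgl, hgI t h2] at hst
      exact absurd hst.symm (hne t h2)
    · rw [h2, hgl, hgI s h1] at hst
      exact absurd hst (hne s h1)
    · rw [hgI s h1, hgI t h2] at hst
      exact hinj h1 h2 hst
  have hlinj : Function.Injective (AddCircle.liftIco (2 * T) (-T) g) := by
    intro q₁ q₂ hq
    obtain ⟨s, hs, rfl⟩ := hsurj q₁
    obtain ⟨t, ht, rfl⟩ := hsurj q₂
    rw [happ s hs, happ t ht] at hq
    rw [hginj hs ht hq]
  let e := AddCircle.homeomorphCircle (T := 2 * T) (by linarith)
  refine ⟨AddCircle.liftIco (2 * T) (-T) g ∘ e.symm,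
    ((hcl.comp e.symm.continuous).isClosedEmbedding (hlinj.comp e.symm.injective)).isEmbedding, ?_⟩
  rw [e.symm.surjective.range_comp]
  ext q
  constructor
  · rintro ⟨y, rfl⟩
    obtain ⟨s, hs, rfl⟩ := hsurj y
    rw [happ s hs]
    rcases hIco s hs with h1 | h1
    · right; rw [h1, hgl]; rfl
    · left; exact ⟨s, h1, (hgI s h1).symm⟩
  · rintro (⟨s, hs, rfl⟩ | hq)
    · exact ⟨(s : AddCircle (2 * T)), by rw [happ s ⟨hs.1.le, hs.2⟩, hgI s hs]⟩
    · rw [mem_singleton_iff.1 hq]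
      exact ⟨((-T : ℝ) : AddCircle (2 * T)), by rw [happ _ ⟨le_rfl, hlt⟩, hgl]⟩

theorem IsSolution.x_neg (h : IsSolution α I x z ψ) (hα : α < -2) {s : ℝ} (hs : s ∈ I)
    (hs0 : s < 0) : x s < 0 := by
  have := h.reflect.x_pos hα (s := -s) (by simpa using hs) (by linarith)
  rw [neg_neg] at this
  linarith

theorem IsSolution.injOn_nonneg (h : IsSolution α I x z ψ) (hα : α < -2) {s t : ℝ} (hs : s ∈ I)
    (ht : t ∈ I) (hs0 : 0 ≤ s) (ht0 : 0 ≤ t) (heq : (x s, z s) = (x t, z t)) : s = t := by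
  wlog hst : s ≤ t generalizing s t
  · exact (this ht hs ht0 hs0 heq.symm (le_of_not_ge hst)).symm
  obtain ⟨T, hT, hTI, -⟩ := h.exists_gt ht
  have hflow := h.polarFlow_of_lt hα (ht0.trans_lt hT)
    (fun v hv => h.Icc_subset hTI ⟨hv.1, hv.2.le⟩)
  rw [Prod.mk.injEq] at heq
  refine (hflow.r_strictAnti (by linarith)).injOn ⟨hs0, hst.trans_lt hT⟩ ⟨ht0, hT⟩ ?_
  rw [rad, rad, heq.1, heq.2]

theorem IsSolution.injOn (h : IsSolution α I x z ψ) (hα : α < -2) :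
    InjOn (fun s => (x s, z s)) I := by
  intro s hs t ht heq
  simp only at heq
  have hx := (Prod.mk.inj heq).1
  rcases le_or_gt 0 s with h1 | h1 <;> rcases le_or_gt 0 t with h2 | h2
  · exact h.injOn_nonneg hα hs ht h1 h2 heq
  · have h3 := h.x_neg hα ht h2
    rcases h1.eq_or_lt with h4 | h4
    · rw [← h4, h.x_zero] at hx; linarith
    · linarith [h.x_pos hα hs h4]
  · have h3 := h.x_neg hα hs h1
    rcases h2.eq_or_lt with h4 | h4
    · rw [← h4, h.x_zero] at hx; linarith
    · linarith [h.x_pos hα ht h4]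
  · have := h.reflect.injOn_nonneg hα (s := -s) (t := -t) (by simpa using hs) (by simpa using ht)
      (by linarith) (by linarith) (by
        simp only [neg_neg]
        rw [hx, (Prod.mk.inj heq).2])
    linarith

theorem abs_x_le_rad (x z : ℝ → ℝ) (s : ℝ) : |x s| ≤ rad x z s :=
  Real.abs_le_sqrt (by linarith [sq_nonneg (z s)])

theorem abs_z_le_rad (x z : ℝ → ℝ) (s : ℝ) : |z s| ≤ rad x z s :=
  Real.abs_le_sqrt (by linarith [sq_nonneg (x s)])

theorem IsMaximalSolution.tendsto_origin (h : IsMaximalSolution α I x z ψ) (hα : α < -2) {T : ℝ}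
    (hT : 0 < T) (hI : I = Ioo (-T) T) :
    Tendsto (fun s => (x s, z s)) (𝓝[<] T) (𝓝 (0, 0)) := by
  have hr := h.tendsto_rad hα hT hI
  exact (squeeze_zero_norm (abs_x_le_rad x z) hr).prodMk_nhds
    (squeeze_zero_norm (abs_z_le_rad x z) hr)

theorem IsMaximalSolution.isEmbeddedClosedCurve (h : IsMaximalSolution α I x z ψ) (hα : α < -2) :
    IsEmbeddedClosedCurve ((fun s => (x s, z s)) '' I ∪ {(0, 0)}) := by
  obtain ⟨T, hT, hI⟩ := h.exists_eq_Ioo hα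
  have hr := h.tendsto_origin hα hT hI
  have hl : Tendsto (fun s => (x s, z s)) (𝓝[>] (-T)) (𝓝 (0, 0)) := by
    have hneg : Tendsto (fun s : ℝ => -s) (𝓝[>] (-T)) (𝓝[<] T) := by
      have := tendsto_neg_nhdsGT (a := -T)
      rwa [neg_neg] at this
    have h1 := hr.comp hneg
    have h2 : Tendsto (fun p : ℝ × ℝ => (-p.1, p.2)) (𝓝 (0, 0)) (𝓝 (0, 0)) := by
      have : Continuous fun p : ℝ × ℝ => (-p.1, p.2) := by fun_prop
      simpa using this.tendsto (0, 0)
    refine (h2.comp h1).congr' ?_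
    filter_upwards [Ioo_mem_nhdsGT (show -T < T by linarith)] with s hs
    have hs : s ∈ I := by rw [hI]; exact hs
    have h3 := h.symm hα hs
    simp only [Function.comp_apply, h3.1, h3.2, neg_neg]
  rw [hI]
  exact isEmbeddedClosedCurve_of_tendsto hT (hI ▸ h.1.x_cont.prodMk h.1.z_cont)
    (hI ▸ h.1.injOn hα) (fun s hs => h.1.ne_origin s (hI ▸ hs)) hl hr

/-! ### The behaviour at the origin -/

/-- A smooth function `F` that vanishes at the origin is approximated by its differential there. -/
theorem exists_linear_approx {F : ℝ × ℝ → ℝ} (hF : ContDiffAt ℝ ∞ F (0, 0)) (hF0 : F (0, 0) = 0) :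
    ∃ K ≥ 0, ∀ᶠ q in 𝓝 ((0, 0) : ℝ × ℝ), DifferentiableAt ℝ F q ∧
      ‖fderiv ℝ F q - fderiv ℝ F (0, 0)‖ ≤ K * ‖q‖ ∧
      |F q - fderiv ℝ F (0, 0) q| ≤ K * ‖q‖ ^ 2 := by
  have h1 : ContDiffAt ℝ 1 (fderiv ℝ F) (0, 0) := hF.fderiv_right (by norm_cast)
  obtain ⟨K, N, hN, hL⟩ := h1.exists_lipschitzOnWith
  have hd : ∀ᶠ q in 𝓝 ((0, 0) : ℝ × ℝ), DifferentiableAt ℝ F q := by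
    have h2 : ContDiffAt ℝ 1 F (0, 0) := hF.of_le (by norm_cast)
    exact (h2.eventually (by simp)).mono fun q hq => hq.differentiableAt one_ne_zero
  obtain ⟨ρ, hρ, hball⟩ := Metric.mem_nhds_iff.1 (inter_mem hN hd)
  have h0 : ((0, 0) : ℝ × ℝ) = 0 := rfl
  have hnorm : ∀ q ∈ Metric.ball ((0, 0) : ℝ × ℝ) ρ,
      ‖fderiv ℝ F q - fderiv ℝ F (0, 0)‖ ≤ K * ‖q‖ := by
    intro q hq
    have := hL.dist_le_mul q (hball hq).1 (0, 0) (mem_of_mem_nhds hN)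
    rwa [dist_eq_norm, h0, dist_zero_right] at this
  refine ⟨K, K.2, ?_⟩
  filter_upwards [Metric.ball_mem_nhds _ hρ] with q hq
  refine ⟨(hball hq).2, hnorm q hq, ?_⟩
  have hqρ : ‖q‖ < ρ := by rwa [h0, mem_ball_zero_iff] at hq
  have hsub : Metric.closedBall (0 : ℝ × ℝ) ‖q‖ ⊆ Metric.ball (0, 0) ρ := by
    rw [h0]; exact Metric.closedBall_subset_ball hqρ
  have h3 := (convex_closedBall (0 : ℝ × ℝ) ‖q‖).norm_image_sub_le_of_norm_hasFDerivWithin_le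
    (f := fun p => F p - fderiv ℝ F (0, 0) p) (f' := fun p => fderiv ℝ F p - fderiv ℝ F (0, 0))
    (C := K * ‖q‖) (fun p hp => ((hball (hsub hp)).2.hasFDerivAt.sub
      (fderiv ℝ F (0, 0)).hasFDerivAt).hasFDerivWithinAt)
    (fun p hp => (hnorm p (hsub hp)).trans
      (mul_le_mul_of_nonneg_left (mem_closedBall_zero_iff.1 hp) K.2))
    (x := 0) (y := q) (by simp) (by simp)
  simp only [← h0, hF0, Real.norm_eq_abs] at h3
  simp only [h0, map_zero, sub_zero] at h3 ⊢
  rw [sq, ← mul_assoc]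
  exact h3

/-- Unless `α = -4`, the closed curve is not smooth at the origin: the equation `F = 0` of a smooth
curve and its derivative along the curve would bound `z / r²` and `y`. -/
theorem IsMaximalSolution.eq_neg_four (h : IsMaximalSolution α I x z ψ) (hα : α < -2)
    (hs : IsSmoothCurveAt ((fun s => (x s, z s)) '' I ∪ {(0, 0)}) (0, 0)) : α = -4 := by
  obtain ⟨T, hT, hI⟩ := h.exists_eq_Ioo hα
  have hm : α + 2 < 0 := by linarith
  have hIco : ∀ s ∈ Ico 0 T, s ∈ I := fun s hs => by rw [hI]; exact ⟨by linarith [hs.1], hs.2⟩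
  have hflow := h.1.polarFlow_of_lt hα hT hIco
  have hr := h.tendsto_rad hα hT hI
  have hγ := h.tendsto_origin hα hT hI
  obtain ⟨h0, U, F, hUo, hU0, hF, hF', hFS⟩ := hs
  have hF0 : F (0, 0) = 0 := (hFS _ hU0).1 h0
  obtain ⟨K, hK, happ⟩ := exists_linear_approx (hF.contDiffAt (hUo.mem_nhds hU0)) hF0
  obtain ⟨L, hL⟩ : ∃ L, L = fderiv ℝ F (0, 0) := ⟨_, rfl⟩
  rw [← hL] at happ hF'
  have hLuv : ∀ u v : ℝ, L (u, v) = u * L (1, 0) + v * L (0, 1) := by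
    intro u v
    have : ((u, v) : ℝ × ℝ) = u • (1, 0) + v • (0, 1) := by simp
    rw [this, map_add, map_smul, map_smul, smul_eq_mul, smul_eq_mul]
  have hzero : ∀ s ∈ I, (x s, z s) ∈ U → F (x s, z s) = 0 := fun s hs hsU =>
    (hFS _ hsU).1 (Or.inl ⟨s, hs, rfl⟩)
  -- the two first-order relations along the curve
  have hbd : ∀ᶠ s in 𝓝[<] T, |L (x s, z s)| ≤ K * rad x z s ^ 2 ∧
      |L (Real.cos (ψ s), Real.sin (ψ s))| ≤ K * rad x z s := by
    filter_upwards [hflow.eventually_mem, hγ.eventually happ, hγ (hUo.mem_nhds hU0)]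
      with s hs ⟨hd, h1, h2⟩ hsU
    have hsI : s ∈ I := hIco s ⟨hs.1.le, hs.2⟩
    have hn : ‖(x s, z s)‖ ≤ rad x z s :=
      max_le (abs_x_le_rad x z s) (abs_z_le_rad x z s)
    rw [hzero s hsI hsU, zero_sub, abs_neg] at h2
    refine ⟨h2.trans (mul_le_mul_of_nonneg_left
      (pow_le_pow_left₀ (norm_nonneg _) hn 2) hK), ?_⟩
    have hder : HasDerivAt (fun s => F (x s, z s))
        (fderiv ℝ F (x s, z s) (Real.cos (ψ s), Real.sin (ψ s))) s :=
      hd.hasFDerivAt.comp_hasDerivAt s ((h.1.x_deriv s hsI).prodMk (h.1.z_deriv s hsI))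
    have hder0 : HasDerivAt (fun s => F (x s, z s)) 0 s := by
      refine (hasDerivAt_const s (0 : ℝ)).congr_of_eventuallyEq ?_
      have hc : ContinuousAt (fun s => (x s, z s)) s :=
        (h.1.x_deriv s hsI).continuousAt.prodMk (h.1.z_deriv s hsI).continuousAt
      filter_upwards [h.1.isOpen.mem_nhds hsI, hc (hUo.mem_nhds hsU)] with v hv hvU
        using hzero v hv hvU
    have heq := hder.unique hder0
    have h3 : L (Real.cos (ψ s), Real.sin (ψ s))
        = -((fderiv ℝ F (x s, z s) - L) (Real.cos (ψ s), Real.sin (ψ s))) := by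
      rw [sub_apply, heq]; ring
    have h4 : ‖(Real.cos (ψ s), Real.sin (ψ s))‖ ≤ 1 :=
      max_le (Real.abs_cos_le_one _) (Real.abs_sin_le_one _)
    rw [h3, abs_neg, ← Real.norm_eq_abs]
    calc _ ≤ ‖fderiv ℝ F (x s, z s) - L‖ * ‖(Real.cos (ψ s), Real.sin (ψ s))‖ :=
          ContinuousLinearMap.le_opNorm _ _
      _ ≤ K * ‖(x s, z s)‖ * 1 :=
          mul_le_mul h1 h4 (norm_nonneg _) (mul_nonneg hK (norm_nonneg _))
      _ ≤ K * rad x z s := by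
          rw [mul_one]; exact mul_le_mul_of_nonneg_left hn hK
  have hab : ∀ᶠ s in 𝓝[<] T,
      |x s / rad x z s * L (1, 0) + z s / rad x z s * L (0, 1)| ≤ K * rad x z s := by
    filter_upwards [hflow.eventually_mem, hbd] with s hs ⟨h1, _⟩
    have hrs := hflow.r_pos s ⟨hs.1.le, hs.2⟩
    have : x s / rad x z s * L (1, 0) + z s / rad x z s * L (0, 1) = L (x s, z s) / rad x z s := by
      rw [hLuv (x s)]; ring
    rw [this, abs_div, abs_of_pos hrs, div_le_iff₀ hrs]
    calc _ ≤ _ := h1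
      _ = _ := by ring
  have hL1 : L (1, 0) = 0 := by
    have t1 : Tendsto (fun s => x s / rad x z s * L (1, 0) + z s / rad x z s * L (0, 1)) (𝓝[<] T)
        (𝓝 (1 * L (1, 0) + 0 * L (0, 1))) :=
      ((hflow.tendsto_a hm hr).mul_const _).add ((hflow.tendsto_b hm hr).mul_const _)
    have t2 : Tendsto (fun s => x s / rad x z s * L (1, 0) + z s / rad x z s * L (0, 1)) (𝓝[<] T)
        (𝓝 0) := by
      refine squeeze_zero_norm' hab ?_
      simpa using hr.const_mul K
    have := tendsto_nhds_unique t1 t2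
    linarith
  have hL2 : L (0, 1) ≠ 0 := by
    intro hcon
    refine hF' (ContinuousLinearMap.ext fun q => ?_)
    rw [show q = (q.1, q.2) from rfl, hLuv, hL1, hcon]
    simp
  have hl : 0 < |L (0, 1)| := abs_pos.2 hL2
  have hM : ∀ᶠ s in 𝓝[<] T, |z s / rad x z s / rad x z s| ≤ 3 * K / |L (0, 1)| ∧
      |-(radComp x z ψ s * (z s / rad x z s) + angComp x z ψ s * (x s / rad x z s)) / rad x z s|
        ≤ 3 * K / |L (0, 1)| := by
    filter_upwards [hflow.eventually_mem, hbd, hab] with s hs ⟨_, h1⟩ h2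
    have hsI : s ∈ Ico 0 T := ⟨hs.1.le, hs.2⟩
    have hrs := hflow.r_pos s hsI
    rw [hL1, mul_zero, zero_add, abs_mul] at h2
    rw [hLuv, hL1, mul_zero, zero_add, abs_mul] at h1
    have hsin : Real.sin (ψ s) = radComp x z ψ s * (z s / rad x z s)
        - angComp x z ψ s * (x s / rad x z s) := by
      have h5 := h.1.rad_sq (hIco s hsI)
      rw [radComp, angComp]
      field_simp
      rw [h5]; ring
    have hD : radComp x z ψ s * (z s / rad x z s) + angComp x z ψ s * (x s / rad x z s)
        = 2 * (radComp x z ψ s * (z s / rad x z s)) - Real.sin (ψ s) := by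
      rw [hsin]; ring
    have hS : |radComp x z ψ s| ≤ 1 := by
      rw [← sq_le_one_iff_abs_le_one]
      linarith [hflow.tan_sq s hsI, sq_nonneg (angComp x z ψ s)]
    constructor
    · rw [abs_div, abs_of_pos hrs, div_le_div_iff₀ hrs hl]
      nlinarith
    · rw [abs_div, abs_of_pos hrs, div_le_div_iff₀ hrs hl, abs_neg, hD]
      have h6 : |2 * (radComp x z ψ s * (z s / rad x z s)) - Real.sin (ψ s)|
          ≤ 2 * |z s / rad x z s| + |Real.sin (ψ s)| := by
        refine (abs_sub _ _).trans (add_le_add ?_ le_rfl)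
        rw [abs_mul, abs_two, abs_mul]
        have := mul_le_of_le_one_left (abs_nonneg (z s / rad x z s)) hS
        linarith
      calc _ ≤ (2 * |z s / rad x z s| + |Real.sin (ψ s)|) * |L (0, 1)| :=
            mul_le_mul_of_nonneg_right h6 hl.le
        _ ≤ 3 * K * rad x z s := by linarith
  rcases lt_trichotomy α (-4) with h1 | h1 | h1
  · exact (hflow.not_bounded_of_lt (by linarith) hr hM).elim
  · exact h1
  · exact (hflow.not_bounded_of_gt hm (by linarith) hr hM).elim

theorem IsMaximalSolution.exists_z_neg (h : IsMaximalSolution α I x z ψ) (hα : α < -2)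
    (hα4 : -4 < α) : ∃ s ∈ I, z s < 0 := by
  obtain ⟨T, hT, hI⟩ := h.exists_eq_Ioo hα
  have hIco : ∀ s ∈ Ico 0 T, s ∈ I := fun s hs => by rw [hI]; exact ⟨by linarith [hs.1], hs.2⟩
  have hflow := h.1.polarFlow_of_lt hα hT hIco
  obtain ⟨s, hs, hneg⟩ := hflow.exists_b_neg (by linarith) (by linarith) (h.tendsto_rad hα hT hI)
  have hsI := hIco s ⟨hs.1.le, hs.2⟩
  refine ⟨s, hsI, ?_⟩
  by_contra hcon
  exact absurd hneg (not_lt.2 (div_nonneg (not_lt.1 hcon) (h.1.rad_pos hsI).le))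

/-! ### The bigraph for `α < -4` -/

theorem IsMaximalSolution.z_pos (h : IsMaximalSolution α I x z ψ) (hα : α < -4) :
    ∀ s ∈ I, 0 < z s := by
  have hα2 : α < -2 := by linarith
  have hpos : ∀ s ∈ I, 0 < s → 0 < z s := by
    intro s hs hs0
    obtain ⟨t, ht, htI, -⟩ := h.1.exists_gt hs
    have hflow := h.1.polarFlow_of_lt hα2 (hs0.trans ht)
      (fun v hv => h.1.Icc_subset htI ⟨hv.1, hv.2.le⟩)
    exact (div_pos_iff_of_pos_right (h.1.rad_pos hs)).1
      ((hflow.y_pos (by linarith)).2 s ⟨hs0, ht⟩)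
  intro s hs
  rcases lt_trichotomy s 0 with h1 | h1 | h1
  · rw [← (h.symm hα2 hs).2]
    exact hpos (-s) (h.neg_mem hα2 hs) (by linarith)
  · rw [h1, h.1.z_zero]; exact one_pos
  · exact hpos s hs h1

theorem IsSolution.contDiffAt (h : IsSolution α I x z ψ) (hα : α < -2) {s : ℝ} (hs : s ∈ I)
    (hs0 : 0 < s) : ContDiffAt ℝ ∞ x s ∧ ContDiffAt ℝ ∞ z s := by
  obtain ⟨t, ht, htI, -⟩ := h.exists_gt hs
  have hI : ∀ v ∈ Ioo 0 t, v ∈ I := fun v hv => h.Icc_subset htI ⟨hv.1.le, hv.2.le⟩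
  have hx : ∀ v ∈ Ioo 0 t, 0 < x v := fun v hv => h.x_pos hα (hI v hv) hv.1
  have hw := contDiffOn_of_field (α := α) (n := ⊤) (w := fun s => (x s, z s, ψ s))
    (fun v hv => h.hasDerivAt_field (hI v hv) (hx v hv).ne') hx
  have hc := hw.contDiffAt (Ioo_mem_nhds hs0 ht)
  exact ⟨hc.fst, hc.snd.fst⟩

theorem IsMaximalSolution.z_strictAnti (h : IsMaximalSolution α I x z ψ) (hα : α < -4) {T : ℝ}
    (hT : 0 < T) (hI : I = Ioo (-T) T) :
    StrictAntiOn z (Ico 0 T) ∧ ∀ s ∈ Ioo 0 T, Real.sin (ψ s) < 0 := by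
  have hα2 : α < -2 := by linarith
  have hIco : ∀ s ∈ Ico 0 T, s ∈ I := fun s hs => by rw [hI]; exact ⟨by linarith [hs.1], hs.2⟩
  have hflow := h.1.polarFlow_of_lt hα2 hT hIco
  have hsin : ∀ s ∈ Ioo 0 T, Real.sin (ψ s) < 0 := by
    intro s hs
    have hsI := hIco s ⟨hs.1.le, hs.2⟩
    have hr := (h.1.rad_pos hsI).ne'
    have h1 := hflow.slope_neg (by linarith) s hs
    have h2 := h.1.rad_sq hsI
    have h3 : Real.sin (ψ s) = radComp x z ψ s * (z s / rad x z s)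
        - angComp x z ψ s * (x s / rad x z s) := by
      rw [radComp, angComp]
      field_simp
      rw [h2]; ring
    rw [h3]; exact h1
  refine ⟨strictAntiOn_of_deriv_neg (convex_Ico 0 T) (h.1.z_cont.mono hIco) fun s hs => ?_, hsin⟩
  rw [interior_Ico] at hs
  rw [(h.1.z_deriv s (hIco s ⟨hs.1.le, hs.2⟩)).deriv]
  exact hsin s hs

theorem IsMaximalSolution.isBigraph (h : IsMaximalSolution α I x z ψ) (hα : α < -4) :
    IsBigraph ((fun s => (x s, z s)) '' I) := by
  have hα2 : α < -2 := by linarith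
  obtain ⟨T, hT, hI⟩ := h.exists_eq_Ioo hα2
  have hIco : ∀ s ∈ Ico 0 T, s ∈ I := fun s hs => by rw [hI]; exact ⟨by linarith [hs.1], hs.2⟩
  obtain ⟨hanti, hsin⟩ := h.z_strictAnti hα hT hI
  have hz0 := h.1.z_zero
  have h0 : (0 : ℝ) ∈ Ico 0 T := ⟨le_rfl, hT⟩
  have hmaps : ∀ s ∈ Ico 0 T, z s ∈ Ioc (0 : ℝ) 1 := fun s hs =>
    ⟨h.z_pos hα s (hIco s hs), hz0 ▸ hanti.antitoneOn h0 hs hs.1⟩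
  have hsurj : ∀ t ∈ Ioc (0 : ℝ) 1, ∃ s ∈ Ico 0 T, z s = t := by
    intro t ht
    have hlim : Tendsto z (𝓝[<] T) (𝓝 0) := (h.tendsto_origin hα2 hT hI).snd_nhds
    obtain ⟨s, hs, hsT⟩ := ((hlim.eventually (gt_mem_nhds ht.1)).and
      (Ioo_mem_nhdsLT hT)).exists
    obtain ⟨v, hv, hvt⟩ := intermediate_value_Icc' hsT.1.le
      (h.1.z_cont.mono fun v hv => hIco v ⟨hv.1, hv.2.trans_lt hsT.2⟩)
      ⟨hs.le, hz0.symm ▸ ht.2⟩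
    exact ⟨v, ⟨hv.1, hv.2.trans_lt hsT.2⟩, hvt⟩
  obtain ⟨σ, hσ⟩ : ∃ σ : ℝ → ℝ, ∀ t ∈ Ioc (0 : ℝ) 1, σ t ∈ Ico 0 T ∧ z (σ t) = t := by
    choose! σ hσ using hsurj
    exact ⟨σ, hσ⟩
  have hσz : ∀ s ∈ Ico 0 T, σ (z s) = s := fun s hs =>
    hanti.injOn (hσ _ (hmaps s hs)).1 hs (hσ _ (hmaps s hs)).2
  have hσc : ContinuousOn σ (Ioc 0 1) := by
    intro t ht
    obtain ⟨hσt, hzt⟩ := hσ t ht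
    refine tendsto_order.2 ⟨fun c hc => ?_, fun c hc => ?_⟩
    · rcases lt_or_ge c 0 with hc0 | hc0
      · filter_upwards [self_mem_nhdsWithin] with t' ht' using hc0.trans_le (hσ t' ht').1.1
      · have hcI : c ∈ Ico 0 T := ⟨hc0, hc.trans hσt.2⟩
        have h1 : t < z c := by
          have := hanti hcI hσt hc
          rwa [hzt] at this
        filter_upwards [self_mem_nhdsWithin, nhdsWithin_le_nhds (gt_mem_nhds h1)] with t' ht' hlt
        have h2 := hσ t' ht'
        rw [← h2.2] at hlt
        exact (hanti.lt_iff_gt h2.1 hcI).1 hlt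
    · rcases lt_or_ge c T with hcT | hcT
      · have hcI : c ∈ Ico 0 T := ⟨hσt.1.trans hc.le, hcT⟩
        have h1 : z c < t := by
          have := hanti hσt hcI hc
          rwa [hzt] at this
        filter_upwards [self_mem_nhdsWithin, nhdsWithin_le_nhds (lt_mem_nhds h1)] with t' ht' hlt
        have h2 := hσ t' ht'
        rw [← h2.2] at hlt
        exact (hanti.lt_iff_gt hcI h2.1).1 hlt
      · filter_upwards [self_mem_nhdsWithin] with t' ht' using (hσ t' ht').1.2.trans_le hcT
  have hσpos : ∀ t ∈ Ioo (0 : ℝ) 1, σ t ∈ Ioo 0 T := by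
    intro t ht
    obtain ⟨h1, h2⟩ := hσ t ⟨ht.1, ht.2.le⟩
    refine ⟨h1.1.lt_of_ne fun hcon => ?_, h1.2⟩
    rw [← hcon, hz0] at h2
    exact ht.2.ne h2.symm
  have hxpos : ∀ s ∈ Ioo 0 T, 0 < x s := fun s hs =>
    h.1.x_pos hα2 (hIco s ⟨hs.1.le, hs.2⟩) hs.1
  refine ⟨Ioc 0 1, fun t => x (σ t), ordConnected_Ioc, ?_, ?_, ?_, ?_, ?_⟩
  · rw [interior_Ioc]; exact nonempty_Ioo.2 one_pos
  · exact h.1.x_cont.comp hσc fun t ht => hIco _ (hσ t ht).1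
  · rw [interior_Ioc]
    intro t ht
    have hs := hσpos t ht
    have hsI := hIco _ ⟨hs.1.le, hs.2⟩
    obtain ⟨hxs, hzs⟩ := h.1.contDiffAt hα2 hsI hs.1
    have hzt := (hσ t ⟨ht.1, ht.2.le⟩).2
    have hder : HasStrictDerivAt z (Real.sin (ψ (σ t))) (σ t) :=
      hzs.hasStrictDerivAt' (h.1.z_deriv _ hsI) (by simp)
    have hne := (hsin _ hs).ne
    -- `σ` is the local inverse of `z` given by the inverse function theorem
    have hinv : ContDiffAt ℝ ∞ (hder.localInverse z _ _ hne) (z (σ t)) :=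
      hzs.to_localInverse (f' := ContinuousLinearEquiv.unitsEquivAut ℝ (Units.mk0 _ hne))
        (by exact (h.1.z_deriv _ hsI).hasFDerivAt) (by simp)
    rw [hzt] at hinv
    have hev : ∀ᶠ t' in 𝓝 t, hder.localInverse z _ _ hne t' = σ t' := by
      have h1 := (hder.hasStrictFDerivAt_equiv hne).eventually_left_inverse
      have hσt : ContinuousAt σ t := hσc.continuousAt (Ioc_mem_nhds ht.1 ht.2)
      filter_upwards [hσt.eventually h1, Ioc_mem_nhds ht.1 ht.2] with t' h2 ht'
      rw [(hσ t' ht').2] at h2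
      exact h2
    have hσs : ContDiffAt ℝ ∞ σ t := hinv.congr_of_eventuallyEq (hev.mono fun _ h => h.symm)
    exact (hxs.comp t hσs).contDiffWithinAt
  · rw [interior_Ioc]
    exact fun t ht => hxpos _ (hσpos t ht)
  · ext p
    constructor
    · rintro ⟨s, hs, rfl⟩
      rcases le_total 0 s with h1 | h1
      · have hsT : s ∈ Ico 0 T := ⟨h1, by rw [hI] at hs; exact hs.2⟩
        refine ⟨hmaps s hsT, Or.inl ?_⟩
        simp only [hσz s hsT]
      · have hsT : -s ∈ Ico 0 T := ⟨by linarith, by rw [hI] at hs; linarith [hs.1]⟩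
        have h2 := h.symm hα2 hs
        have h3 := hmaps _ hsT
        have h4 := hσz _ hsT
        rw [h2.2] at h3 h4
        refine ⟨h3, Or.inr ?_⟩
        simp only [h4, h2.1, neg_neg]
    · rintro ⟨hp2, hp⟩
      obtain ⟨h1, h2⟩ := hσ p.2 hp2
      rcases hp with hp | hp
      · exact ⟨σ p.2, hIco _ h1, Prod.ext hp.symm h2⟩
      · have h3 := h.symm hα2 (hIco _ h1)
        exact ⟨-σ p.2, h.neg_mem hα2 (hIco _ h1), Prod.ext (by simp only [h3.1, hp])
          (by simp only [h3.2, h2])⟩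

/-! ### The explicit solutions -/

/-- For `α = -4` the circle of radius `1 / 2` through the origin is a solution. -/
theorem isSolution_neg_four : IsSolution (-4) (Ioo (-(Real.pi / 2)) (Real.pi / 2))
    (fun s => Real.sin s * Real.cos s) (fun s => Real.cos s ^ 2) (fun s => -2 * s) where
  isOpen := isOpen_Ioo
  ordConnected := ordConnected_Ioo
  zero_mem := ⟨by linarith [Real.pi_pos], by linarith [Real.pi_pos]⟩
  x_zero := by simp
  z_zero := by simp
  ψ_zero := by simp
  ne_origin s hs hcon := by
    have h1 := Real.cos_pos_of_mem_Ioo hs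
    have h2 := (Prod.mk.inj hcon).2
    exact (pow_pos h1 2).ne' h2
  x_deriv s _ := by
    refine ((Real.hasDerivAt_sin s).mul (Real.hasDerivAt_cos s)).congr_deriv ?_
    rw [neg_mul, Real.cos_neg, Real.cos_two_mul']; ring
  z_deriv s _ := by
    refine ((Real.hasDerivAt_cos s).pow 2).congr_deriv ?_
    rw [neg_mul, Real.sin_neg, Real.sin_two_mul]
    simp only [Nat.add_one_sub_one, Nat.cast_ofNat, pow_one]
    ring
  ψ_contDiffOn := by fun_prop
  ψ_deriv s hs hx := by
    refine ((hasDerivAt_id s).const_mul (-2)).congr_deriv ?_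
    have h1 := (Real.cos_pos_of_mem_Ioo hs).ne'
    have h2 : Real.sin s ≠ 0 := left_ne_zero_of_mul hx
    have h3 := Real.sin_sq_add_cos_sq s
    have h4 : (Real.sin s * Real.cos s) ^ 2 + (Real.cos s ^ 2) ^ 2 = Real.cos s ^ 2 := by
      linear_combination Real.cos s ^ 2 * h3
    have h5 : Real.cos (-2 * s) = Real.cos s ^ 2 - Real.sin s ^ 2 := by
      rw [neg_mul, Real.cos_neg, Real.cos_two_mul']
    have h6 : Real.sin (-2 * s) = -(2 * Real.sin s * Real.cos s) := by
      rw [neg_mul, Real.sin_neg, Real.sin_two_mul]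
    rw [h4, h5, h6]
    field_simp
    linear_combination 4 * h3

theorem IsMaximalSolution.image_of_eq_neg_four (h : IsMaximalSolution (-4) I x z ψ) :
    (fun s => (x s, z s)) '' I ∪ {(0, 0)} =
      {p : ℝ × ℝ | p.1 ^ 2 + (p.2 - 1 / 2) ^ 2 = (1 / 2) ^ 2} := by
  have hα : (-4 : ℝ) < -2 := by norm_num
  have hsub := h.subset_of_isSolution hα isSolution_neg_four
  have hval : ∀ s ∈ Ioo (-(Real.pi / 2)) (Real.pi / 2),
      x s = Real.sin s * Real.cos s ∧ z s = Real.cos s ^ 2 := fun s hs => by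
    have := h.1.eq_of_mem hα isSolution_neg_four (hsub hs) hs
    exact ⟨this.1, this.2.1⟩
  have hpi := Real.pi_pos
  -- the curve would pass through the origin at `π / 2`
  have hnot : Real.pi / 2 ∉ I := by
    intro hmem
    have hne : (𝓝[<] (Real.pi / 2)).NeBot := inferInstance
    have hev : ∀ᶠ s in 𝓝[<] (Real.pi / 2), s ∈ Ioo (-(Real.pi / 2)) (Real.pi / 2) :=
      Ioo_mem_nhdsLT (by linarith)
    have hx : x (Real.pi / 2) = 0 := by
      have h1 := (h.1.x_deriv _ hmem).continuousAt.tendsto.mono_left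
        (nhdsWithin_le_nhds (s := Iio (Real.pi / 2)))
      have h2 : Continuous fun s => Real.sin s * Real.cos s := by fun_prop
      have h3 := (h2.tendsto (Real.pi / 2)).mono_left (nhdsWithin_le_nhds (s := Iio (Real.pi / 2)))
      have := tendsto_nhds_unique (h1.congr' (hev.mono fun s hs => (hval s hs).1)) h3
      simpa using this
    have hz : z (Real.pi / 2) = 0 := by
      have h1 := (h.1.z_deriv _ hmem).continuousAt.tendsto.mono_left
        (nhdsWithin_le_nhds (s := Iio (Real.pi / 2)))
      have h2 : Continuous fun s => Real.cos s ^ 2 := by fun_prop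
      have h3 := (h2.tendsto (Real.pi / 2)).mono_left (nhdsWithin_le_nhds (s := Iio (Real.pi / 2)))
      have := tendsto_nhds_unique (h1.congr' (hev.mono fun s hs => (hval s hs).2)) h3
      simpa using this
    exact h.1.ne_origin _ hmem (by rw [hx, hz])
  have hI : I = Ioo (-(Real.pi / 2)) (Real.pi / 2) := by
    refine Subset.antisymm (fun s hs => ?_) hsub
    constructor
    · by_contra hcon
      exact hnot (h.1.Icc_subset (h.neg_mem hα hs) ⟨by linarith, by linarith [not_lt.1 hcon]⟩)
    · by_contra hcon
      exact hnot (h.1.Icc_subset hs ⟨by linarith, not_lt.1 hcon⟩)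
  ext p
  constructor
  · rintro (⟨s, hs, rfl⟩ | hp)
    · rw [hI] at hs
      simp only [mem_ofPred_eq, (hval s hs).1, (hval s hs).2]
      linear_combination Real.cos s ^ 2 * Real.sin_sq_add_cos_sq s
    · rw [mem_singleton_iff.1 hp]; norm_num
  · intro hp
    have hp : p.1 ^ 2 + (p.2 - 1 / 2) ^ 2 = (1 / 2) ^ 2 := hp
    by_cases h2 : p.2 = 0
    · right
      rw [h2] at hp
      have h1 : p.1 = 0 := pow_eq_zero_iff two_ne_zero |>.1 (by linarith)
      exact Prod.ext h1 h2
    · left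
      have hs : Real.arctan (p.1 / p.2) ∈ Ioo (-(Real.pi / 2)) (Real.pi / 2) :=
        ⟨Real.neg_pi_div_two_lt_arctan _, Real.arctan_lt_pi_div_two _⟩
      have hcos : Real.cos (Real.arctan (p.1 / p.2)) ^ 2 = p.2 := by
        rw [Real.cos_sq_arctan]
        have h3 : p.1 ^ 2 = p.2 - p.2 ^ 2 := by linarith
        rw [div_pow, h3]
        field_simp
        ring
      refine ⟨Real.arctan (p.1 / p.2), hI ▸ hs, ?_⟩
      have hsin : Real.sin (Real.arctan (p.1 / p.2)) * Real.cos (Real.arctan (p.1 / p.2))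
          = p.1 := by
        have h4 := (Real.cos_pos_of_mem_Ioo hs).ne'
        have h5 := Real.tan_arctan (p.1 / p.2)
        rw [Real.tan_eq_sin_div_cos, div_eq_div_iff h4 h2] at h5
        have h6 : Real.sin (Real.arctan (p.1 / p.2)) * Real.cos (Real.arctan (p.1 / p.2)) * p.2
            = p.1 * p.2 := by
          calc _ = Real.sin (Real.arctan (p.1 / p.2)) * p.2
                * Real.cos (Real.arctan (p.1 / p.2)) := by ring
            _ = p.1 * Real.cos (Real.arctan (p.1 / p.2)) ^ 2 := by rw [h5]; ring
            _ = p.1 * p.2 := by rw [hcos]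
        exact mul_right_cancel₀ h2 h6
      exact Prod.ext ((hval _ hs).1.trans hsin) ((hval _ hs).2.trans hcos)

/-- A circle through the origin centred on the `z`-axis is smooth there. -/
theorem isSmoothCurveAt_circle :
    IsSmoothCurveAt {p : ℝ × ℝ | p.1 ^ 2 + (p.2 - 1 / 2) ^ 2 = (1 / 2) ^ 2} (0, 0) := by
  refine ⟨by norm_num, univ, fun p => p.1 ^ 2 + (p.2 - 1 / 2) ^ 2 - (1 / 2) ^ 2, isOpen_univ,
    mem_univ _, ?_, ?_, ?_⟩
  · exact ContDiff.contDiffOn (by fun_prop)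
  · intro hcon
    have hdiff : DifferentiableAt ℝ
        (fun p : ℝ × ℝ => p.1 ^ 2 + (p.2 - 1 / 2) ^ 2 - (1 / 2) ^ 2) (0, 0) := by fun_prop
    have h1 := hdiff.hasFDerivAt
    rw [hcon] at h1
    have h1' : HasFDerivAt (fun p : ℝ × ℝ => p.1 ^ 2 + (p.2 - 1 / 2) ^ 2 - (1 / 2) ^ 2)
        (0 : ℝ × ℝ →L[ℝ] ℝ) ((0 : ℝ), id (0 : ℝ)) := h1
    have h2 := h1'.comp_hasDerivAt (0 : ℝ) ((hasDerivAt_const (0 : ℝ) (0 : ℝ)).prodMk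
      (hasDerivAt_id (0 : ℝ)))
    have h3 : HasDerivAt (fun v : ℝ => (0 : ℝ) ^ 2 + (v - 1 / 2) ^ 2 - (1 / 2) ^ 2) (-1) 0 := by
      refine (((((hasDerivAt_id (0 : ℝ)).sub_const (1 / 2)).pow 2).const_add _).sub_const
        _).congr_deriv ?_
      norm_num
    have := h2.unique h3
    norm_num at this
  · intro q _
    exact sub_eq_zero.symm

theorem isSolution_neg_two : IsSolution (-2) univ Real.sin Real.cos (fun s => -s) where
  isOpen := isOpen_univ
  ordConnected := ordConnected_univ
  zero_mem := mem_univ _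
  x_zero := Real.sin_zero
  z_zero := Real.cos_zero
  ψ_zero := neg_zero
  ne_origin s _ hcon := by
    obtain ⟨h1, h2⟩ := Prod.mk.inj hcon
    have := Real.sin_sq_add_cos_sq s
    rw [h1, h2] at this
    norm_num at this
  x_deriv s _ := by rw [Real.cos_neg]; exact Real.hasDerivAt_sin s
  z_deriv s _ := by rw [Real.sin_neg]; exact Real.hasDerivAt_cos s
  ψ_contDiffOn := contDiff_neg.contDiffOn
  ψ_deriv s _ hx := by
    refine (hasDerivAt_neg s).congr_deriv ?_
    have h1 := Real.sin_sq_add_cos_sq s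
    have h2 := Real.cos_sq_add_sin_sq s
    rw [h1, Real.cos_neg, Real.sin_neg, neg_div, div_self hx]
    linear_combination 2 * h2

/-- For `α = -2` the function `x * (x * x' + z * z') / (x² + z²)` has a square with zero
derivative everywhere, and it vanishes at `0`, so it vanishes identically. -/
theorem IsSolution.x_mul_eq_zero (h : IsSolution (-2) I x z ψ) {s : ℝ} (hs : s ∈ I) :
    x s * (x s * Real.cos (ψ s) + z s * Real.sin (ψ s)) = 0 := by
  have hψd : ∀ s ∈ I, HasDerivAt ψ (deriv ψ s) s := fun s hs =>
    ((h.ψ_contDiffOn.differentiableOn one_ne_zero).differentiableAt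
      (h.isOpen.mem_nhds hs)).hasDerivAt
  have hd : ∀ s ∈ I, HasDerivAt (fun s => (x s * (x s * Real.cos (ψ s) + z s * Real.sin (ψ s))
      / (x s ^ 2 + z s ^ 2)) ^ 2) 0 s := by
    intro s hs
    have hq := (h.sq_pos hs).ne'
    have hraw := (((h.x_deriv s hs).mul (((h.x_deriv s hs).mul (hψd s hs).cos).add
      ((h.z_deriv s hs).mul (hψd s hs).sin))).div
      (((h.x_deriv s hs).pow 2).add ((h.z_deriv s hs).pow 2)) hq).pow 2
    refine hraw.congr_deriv ?_
    by_cases hx : x s = 0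
    · simp [hx]
    · have hψ' := (hψd s hs).unique (h.ψ_deriv s hs hx)
      have h1 := Real.sin_sq_add_cos_sq (ψ s)
      simp only [Pi.add_apply, Pi.mul_apply, Pi.div_apply, Pi.pow_apply]
      rw [hψ']
      refine mul_eq_zero_of_right _ ?_
      generalize Real.sin (ψ s) = t at *
      generalize Real.cos (ψ s) = c at *
      simp only [Nat.add_one_sub_one, Nat.cast_ofNat, pow_one]
      field_simp
      ring
  have hconst : ∀ s ∈ I, (x s * (x s * Real.cos (ψ s) + z s * Real.sin (ψ s))
      / (x s ^ 2 + z s ^ 2)) ^ 2 = (x 0 * (x 0 * Real.cos (ψ 0) + z 0 * Real.sin (ψ 0))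
      / (x 0 ^ 2 + z 0 ^ 2)) ^ 2 := fun s hs =>
    h.isOpen.is_const_of_deriv_eq_zero h.ordConnected.isPreconnected
      (fun v hv => (hd v hv).differentiableAt.differentiableWithinAt)
      (fun v hv => (hd v hv).deriv) hs h.zero_mem
  have h1 := hconst s hs
  rw [h.x_zero, zero_mul, zero_div, zero_pow two_ne_zero, pow_eq_zero_iff two_ne_zero,
    div_eq_zero_iff] at h1
  exact h1.resolve_right (h.sq_pos hs).ne'

/-- For `α = -2` the curve is orthogonal to the position vector.  On the axis this needs an
argument: there the product could only be `± |z|`, which is excluded by connectedness. -/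
theorem IsSolution.radial_eq_zero (h : IsSolution (-2) I x z ψ) {s : ℝ} (hs : s ∈ I) :
    x s * Real.cos (ψ s) + z s * Real.sin (ψ s) = 0 := by
  have hFc : ContinuousOn (fun s => x s * Real.cos (ψ s) + z s * Real.sin (ψ s)) I :=
    (h.x_cont.mul (Real.continuous_cos.comp_continuousOn h.ψ_cont)).add
      (h.z_cont.mul (Real.continuous_sin.comp_continuousOn h.ψ_cont))
  have hsq : ∀ s ∈ I, radComp x z ψ s ^ 2 = 0 ∨ radComp x z ψ s ^ 2 = 1 := by
    intro s hs
    have hr := (h.rad_pos hs).ne'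
    by_cases hF : x s * Real.cos (ψ s) + z s * Real.sin (ψ s) = 0
    · left; rw [radComp, hF, zero_div]; norm_num
    have hx : x s = 0 := (mul_eq_zero.1 (h.x_mul_eq_zero hs)).resolve_right hF
    by_cases hc : Real.cos (ψ s) = 0
    · right
      have h1 := h.rad_sq hs
      have h2 := Real.sin_sq_add_cos_sq (ψ s)
      rw [hc] at h2
      rw [hx] at h1
      rw [radComp, hx, div_pow, div_eq_one_iff_eq (pow_ne_zero 2 hr), h1]
      linear_combination z s ^ 2 * h2
    · -- a zero of `x` with `x' ≠ 0` is isolated, so the product vanishes there by continuity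
      exfalso
      have h1 : ∀ᶠ v in 𝓝[≠] s, x v ≠ 0 := by
        have := (h.x_deriv s hs).eventually_ne (c := 0) hc
        exact this
      have h2 : ∀ᶠ v in 𝓝[≠] s, x v * Real.cos (ψ v) + z v * Real.sin (ψ v) = 0 := by
        filter_upwards [h1, nhdsWithin_le_nhds (h.isOpen.mem_nhds hs)] with v hv hvI
        exact (mul_eq_zero.1 (h.x_mul_eq_zero hvI)).resolve_left hv
      have h3 := (hFc.continuousAt (h.isOpen.mem_nhds hs)).tendsto.mono_left
        (nhdsWithin_le_nhds (s := {s}ᶜ))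
      exact hF (tendsto_nhds_unique h3
        (tendsto_const_nhds.congr' (h2.mono fun v hv => hv.symm)))
  have hGc : ContinuousOn (fun s => radComp x z ψ s ^ 2) I :=
    (hFc.div h.rad_cont fun s hs => (h.rad_pos hs).ne').pow 2
  rcases hsq s hs with h1 | h1
  · rw [pow_eq_zero_iff two_ne_zero, radComp, div_eq_zero_iff] at h1
    exact h1.resolve_right (h.rad_pos hs).ne'
  · exfalso
    have h0 : radComp x z ψ 0 ^ 2 = 0 := by simp [radComp, h.x_zero, h.ψ_zero]
    obtain ⟨v, hv, hv2⟩ := h.ordConnected.isPreconnected.intermediate_value h.zero_mem hs hGc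
      (show (1 / 2 : ℝ) ∈ _ by simp only [h0, h1]; norm_num)
    simp only at hv2
    rcases hsq v hv with h2 | h2 <;> rw [h2] at hv2 <;> norm_num at hv2

/-- For `α = -2` every solution is a piece of the unit circle. -/
theorem IsSolution.eq_of_neg_two (h : IsSolution (-2) I x z ψ) {s : ℝ} (hs : s ∈ I) :
    x s = Real.sin s ∧ z s = Real.cos s ∧ ψ s = -s := by
  have const : ∀ f : ℝ → ℝ, (∀ v ∈ I, HasDerivAt f 0 v) → ∀ v ∈ I, f v = f 0 := fun f hf v hv =>
    h.isOpen.is_const_of_deriv_eq_zero h.ordConnected.isPreconnected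
      (fun v hv => (hf v hv).differentiableAt.differentiableWithinAt)
      (fun v hv => (hf v hv).deriv) hv h.zero_mem
  have hr : ∀ v ∈ I, x v ^ 2 + z v ^ 2 = 1 := by
    intro v hv
    have := const (fun s => x s ^ 2 + z s ^ 2) (fun v hv => by
      refine (((h.x_deriv v hv).pow 2).add ((h.z_deriv v hv).pow 2)).congr_deriv ?_
      simp only [Nat.add_one_sub_one, Nat.cast_ofNat, pow_one]
      linear_combination 2 * h.radial_eq_zero hv) v hv
    simp only [h.x_zero, h.z_zero] at this
    linarith
  have hAsq : ∀ v ∈ I, (z v * Real.cos (ψ v) - x v * Real.sin (ψ v)) ^ 2 = 1 := by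
    intro v hv
    have h1 := h.radial_eq_zero hv
    have h2 := Real.sin_sq_add_cos_sq (ψ v)
    linear_combination (x v ^ 2 + z v ^ 2) * h2 + hr v hv
      - (x v * Real.cos (ψ v) + z v * Real.sin (ψ v)) * h1
  have hAc : ContinuousOn (fun v => z v * Real.cos (ψ v) - x v * Real.sin (ψ v)) I :=
    (h.z_cont.mul (Real.continuous_cos.comp_continuousOn h.ψ_cont)).sub
      (h.x_cont.mul (Real.continuous_sin.comp_continuousOn h.ψ_cont))
  have hA : ∀ v ∈ I, z v * Real.cos (ψ v) - x v * Real.sin (ψ v) = 1 := by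
    intro v hv
    rcases sq_eq_one_iff.1 (hAsq v hv) with h1 | h1
    · exact h1
    · exfalso
      have h0 : z 0 * Real.cos (ψ 0) - x 0 * Real.sin (ψ 0) = 1 := by
        simp [h.x_zero, h.z_zero, h.ψ_zero]
      obtain ⟨w, hw, hw0⟩ := h.ordConnected.isPreconnected.intermediate_value hv h.zero_mem hAc
        (show (0 : ℝ) ∈ _ by simp only [h0, h1]; norm_num)
      have h2 := hAsq w hw
      simp only at hw0
      rw [hw0] at h2
      norm_num at h2
  have hcos : ∀ v ∈ I, Real.cos (ψ v) = z v := fun v hv => by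
    linear_combination (-Real.cos (ψ v)) * hr v hv + x v * h.radial_eq_zero hv + z v * hA v hv
  have hsin : ∀ v ∈ I, Real.sin (ψ v) = -x v := fun v hv => by
    linear_combination (-Real.sin (ψ v)) * hr v hv + z v * h.radial_eq_zero hv - x v * hA v hv
  have hx' : ∀ v ∈ I, HasDerivAt x (z v) v := fun v hv => hcos v hv ▸ h.x_deriv v hv
  have hz' : ∀ v ∈ I, HasDerivAt z (-x v) v := fun v hv => hsin v hv ▸ h.z_deriv v hv
  have hP := const (fun v => x v * Real.cos v - z v * Real.sin v) (fun v hv => by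
    refine (((hx' v hv).mul (Real.hasDerivAt_cos v)).sub
      ((hz' v hv).mul (Real.hasDerivAt_sin v))).congr_deriv ?_
    ring) s hs
  have hQ := const (fun v => x v * Real.sin v + z v * Real.cos v) (fun v hv => by
    refine (((hx' v hv).mul (Real.hasDerivAt_sin v)).add
      ((hz' v hv).mul (Real.hasDerivAt_cos v))).congr_deriv ?_
    ring) s hs
  simp only [h.x_zero, h.z_zero, Real.sin_zero, Real.cos_zero] at hP hQ
  have h1 := Real.sin_sq_add_cos_sq s
  have hθ := const (fun v => ψ v + v) (fun v hv => by
    have hψd : HasDerivAt ψ (deriv ψ v) v :=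
      ((h.ψ_contDiffOn.differentiableOn one_ne_zero).differentiableAt
        (h.isOpen.mem_nhds hv)).hasDerivAt
    have hz2 : HasDerivAt z (-Real.sin (ψ v) * deriv ψ v) v :=
      hψd.cos.congr_of_eventuallyEq
        (by filter_upwards [h.isOpen.mem_nhds hv] with w hw using (hcos w hw).symm)
    have hx2 : HasDerivAt x (-(Real.cos (ψ v) * deriv ψ v)) v :=
      hψd.sin.neg.congr_of_eventuallyEq
        (by
          filter_upwards [h.isOpen.mem_nhds hv] with w hw
          simp only [Pi.neg_apply, hsin w hw, neg_neg])
    have e1 := hz2.unique (h.z_deriv v hv)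
    have e2 := hx2.unique (h.x_deriv v hv)
    refine (hψd.add (hasDerivAt_id v)).congr_deriv ?_
    have e3 := Real.sin_sq_add_cos_sq (ψ v)
    linear_combination (-Real.sin (ψ v)) * e1 - Real.cos (ψ v) * e2
      - (deriv ψ v + 1) * e3) s hs
  simp only [h.ψ_zero] at hθ
  refine ⟨?_, ?_, by linarith⟩
  · linear_combination Real.cos s * hP + Real.sin s * hQ - x s * h1
  · linear_combination Real.cos s * hQ - Real.sin s * hP - z s * h1

theorem IsMaximalSolution.image_of_eq_neg_two (h : IsMaximalSolution (-2) I x z ψ) :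
    (fun s => (x s, z s)) '' I = {p : ℝ × ℝ | p.1 ^ 2 + p.2 ^ 2 = 1} := by
  have hI : univ = I := h.2 univ _ _ _ isSolution_neg_two (subset_univ _)
    (fun s hs => (h.1.eq_of_neg_two hs).1.symm) (fun s hs => (h.1.eq_of_neg_two hs).2.1.symm)
    (fun s hs => (h.1.eq_of_neg_two hs).2.2.symm)
  have hval : ∀ s, x s = Real.sin s ∧ z s = Real.cos s := fun s => by
    have := h.1.eq_of_neg_two (hI ▸ mem_univ s)
    exact ⟨this.1, this.2.1⟩
  ext p
  constructor
  · rintro ⟨s, -, rfl⟩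
    simp only [mem_ofPred_eq, (hval s).1, (hval s).2]
    exact Real.sin_sq_add_cos_sq s
  · intro hp
    have hp : p.1 ^ 2 + p.2 ^ 2 = 1 := hp
    have hn : ‖(⟨p.2, p.1⟩ : ℂ)‖ = 1 := by
      rw [← sq_eq_sq₀ (norm_nonneg _) zero_le_one, ← Complex.normSq_eq_norm_sq,
        Complex.normSq_mk]
      linarith
    have h1 := Complex.norm_mul_cos_arg (⟨p.2, p.1⟩ : ℂ)
    have h2 := Complex.norm_mul_sin_arg (⟨p.2, p.1⟩ : ℂ)
    rw [hn, one_mul] at h1 h2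
    exact ⟨Complex.arg ⟨p.2, p.1⟩, hI ▸ mem_univ _,
      Prod.ext ((hval _).1.trans h2) ((hval _).2.trans h1)⟩

end StationaryCurve

theorem theorem5p3 (α : ℝ) (hα : α ≤ -2) (I : Set ℝ) (x z ψ : ℝ → ℝ)
    (hγ : StationaryCurve.IsMaximalSolution α I x z ψ) :
    (α < -2 →
      Set.InjOn (fun s => (x s, z s)) I ∧
      StationaryCurve.IsEmbeddedClosedCurve ((fun s => (x s, z s)) '' I ∪ {(0, 0)}) ∧
      (StationaryCurve.IsSmoothCurveAt ((fun s => (x s, z s)) '' I ∪ {(0, 0)}) (0, 0) ↔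
        α = -4)) ∧
    (α = -2 → (fun s => (x s, z s)) '' I = {p : ℝ × ℝ | p.1 ^ 2 + p.2 ^ 2 = 1}) ∧
    (-4 < α → α < -2 → (∃ s ∈ I, 0 < z s) ∧ (∃ s ∈ I, z s < 0)) ∧
    (α = -4 → (fun s => (x s, z s)) '' I ∪ {(0, 0)} =
      {p : ℝ × ℝ | p.1 ^ 2 + (p.2 - 1 / 2) ^ 2 = (1 / 2) ^ 2}) ∧
    (α < -4 → (∀ s ∈ I, 0 < z s) ∧
      StationaryCurve.IsBigraph ((fun s => (x s, z s)) '' I)) := by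
  refine ⟨fun h2 => ⟨hγ.1.injOn h2, hγ.isEmbeddedClosedCurve h2, hγ.eq_neg_four h2, ?_⟩,
    ?_, fun h4 h2 => ⟨⟨0, hγ.1.zero_mem, by rw [hγ.1.z_zero]; exact one_pos⟩,
      hγ.exists_z_neg h2 h4⟩, ?_, fun h4 => ⟨hγ.z_pos h4, hγ.isBigraph h4⟩⟩
  · rintro rfl
    rw [hγ.image_of_eq_neg_four]
    exact StationaryCurve.isSmoothCurveAt_circle
  · rintro rfl
    exact hγ.image_of_eq_neg_two
  · rintro rfl
    exact hγ.image_of_eq_neg_four
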